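/- A strategic-form game with agents $1,\dots,n$, finite action sets $A_1,\dots,A_n$ and utilities $U_i(a)\in\mathbb R$ is given. A strong Nash equilibrium (SNE) is a profile of independent mixed strategies such that no nonempty coalition can, by jointly changing the mixed strategies of its members while the other agents keep theirs, strictly increase the expected utility of every one of its members. For $\sigma>0$, the perturbed game $\tilde U=U+Z$ is obtained by adding independent noise to all entries of all utility arrays, each entry of $Z$ being uniform on $[-\sigma,\sigma]$ (uniform perturbation) or normal with mean $0$ and standard deviation $\sigma$ (Gaussian perturbation). **Theorem 5.1 (Finding an SNE is in smoothed-$\mathcal P$).** (1) There is a deterministic algorithm (a real random-access program: exact real arithmetic and comparisons at unit cost) that, on every 2-agent game with real payoffs and nonempty finite action sets, halts and returns an SNE or correctly reports that none exists, and whose smoothed running time is polynomial: for the uniform and for the Gaussian perturbation there are constants $c,k_1,k_2>0$ such that for all $0<\sigma<1$ and every 2-agent game $U$ with at most $m$ actions per agent $$\mathbb E_{Z}\big[t(U+Z)\big]\le c\,m^{k_1}\sigma^{-k_2},$$ where $t(\tilde U)$ is the number of steps of the algorithm on $\tilde U$. (2) For every number $n$ of agents, every game $U$, every $\sigma>0$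 and both perturbation models, almost surely every SNE of the perturbed game $U+Z$ is in pure strategies. -/

import Mathlib

open MeasureTheory ProbabilityTheory
open scoped ENNReal

namespace StrongNash

/-! ### Games and strong Nash equilibria -/

/-- Pure action profiles of an `n`-agent game in which agent `i` has `m i` actions. -/
abbrev Profile {n : ℕ} (m : Fin n → ℕ) : Type := ∀ i, Fin (m i)

/-- A strategic-form game: `U i a` is the utility of agent `i` at the action profile `a`. -/
abbrev Game {n : ℕ} (m : Fin n → ℕ) : Type := Fin n → Profile m → ℝ

/-- Candidate mixed-strategy profiles: `x i a` is the probability with which agent `i` plays `a`. -/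
abbrev Strategies {n : ℕ} (m : Fin n → ℕ) : Type := ∀ i, Fin (m i) → ℝ

/-- Every `x i` is a probability vector. -/
def IsMixed {n : ℕ} {m : Fin n → ℕ} (x : Strategies m) : Prop :=
  ∀ i, x i ∈ stdSimplex ℝ (Fin (m i))

/-- Every agent plays one of her actions with probability one. -/
def IsPure {n : ℕ} {m : Fin n → ℕ} (x : Strategies m) : Prop :=
  ∀ i, ∃ a, x i = Pi.single a 1

/-- Expected utility of agent `i` when the agents randomize independently according to `x`. -/
def expectedUtility {n : ℕ} {m : Fin n → ℕ} (U : Game m) (x : Strategies m) (i : Fin n) : ℝ :=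
  ∑ a : Profile m, (∏ j, x j (a j)) * U i a

/-- Strong Nash equilibrium: no nonempty coalition `C` has a joint deviation to mixed strategies
of its members (the other agents keeping theirs) that is strictly better for every member. -/
def IsSNE {n : ℕ} {m : Fin n → ℕ} (U : Game m) (x : Strategies m) : Prop :=
  IsMixed x ∧
    ∀ C : Finset (Fin n), C.Nonempty → ∀ y : Strategies m, IsMixed y → (∀ i ∉ C, y i = x i) →
      ∃ i ∈ C, expectedUtility U y i ≤ expectedUtility U x i

/-! ### Perturbations -/

/-- The two perturbation models. -/
inductive PerturbationModel
  | uniform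
  | gaussian

/-- Law of the noise added to one payoff entry: uniform on `[-σ, σ]`, respectively normal with
mean `0` and standard deviation `σ`. -/
noncomputable def PerturbationModel.entryNoise (D : PerturbationModel) (σ : ℝ) : Measure ℝ :=
  match D with
  | .uniform => volume[|Set.Icc (-σ) σ]
  | .gaussian => gaussianReal 0 (Real.toNNReal (σ ^ 2))

/-- Law of the noise added to a whole game: all entries of all utility arrays are perturbed
independently. The perturbed version of `U` is `U + Z`, with `Z` drawn from this law. -/
noncomputable def PerturbationModel.noise (D : PerturbationModel) (σ : ℝ) {n : ℕ}
    (m : Fin n → ℕ) : Measure (Game m) :=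
  Measure.pi fun _ => Measure.pi fun _ => D.entryNoise σ

/-! ### Real random-access programs with a step count

Exact real arithmetic and exact comparison of reals at unit cost. A program is a finite piece of
code, the same for all input sizes. There is no conversion between reals and integers, other than
by branching on comparisons, and the only constants are integers. -/

/-- Integer expressions: constants, variables, array cells `arr[i]`, sum, truncated difference,
product. -/
inductive NatExpr
  | const (k : ℕ)
  | var (v : ℕ)
  | get (arr : ℕ) (i : NatExpr)
  | add (e f : NatExpr)
  | sub (e f : NatExpr)
  | mul (e f : NatExpr)

/-- Real expressions: integer constants, cells `arr[i]` of real arrays, field operations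
(with quotient `0` for a zero divisor). -/
inductive RealExpr
  | const (k : ℤ)
  | get (arr : ℕ) (i : NatExpr)
  | add (e f : RealExpr)
  | sub (e f : RealExpr)
  | mul (e f : RealExpr)
  | div (e f : RealExpr)

/-- Tests. -/
inductive Test
  | natLe (e f : NatExpr)
  | realLe (e f : RealExpr)
  | not (b : Test)
  | and (b c : Test)

/-- Programs. -/
inductive Program
  | nop
  | setNat (v : ℕ) (e : NatExpr)
  | putNat (arr : ℕ) (i e : NatExpr)
  | putReal (arr : ℕ) (i : NatExpr) (e : RealExpr)
  | seq (p q : Program)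
  | ite (b : Test) (p q : Program)
  | loop (b : Test) (p : Program)

/-- Memory: integer variables, integer arrays and real arrays, each indexed by natural numbers. -/
structure State where
  var : ℕ → ℕ
  natArr : ℕ → ℕ → ℕ
  realArr : ℕ → ℕ → ℝ

/-- Value of an integer expression. -/
def NatExpr.eval (s : State) : NatExpr → ℕ
  | .const k => k
  | .var v => s.var v
  | .get arr i => s.natArr arr (i.eval s)
  | .add e f => e.eval s + f.eval s
  | .sub e f => e.eval s - f.eval s
  | .mul e f => e.eval s * f.eval s

/-- Number of operations of an integer expression. -/
def NatExpr.cost : NatExpr → ℕ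
  | .const _ => 1
  | .var _ => 1
  | .get _ i => i.cost + 1
  | .add e f => e.cost + f.cost + 1
  | .sub e f => e.cost + f.cost + 1
  | .mul e f => e.cost + f.cost + 1

/-- Value of a real expression. -/
noncomputable def RealExpr.eval (s : State) : RealExpr → ℝ
  | .const k => k
  | .get arr i => s.realArr arr (i.eval s)
  | .add e f => e.eval s + f.eval s
  | .sub e f => e.eval s - f.eval s
  | .mul e f => e.eval s * f.eval s
  | .div e f => e.eval s / f.eval s

/-- Number of operations of a real expression. -/
def RealExpr.cost : RealExpr → ℕ
  | .const _ => 1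
  | .get _ i => i.cost + 1
  | .add e f => e.cost + f.cost + 1
  | .sub e f => e.cost + f.cost + 1
  | .mul e f => e.cost + f.cost + 1
  | .div e f => e.cost + f.cost + 1

/-- Truth of a test. -/
def Test.Holds (s : State) : Test → Prop
  | .natLe e f => e.eval s ≤ f.eval s
  | .realLe e f => e.eval s ≤ f.eval s
  | .not b => ¬ b.Holds s
  | .and b c => b.Holds s ∧ c.Holds s

/-- Number of operations of a test. -/
def Test.cost : Test → ℕ
  | .natLe e f => e.cost + f.cost + 1
  | .realLe e f => e.cost + f.cost + 1
  | .not b => b.cost + 1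
  | .and b c => b.cost + c.cost + 1

/-- Assignment to an integer variable. -/
def State.setNat (s : State) (v k : ℕ) : State :=
  { s with var := Function.update s.var v k }

/-- Assignment to a cell of an integer array. -/
def State.putNat (s : State) (arr i k : ℕ) : State :=
  { s with natArr := Function.update s.natArr arr (Function.update (s.natArr arr) i k) }

/-- Assignment to a cell of a real array. -/
def State.putReal (s : State) (arr i : ℕ) (r : ℝ) : State :=
  { s with realArr := Function.update s.realArr arr (Function.update (s.realArr arr) i r) }

/-- `Runs p s t s'`: started in `s`, the program `p` halts in `s'` after exactly `t` steps. -/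
inductive Runs : Program → State → ℕ → State → Prop
  | nop (s : State) : Runs .nop s 1 s
  | setNat (s : State) (v : ℕ) (e : NatExpr) :
      Runs (.setNat v e) s (e.cost + 1) (s.setNat v (e.eval s))
  | putNat (s : State) (arr : ℕ) (i e : NatExpr) :
      Runs (.putNat arr i e) s (i.cost + e.cost + 1) (s.putNat arr (i.eval s) (e.eval s))
  | putReal (s : State) (arr : ℕ) (i : NatExpr) (e : RealExpr) :
      Runs (.putReal arr i e) s (i.cost + e.cost + 1) (s.putReal arr (i.eval s) (e.eval s))
  | seq {p q : Program} {s s' s'' : State} {t t' : ℕ} :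
      Runs p s t s' → Runs q s' t' s'' → Runs (.seq p q) s (t + t') s''
  | iteTrue {b : Test} {p : Program} (q : Program) {s s' : State} {t : ℕ} :
      b.Holds s → Runs p s t s' → Runs (.ite b p q) s (b.cost + 1 + t) s'
  | iteFalse {b : Test} (p : Program) {q : Program} {s s' : State} {t : ℕ} :
      ¬ b.Holds s → Runs q s t s' → Runs (.ite b p q) s (b.cost + 1 + t) s'
  | loopDone {b : Test} (p : Program) {s : State} :
      ¬ b.Holds s → Runs (.loop b p) s (b.cost + 1) s
  | loopStep {b : Test} {p : Program} {s s' s'' : State} {t t' : ℕ} :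
      b.Holds s → Runs p s t s' → Runs (.loop b p) s' t' s'' →
        Runs (.loop b p) s (b.cost + 1 + t + t') s''

/-- Running time of `p` from `s`; it is `∞` if `p` does not halt. (Execution is deterministic, so
there is at most one `t` in the infimum.) -/
noncomputable def Program.time (p : Program) (s : State) : ℝ≥0∞ :=
  ⨅ (t : ℕ) (_ : ∃ s', Runs p s t s'), (t : ℝ≥0∞)

/-! ### Finding strong Nash equilibria of 2-agent games -/

/-- Input convention for 2-agent games: variables `0` and `1` hold the numbers of actions, real
array `i` (`i = 0, 1`) holds the utility matrix of agent `i` in row-major order, and everything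
else is `0`. -/
noncomputable def inputState {m : Fin 2 → ℕ} (U : Game m) : State where
  var v := if v = 0 then m 0 else if v = 1 then m 1 else 0
  natArr _ _ := 0
  realArr arr k := ∑ i : Fin 2, ∑ a : Profile m,
    if arr = i.val ∧ k = (a 0).val * m 1 + (a 1).val then U i a else 0

/-- Output convention: variable `2` is `0` for the answer "non-existence"; otherwise the answer is
the strategy profile stored in the real arrays `2` (agent `0`) and `3` (agent `1`). -/
def output (m : Fin 2 → ℕ) (s : State) : Option (Strategies m) :=
  if s.var 2 = 0 then none else some fun i a => s.realArr (2 + i.val) a.val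

/-- Correct answers to the problem of finding a strong Nash equilibrium. -/
def CorrectAnswer {m : Fin 2 → ℕ} (U : Game m) : Option (Strategies m) → Prop
  | none => ¬ ∃ x, IsSNE U x
  | some x => IsSNE U x

/-- On every 2-agent game, without exception, the program halts with a correct answer. -/
def FindsSNE (p : Program) : Prop :=
  ∀ (m : Fin 2 → ℕ), (∀ i, 1 ≤ m i) → ∀ U : Game m,
    ∃ t s, Runs p (inputState U) t s ∧ CorrectAnswer U (output m s)

/-- Smoothed running time at `U`: the expected running time on the perturbed game. -/
noncomputable def smoothedTime (p : Program) (D : PerturbationModel) (σ : ℝ) {m : Fin 2 → ℕ}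
    (U : Game m) : ℝ≥0∞ :=
  ∫⁻ Z, p.time (inputState (U + Z)) ∂(D.noise σ m)

/-- Smoothed polynomial time: the smoothed running time is at most `c * M ^ k₁ * σ ^ (-k₂)`, where
`M` is the number of actions per agent (the larger one, if they differ). The constants depend
neither on the game nor on `σ`. -/
def SmoothedPolynomialTime (p : Program) (D : PerturbationModel) : Prop :=
  ∃ c k₁ k₂ : ℝ, 0 < c ∧ 0 < k₁ ∧ 0 < k₂ ∧
    ∀ σ : ℝ, 0 < σ → σ < 1 → ∀ m : Fin 2 → ℕ, (∀ i, 1 ≤ m i) → ∀ U : Game m,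
      smoothedTime p D σ U ≤
        ENNReal.ofReal (c * ((max (m 0) (m 1) : ℕ) : ℝ) ^ k₁ * σ ^ (-k₂))

end StrongNash

namespace StrongNash

/-! ### Null sets of games -/

/-! Both noise laws are absolutely continuous, so it suffices to treat Lebesgue-almost every game.

Purity (`ae_sne_isPure`). Suppose that a strong equilibrium is not pure. If only one agent mixes,
she is indifferent between two pure profiles, so two payoffs coincide. If agents i and j both mix,
indifference makes their own shifts of probability free to first order; if each shift also moved the
payoff of the other agent, suitable small simultaneous shifts would profit both
(`IsSNE.not_both_reactive`). Hence one of them, say i, is indifferent between two support actions of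
j, while everyone is indifferent within her own support. This is one equation too many.
`ae_notMem_indifferent` makes the dimension count rigorous: the exceptional games lie in the image
of a null set under a differentiable map from the space of games to itself. The map trades payoffs
for strategies: some payoffs at unilateral deviations from a base profile are replaced by strategy
weights and recovered from the indifference equations, in which they occur linearly with coefficient
one.

Algorithm. For two agents, `BiSNE.pure_of_no_coincidence` shows that a mixed strong equilibrium
forces a polynomial identity between payoffs on two rows and two columns. Either one agent's shifts
move the other's payoff, and then the second-order terms of the latter vanish; or there are no
first-order effects, the two second-order bilinear forms never have the same strict sign, and they
are proportional (`bilinear_proportional`). Such coincidences form a null set (`ae_no_coincidence`)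
and are found by exhaustive search in time of order M^4. Without them the pure profiles are the only
candidates. With them, the program builds finite but possibly enormous candidate lists; this branch
has probability zero, so it only has to halt and be correct. The expected time is thus at most a
constant times M^8, whatever the noise level.

Two facts make the program correct on every game. First, the expanded lists are complete: every
strategy is a convex combination of candidates that respect its support and all weak comparisons of
the opponent's payoffs, one of these candidates pays the opponent at least as much, and
`BiSNE.exchange` passes to it. The lists arise from the pure strategies by adding crossing points
with hyperplanes (`Covers.insert`). Second, a given pair can be verified by field operations: a
joint improvement can be taken on two rows and two columns (`exists_two_point`, applied on both
sides), where its existence amounts to positivity of a binary quadratic form on a planar cone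
(`exists_coneGood_iff`). -/

theorem pi_absolutelyContinuous_fin {n : ℕ} {α : Fin n → Type*} [∀ i, MeasurableSpace (α i)]
    {μ ν : ∀ i, Measure (α i)} [∀ i, SigmaFinite (μ i)] [∀ i, SigmaFinite (ν i)]
    (h : ∀ i, μ i ≪ ν i) : Measure.pi μ ≪ Measure.pi ν := by
  induction n with
  | zero =>
    rw [Measure.pi_of_empty μ, Measure.pi_of_empty ν]
  | succ n ih =>
    have h1 := (measurePreserving_piFinSuccAbove μ 0).symm
    have h2 := (measurePreserving_piFinSuccAbove ν 0).symm
    rw [← h1.map_eq, ← h2.map_eq]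
    exact ((h 0).prod (ih fun i => h _)).map h1.measurable

theorem pi_absolutelyContinuous {ι : Type*} [Fintype ι] {α : ι → Type*}
    [∀ i, MeasurableSpace (α i)] {μ ν : ∀ i, Measure (α i)} [∀ i, SigmaFinite (μ i)]
    [∀ i, SigmaFinite (ν i)] (h : ∀ i, μ i ≪ ν i) : Measure.pi μ ≪ Measure.pi ν := by
  let e := (Fintype.equivFin ι).symm
  have h1 := measurePreserving_piCongrLeft μ e
  have h2 := measurePreserving_piCongrLeft ν e
  rw [← h1.map_eq, ← h2.map_eq]
  exact (pi_absolutelyContinuous_fin fun i => h _).map h1.measurable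

theorem entryNoise_absolutelyContinuous (D : PerturbationModel) {σ : ℝ} (hσ : 0 < σ) :
    D.entryNoise σ ≪ volume := by
  cases D with
  | uniform => exact cond_absolutelyContinuous
  | gaussian =>
    refine gaussianReal_absolutelyContinuous 0 ?_
    simp [hσ.ne']

theorem isProbabilityMeasure_entryNoise (D : PerturbationModel) {σ : ℝ} (hσ : 0 < σ) :
    IsProbabilityMeasure (D.entryNoise σ) := by
  cases D with
  | uniform =>
    refine cond_isProbabilityMeasure_of_finite ?_ ?_
    · simp [hσ]
    · simp
  | gaussian =>
    unfold PerturbationModel.entryNoise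
    infer_instance

theorem isProbabilityMeasure_noise (D : PerturbationModel) {σ : ℝ} (hσ : 0 < σ) {n : ℕ}
    (m : Fin n → ℕ) : IsProbabilityMeasure (D.noise σ m) := by
  have := isProbabilityMeasure_entryNoise D hσ
  unfold PerturbationModel.noise
  infer_instance

theorem noise_absolutelyContinuous (D : PerturbationModel) {σ : ℝ} (hσ : 0 < σ) {n : ℕ}
    (m : Fin n → ℕ) : D.noise σ m ≪ (volume : Measure (Game m)) := by
  have := isProbabilityMeasure_entryNoise D hσ
  exact pi_absolutelyContinuous fun _ => pi_absolutelyContinuous fun _ =>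
    entryNoise_absolutelyContinuous D hσ

instance isAddHaarMeasure_volume_game {n : ℕ} (m : Fin n → ℕ) :
    (volume : Measure (Game m)).IsAddHaarMeasure :=
  have : (volume : Measure (Profile m → ℝ)).IsAddHaarMeasure := isAddHaarMeasure_volume_pi _
  Measure.pi.isAddHaarMeasure fun _ : Fin n => (volume : Measure (Profile m → ℝ))

/-- A property that holds for Lebesgue-almost all games holds almost surely for a perturbed game. -/
theorem ae_noise_of_ae_volume (D : PerturbationModel) {σ : ℝ} (hσ : 0 < σ) {n : ℕ}
    {m : Fin n → ℕ} (U : Game m) {P : Game m → Prop} (h : ∀ᵐ V : Game m, P V) :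
    ∀ᵐ Z ∂(D.noise σ m), P (U + Z) := by
  apply (noise_absolutelyContinuous D hσ m).ae_le
  exact (measurePreserving_add_left volume U).quasiMeasurePreserving.ae h

/-- A measurable set meeting every line in direction `e` at most once is null. -/
theorem ae_notMem_of_subsingleton_lines {E : Type*} [NormedAddCommGroup E] [NormedSpace ℝ E]
    [FiniteDimensional ℝ E] [MeasurableSpace E] [BorelSpace E] (μ : Measure E)
    [μ.IsAddHaarMeasure] {s : Set E} (hs : MeasurableSet s) (e : E)
    (h : ∀ x, {t : ℝ | x + t • e ∈ s}.Subsingleton) : ∀ᵐ x ∂μ, x ∉ s := by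
  have := FiniteDimensional.proper ℝ E
  refine ae_mem_of_ae_add_linearMap_mem (LinearMap.toSpanSingleton ℝ E e) volume μ hs.compl ?_
  intro y
  filter_upwards [measure_eq_zero_iff_ae_notMem.1 ((h y).measure_zero volume)] with t ht
  exact ht

/-! ### Multilinearity of expected utilities and deviations from a strong equilibrium -/

section Utilities

variable {n : ℕ} {m : Fin n → ℕ}

/-- Expected utility of agent `i` when agent `j` switches to her action `b`. -/
noncomputable def condUtility (U : Game m) (x : Strategies m) (i j : Fin n) (b : Fin (m j)) : ℝ :=
  expectedUtility U (Function.update x j (Pi.single b 1)) i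

theorem prod_update_apply (x : Strategies m) (j : Fin n) (v : Fin (m j) → ℝ) (a : Profile m) :
    ∏ l, Function.update x j v l (a l) = v (a j) * ∏ l ∈ Finset.univ.erase j, x l (a l) := by
  rw [← Finset.mul_prod_erase _ _ (Finset.mem_univ j)]
  congr 1
  · simp
  · refine Finset.prod_congr rfl fun l hl => ?_
    rw [Function.update_of_ne (Finset.ne_of_mem_erase hl)]

theorem expectedUtility_update (U : Game m) (x : Strategies m) (i j : Fin n)
    (v : Fin (m j) → ℝ) :
    expectedUtility U (Function.update x j v) i = ∑ b, v b * condUtility U x i j b := by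
  simp only [condUtility, expectedUtility, prod_update_apply, Finset.mul_sum]
  rw [Finset.sum_comm]
  refine Finset.sum_congr rfl fun a _ => ?_
  rw [Finset.sum_eq_single (a j)]
  · simp [mul_assoc]
  · intro b _ hb
    simp [Pi.single_eq_of_ne' hb]
  · simp

theorem expectedUtility_eq_sum_condUtility (U : Game m) (x : Strategies m) (i j : Fin n) :
    expectedUtility U x i = ∑ b, x j b * condUtility U x i j b := by
  rw [← expectedUtility_update, Function.update_eq_self]

theorem expectedUtility_smul_strategies (U : Game m) (r : Fin n → ℝ) (x : Strategies m)
    (i : Fin n) :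
    expectedUtility U (fun l b => r l * x l b) i = (∏ l, r l) * expectedUtility U x i := by
  simp only [expectedUtility, Finset.prod_mul_distrib, Finset.mul_sum, mul_assoc]

theorem expectedUtility_add (U V : Game m) (x : Strategies m) (i : Fin n) :
    expectedUtility (U + V) x i = expectedUtility U x i + expectedUtility V x i := by
  simp only [expectedUtility, Pi.add_apply, mul_add, Finset.sum_add_distrib]

theorem expectedUtility_smul (t : ℝ) (U : Game m) (x : Strategies m) (i : Fin n) :
    expectedUtility (t • U) x i = t * expectedUtility U x i := by
  simp only [expectedUtility, Pi.smul_apply, smul_eq_mul, Finset.mul_sum]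
  exact Finset.sum_congr rfl fun a _ => by ring

theorem expectedUtility_congr {U V : Game m} {i : Fin n} (h : U i = V i) (x : Strategies m) :
    expectedUtility U x i = expectedUtility V x i := by
  simp only [expectedUtility, h]

theorem expectedUtility_of_eq_single {U : Game m} {i : Fin n} {z : Profile m} {r : ℝ}
    (h : U i = Pi.single z r) (x : Strategies m) :
    expectedUtility U x i = (∏ l, x l (z l)) * r := by
  simp only [expectedUtility, h]
  rw [Finset.sum_eq_single z]
  · simp
  · intro b _ hb
    simp [Pi.single_eq_of_ne hb]
  · simp

/-- The strategy `v` with probability `ε` moved from the action `b'` to the action `b`. -/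
noncomputable def shift {k : ℕ} (v : Fin k → ℝ) (b b' : Fin k) (ε : ℝ) : Fin k → ℝ :=
  v + ε • (Pi.single b 1 - Pi.single b' 1)

theorem shift_mem_stdSimplex {k : ℕ} {v : Fin k → ℝ} (hv : v ∈ stdSimplex ℝ (Fin k))
    (b b' : Fin k) {ε : ℝ} (h0 : 0 ≤ ε) (h1 : ε ≤ v b') :
    shift v b b' ε ∈ stdSimplex ℝ (Fin k) := by
  refine ⟨fun c => ?_, ?_⟩
  · have := hv.1 c
    simp only [shift, Pi.add_apply, Pi.smul_apply, Pi.sub_apply, smul_eq_mul, Pi.single_apply]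
    split_ifs with h2 h3 h3
    · linarith
    · linarith
    · subst h3; linarith
    · linarith
  · simp [shift, Finset.sum_add_distrib, ← Finset.mul_sum, hv.2]

theorem expectedUtility_update_shift (U : Game m) (x : Strategies m) (i j : Fin n)
    (b b' : Fin (m j)) (ε : ℝ) :
    expectedUtility U (Function.update x j (shift (x j) b b' ε)) i =
      expectedUtility U x i + ε * (condUtility U x i j b - condUtility U x i j b') := by
  rw [expectedUtility_update, expectedUtility_eq_sum_condUtility U x i j]
  simp only [shift, Pi.add_apply, Pi.smul_apply, Pi.sub_apply, smul_eq_mul, add_mul,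
    Finset.sum_add_distrib, mul_assoc, ← Finset.mul_sum, sub_mul, Finset.sum_sub_distrib]
  simp [Pi.single_apply]

theorem IsMixed.update {x : Strategies m} (hx : IsMixed x) (j : Fin n) {v : Fin (m j) → ℝ}
    (hv : v ∈ stdSimplex ℝ (Fin (m j))) : IsMixed (Function.update x j v) := by
  intro l
  by_cases h : l = j
  · subst h; simpa using hv
  · simpa [Function.update_of_ne h] using hx l

theorem IsSNE.condUtility_le {U : Game m} {x : Strategies m} (h : IsSNE U x) (k : Fin n)
    (a : Fin (m k)) : condUtility U x k k a ≤ expectedUtility U x k := by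
  obtain ⟨i, hi, h2⟩ := h.2 {k} ⟨k, by simp⟩ (Function.update x k (Pi.single a 1))
    (h.1.update k (single_mem_stdSimplex ℝ a)) (by
      intro i hi
      rw [Function.update_of_ne (by simpa using hi)])
  rw [Finset.mem_singleton] at hi
  subst hi
  exact h2

/-- The utility is a weighted average of the utilities of the single actions, none of which exceeds
it; so every action with positive weight attains it. -/
theorem IsSNE.condUtility_eq {U : Game m} {x : Strategies m} (h : IsSNE U x) (k : Fin n)
    {a : Fin (m k)} (ha : 0 < x k a) : condUtility U x k k a = expectedUtility U x k := by
  have h1 : ∑ b, x k b * (expectedUtility U x k - condUtility U x k k b) = 0 := by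
    simp only [mul_sub, Finset.sum_sub_distrib, ← Finset.sum_mul, (h.1 k).2,
      ← expectedUtility_eq_sum_condUtility]
    ring
  rw [Finset.sum_eq_zero_iff_of_nonneg fun b _ =>
    mul_nonneg ((h.1 k).1 b) (sub_nonneg.2 (h.condUtility_le k b))] at h1
  have := h1 a (Finset.mem_univ a)
  rcases mul_eq_zero.1 this with h2 | h2
  · exact absurd h2 ha.ne'
  · linarith

theorem eventually_pos_add_mul_sq {p : ℝ} (hp : 0 < p) (K : ℝ) :
    ∀ᶠ ε : ℝ in nhdsWithin 0 (Set.Ioi 0), 0 < ε * p + ε ^ 2 * K := by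
  have h : Filter.Tendsto (fun ε : ℝ => p + ε * K) (nhdsWithin 0 (Set.Ioi 0)) (nhds (p + 0 * K)) :=
    ((continuous_const.add (continuous_id.mul continuous_const)).tendsto 0).mono_left
      nhdsWithin_le_nhds
  filter_upwards [h.eventually (lt_mem_nhds (a := 0) (by simpa using hp)), self_mem_nhdsWithin]
    with ε h1 h2
  have : 0 < ε * (p + ε * K) := mul_pos h2 h1
  nlinarith

/-- Two agents of a strong equilibrium cannot both react to moves of the other one within her
support. -/
theorem IsSNE.not_both_reactive {U : Game m} {x : Strategies m} (h : IsSNE U x) {i j : Fin n}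
    (hij : i ≠ j) {a a' : Fin (m i)} {b b' : Fin (m j)} (ha : 0 < x i a) (ha' : 0 < x i a')
    (hb : 0 < x j b) (hb' : 0 < x j b')
    (h1 : condUtility U x i j b' < condUtility U x i j b)
    (h2 : condUtility U x j i a' < condUtility U x j i a) : False := by
  -- Utility is affine in each of the two strategies, so simultaneous shifts by `ε` add a linear
  -- term and `ε ^ 2 * K`. For `i` and `j`, indifference kills the own contribution to the linear
  -- term, and the contribution of the other agent is positive.
  have key : ∀ k, ∃ K, ∀ ε, expectedUtility U
      (Function.update (Function.update x j (shift (x j) b b' ε)) i (shift (x i) a a' ε)) k =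
      expectedUtility U x k + (ε * ((condUtility U x k j b - condUtility U x k j b') +
        (condUtility U x k i a - condUtility U x k i a')) + ε ^ 2 * K) := by
    intro k
    refine ⟨(condUtility U (Function.update x i (Pi.single a 1)) k j b -
      condUtility U (Function.update x i (Pi.single a 1)) k j b') -
      (condUtility U (Function.update x i (Pi.single a' 1)) k j b -
      condUtility U (Function.update x i (Pi.single a' 1)) k j b'), fun ε => ?_⟩
    have h3 := expectedUtility_update_shift U (Function.update x j (shift (x j) b b' ε)) k i a a' ε
    rw [Function.update_of_ne hij] at h3
    have h4 : ∀ c, condUtility U (Function.update x j (shift (x j) b b' ε)) k i c =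
        condUtility U x k i c +
        ε * (condUtility U (Function.update x i (Pi.single c 1)) k j b -
          condUtility U (Function.update x i (Pi.single c 1)) k j b') := by
      intro c
      have h5 := expectedUtility_update_shift U (Function.update x i (Pi.single c 1)) k j b b' ε
      rw [Function.update_of_ne hij.symm] at h5
      rw [condUtility, Function.update_comm hij.symm, h5, ← condUtility]
    rw [h3, expectedUtility_update_shift, h4, h4]
    ring
  obtain ⟨K, hK⟩ := key i
  obtain ⟨L, hL⟩ := key j
  have e1 := h.condUtility_eq i ha
  have e2 := h.condUtility_eq i ha'
  have e3 := h.condUtility_eq j hb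
  have e4 := h.condUtility_eq j hb'
  have f1 : ∀ᶠ ε : ℝ in nhdsWithin 0 (Set.Ioi 0), ε ≤ x i a' :=
    nhdsWithin_le_nhds (ge_mem_nhds ha')
  have f2 : ∀ᶠ ε : ℝ in nhdsWithin 0 (Set.Ioi 0), ε ≤ x j b' :=
    nhdsWithin_le_nhds (ge_mem_nhds hb')
  obtain ⟨ε, g1, g2, g3, g4, g5⟩ := (f1.and (f2.and ((eventually_pos_add_mul_sq
    (p := (condUtility U x i j b - condUtility U x i j b') +
        (condUtility U x i i a - condUtility U x i i a')) (by linarith) K).and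
    ((eventually_pos_add_mul_sq
    (p := (condUtility U x j j b - condUtility U x j j b') +
        (condUtility U x j i a - condUtility U x j i a')) (by linarith) L).and
    self_mem_nhdsWithin)))).exists
  have g5 : 0 < ε := g5
  obtain ⟨k, hk, hle⟩ := h.2 {i, j} ⟨i, by simp⟩
    (Function.update (Function.update x j (shift (x j) b b' ε)) i (shift (x i) a a' ε))
    ((h.1.update j (shift_mem_stdSimplex (h.1 j) b b' g5.le g2)).update i
      (shift_mem_stdSimplex (h.1 i) a a' g5.le g1))
    (by
      intro k hk
      simp only [Finset.mem_insert, Finset.mem_singleton, not_or] at hk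
      rw [Function.update_of_ne hk.1, Function.update_of_ne hk.2])
  simp only [Finset.mem_insert, Finset.mem_singleton] at hk
  rcases hk with rfl | rfl
  · rw [hK] at hle; linarith
  · rw [hL] at hle; linarith

end Utilities

/-! ### Generic games: no agent is indifferent to the moves of another agent -/

section Generic

variable {n : ℕ} {m : Fin n → ℕ}

/-- The game in which agent `i` gets `1` at the profile `z` and all other payoffs vanish. -/
noncomputable def unitPayoff (i : Fin n) (z : Profile m) : Game m :=
  Pi.single i (Pi.single z (1 : ℝ))

theorem unitPayoff_self (i : Fin n) (z : Profile m) : unitPayoff i z i = Pi.single z 1 :=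
  Pi.single_eq_same _ _

variable (S : ∀ k, Finset (Fin (m k))) (a₀ : Profile m)

/-- The profiles at which only agent `k` deviates from `a₀`, to an action in her support. -/
def OnSlot (k : Fin n) (c : Profile m) : Prop :=
  c k ∈ S k ∧ ∀ l ≠ k, c l = a₀ l

open Classical in
/-- Weights stored in the unilateral deviations from `a₀`. -/
noncomputable def storedWeights (V : Game m) : Strategies m := fun k a =>
  if a = a₀ k then 1 else if a ∈ S k then V k (Function.update a₀ k a) else 0

open Classical in
/-- The game `V` with zero payoffs at the unilateral deviations. -/
noncomputable def clearSlots (V : Game m) : Game m := fun k c =>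
  if OnSlot S a₀ k c then 0 else V k c

open Classical in
/-- The game in which every agent is indifferent within her support against the stored weights. -/
noncomputable def solveSlots (V : Game m) : Game m := fun k c =>
  if OnSlot S a₀ k c then
    V k a₀ - condUtility (clearSlots S a₀ V) (storedWeights S a₀ V) k k (c k)
  else V k c

/-- Games with (unnormalized) strategies supported in `S`, for which every agent is indifferent
within her support and agent `i` is indifferent between the actions `b` and `a₀ j` of agent `j`. -/
def Indifferent (i j : Fin n) (b : Fin (m j)) : Set (Game m) :=
  {U | ∃ p : Strategies m, (∀ k, p k (a₀ k) = 1) ∧ (∀ k, ∀ a ∉ S k, p k a = 0) ∧ 0 < p j b ∧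
    (∀ k, ∀ a ∈ S k, condUtility U p k k a = condUtility U p k k (a₀ k)) ∧
    condUtility U p i j b = condUtility U p i j (a₀ j)}

variable {S a₀}

theorem onSlot_update {k : Fin n} {a : Fin (m k)} (ha : a ∈ S k) :
    OnSlot S a₀ k (Function.update a₀ k a) :=
  ⟨by simpa using ha, fun l hl => Function.update_of_ne hl _ _⟩

theorem OnSlot.eq_update {k : Fin n} {c : Profile m} (h : OnSlot S a₀ k c) :
    c = Function.update a₀ k (c k) := by
  ext l : 1
  by_cases hl : l = k
  · subst hl; simp
  · rw [Function.update_of_ne hl, h.2 l hl]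

/-- Against the base actions, all of weight one, the payoff at the slot of `a` has coefficient one.
The other slots of agent `k` require another action of hers and do not contribute. So each
indifference equation determines one slot. -/
theorem condUtility_eq_slot_add (U : Game m) {p : Strategies m} (hp : ∀ k, p k (a₀ k) = 1)
    {k : Fin n} {a : Fin (m k)} (ha : a ∈ S k) :
    condUtility U p k k a =
      U k (Function.update a₀ k a) + condUtility (clearSlots S a₀ U) p k k a := by
  rw [← sub_eq_iff_eq_add]
  simp only [condUtility, expectedUtility, ← Finset.sum_sub_distrib, ← mul_sub]
  rw [Finset.sum_eq_single (Function.update a₀ k a)]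
  · rw [prod_update_apply, clearSlots, if_pos (onSlot_update ha), Finset.prod_eq_one]
    · simp
    · intro l hl
      rw [Function.update_of_ne (Finset.ne_of_mem_erase hl), hp]
  · intro c _ hc
    by_cases h : OnSlot S a₀ k c
    · have : c k ≠ a := fun h' => hc (h' ▸ h.eq_update)
      rw [prod_update_apply, Pi.single_eq_of_ne this]
      simp
    · simp [clearSlots, if_neg h]
  · simp

/-- The preimage keeps the weights `p` in the slots. The slot `a₀` is free for another purpose,
since its weight is always one: it holds the common utility of agent `k` within her support. Solving
the indifference equations then returns the payoffs that were overwritten. -/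
theorem exists_solveSlots_eq (ha₀ : ∀ k, a₀ k ∈ S k) {U : Game m} {p : Strategies m}
    (hp : ∀ k, p k (a₀ k) = 1) (hpS : ∀ k, ∀ a ∉ S k, p k a = 0)
    (hU : ∀ k, ∀ a ∈ S k, condUtility U p k k a = condUtility U p k k (a₀ k)) :
    ∃ V, storedWeights S a₀ V = p ∧ solveSlots S a₀ V = U := by
  classical
  let V : Game m := fun k c => if OnSlot S a₀ k c then
    if c k = a₀ k then condUtility U p k k (a₀ k) else p k (c k) else U k c
  have h1 : storedWeights S a₀ V = p := by
    ext k a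
    simp only [storedWeights]
    split_ifs with h h'
    · rw [h, hp]
    · simp only [V]
      rw [if_pos (onSlot_update h')]
      simp [h]
    · rw [hpS k a h']
  have h2 : clearSlots S a₀ V = clearSlots S a₀ U := by
    ext k c
    simp only [clearSlots, V]
    split_ifs <;> rfl
  refine ⟨V, h1, ?_⟩
  ext k c
  simp only [solveSlots, h1, h2]
  split_ifs with h
  · have h3 : V k a₀ = condUtility U p k k (a₀ k) := by
      simp only [V]
      rw [if_pos ⟨ha₀ k, fun _ _ => rfl⟩]
      simp
    rw [h3, ← hU k (c k) h.1, condUtility_eq_slot_add U hp h.1, ← h.eq_update]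
    ring
  · simp only [V, if_neg h]

theorem differentiable_expectedUtility {E : Type*} [NormedAddCommGroup E] [NormedSpace ℝ E]
    {W : E → Game m} {y : E → Strategies m} {i : Fin n}
    (hW : ∀ c, Differentiable ℝ fun v => W v i c)
    (hy : ∀ l a, Differentiable ℝ fun v => y v l a) :
    Differentiable ℝ fun v => expectedUtility (W v) (y v) i := by
  unfold expectedUtility
  refine Differentiable.fun_sum fun c _ => Differentiable.fun_mul ?_ (hW c)
  induction (Finset.univ : Finset (Fin n)) using Finset.induction_on with
  | empty => simp
  | insert l s hl ih =>
    simp only [Finset.prod_insert hl]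
    exact (hy l (c l)).fun_mul ih

theorem differentiable_condUtility {E : Type*} [NormedAddCommGroup E] [NormedSpace ℝ E]
    {W : E → Game m} {y : E → Strategies m} {i j : Fin n} {b : Fin (m j)}
    (hW : ∀ c, Differentiable ℝ fun v => W v i c)
    (hy : ∀ l a, Differentiable ℝ fun v => y v l a) :
    Differentiable ℝ fun v => condUtility (W v) (y v) i j b := by
  refine differentiable_expectedUtility hW fun l a => ?_
  by_cases h : l = j
  · subst h
    simp only [Function.update_self]
    exact differentiable_const _
  · simp only [Function.update_of_ne h]
    exact hy l a

variable (S a₀) in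
theorem differentiable_storedWeights (k : Fin n) (a : Fin (m k)) :
    Differentiable ℝ fun V : Game m => storedWeights S a₀ V k a := by
  unfold storedWeights
  split_ifs <;> fun_prop

variable (S a₀) in
theorem differentiable_solveSlots : Differentiable ℝ (solveSlots (m := m) S a₀) := by
  rw [differentiable_pi]
  intro k
  rw [differentiable_pi]
  intro c
  unfold solveSlots
  split_ifs
  · refine Differentiable.fun_sub (by fun_prop) (differentiable_condUtility (fun c => ?_)
      (differentiable_storedWeights S a₀))
    unfold clearSlots
    split_ifs <;> fun_prop
  · fun_prop

/-- Moving the payoff of `i` at the deviation of `j` to `b`. -/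
theorem solveSlots_add_single (ha₀ : ∀ k, a₀ k ∈ S k) {i j : Fin n} (hij : i ≠ j) {b : Fin (m j)}
    (hb : b ≠ a₀ j) (V : Game m) (t : ℝ) :
    storedWeights S a₀ (V + t • unitPayoff i (Function.update a₀ j b)) =
      storedWeights S a₀ V ∧
    solveSlots S a₀ (V + t • unitPayoff i (Function.update a₀ j b)) i =
      (solveSlots S a₀ V + t • (unitPayoff i (Function.update a₀ j b) +
        (-storedWeights S a₀ V j b) • unitPayoff i a₀)) i := by
  classical
  set z : Profile m := Function.update a₀ j b with hz
  set e : Game m := unitPayoff i z with he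
  have hzj : z j = b := by simp [hz]
  have hzl : ∀ l ≠ j, z l = a₀ l := fun l hl => Function.update_of_ne hl _ _
  have hslot : ¬ OnSlot S a₀ i z := fun h => hb (hzj ▸ h.2 j hij.symm)
  have hei : e i = Pi.single z 1 := by simp [he, unitPayoff]
  have hek : ∀ k ≠ i, e k = 0 := fun k hk => by simp [he, unitPayoff, hk]
  have hza : ∀ c, OnSlot S a₀ i c → e i c = 0 := by
    intro c hc
    rw [hei, Pi.single_eq_of_ne]
    rintro rfl
    exact hslot hc
  have h1 : storedWeights S a₀ (V + t • e) = storedWeights S a₀ V := by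
    ext k a
    simp only [storedWeights]
    split_ifs with h h'
    · rfl
    · by_cases hk : k = i
      · subst hk
        simp [hza _ (onSlot_update h')]
      · simp [hek k hk]
    · rfl
  have h2 : clearSlots S a₀ (V + t • e) = clearSlots S a₀ V + t • e := by
    ext k c
    by_cases hk : k = i
    · subst hk
      by_cases hc : OnSlot S a₀ k c
      · simp [clearSlots, hc, hza c hc]
      · simp [clearSlots, hc]
    · simp [clearSlots, hek k hk]
  refine ⟨h1, ?_⟩
  ext c
  simp only [solveSlots, h1, h2, Pi.add_apply, Pi.smul_apply, smul_eq_mul]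
  by_cases hc : OnSlot S a₀ i c
  · rw [if_pos hc, if_pos hc, hza c hc, hza a₀ ⟨ha₀ i, fun _ _ => rfl⟩, condUtility, condUtility,
      expectedUtility_add, expectedUtility_smul, expectedUtility_of_eq_single hei,
      prod_update_apply]
    -- At `z` agent `i` plays `a₀ i`, so the raised payoff enters only her equation for `a₀ i`, with
    -- the weight of `b` as coefficient. The solved payoff at `a₀` drops by `t` times this weight;
    -- her other slots are unaffected.
    have h3 : ∏ l ∈ Finset.univ.erase i, storedWeights S a₀ V l (z l) =
        storedWeights S a₀ V j b := by
      rw [Finset.prod_eq_single j]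
      · rw [hzj]
      · intro l _ hl
        rw [hzl l hl]
        simp [storedWeights]
      · intro h
        exact absurd (Finset.mem_erase.2 ⟨hij.symm, Finset.mem_univ _⟩) h
    rw [h3, hzl i hij]
    rw [unitPayoff_self]
    by_cases hci : c i = a₀ i
    · have : c = a₀ := by rw [hc.eq_update, hci, Function.update_eq_self]
      subst this
      simp
      ring
    · rw [Pi.single_eq_of_ne (Ne.symm hci),
        Pi.single_eq_of_ne fun h : c = a₀ => hci (congrFun h i)]
      simp
  · have : c ≠ a₀ := by
      rintro rfl
      exact hc ⟨ha₀ i, fun _ _ => rfl⟩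
    rw [if_neg hc, if_neg hc, unitPayoff_self, Pi.single_eq_of_ne this]
    simp

/-- In the coordinates of `solveSlots` the extra indifference cuts out a set `B` that lines meet at
most once: raising the payoff of `i` at the deviation of `j` to `b` by `t` raises the difference of
the two utilities by `t` times one plus the positive weight of `b`. So `B` is null, and a
differentiable self-map of a finite-dimensional space preserves null sets. -/
theorem ae_notMem_indifferent (ha₀ : ∀ k, a₀ k ∈ S k) {i j : Fin n} (hij : i ≠ j) {b : Fin (m j)}
    (hb : b ≠ a₀ j) : ∀ᵐ U : Game m, U ∉ Indifferent S a₀ i j b := by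
  have hdw := differentiable_storedWeights S a₀
  have hds := differentiable_solveSlots S a₀
  have hdc : ∀ c, Differentiable ℝ fun V =>
      condUtility (solveSlots S a₀ V) (storedWeights S a₀ V) i j c := fun c =>
    differentiable_condUtility (fun c' => by
      rw [differentiable_pi] at hds
      have h1 := hds i
      rw [differentiable_pi] at h1
      exact h1 c') hdw
  let B : Set (Game m) := {V | 0 < storedWeights S a₀ V j b ∧
    condUtility (solveSlots S a₀ V) (storedWeights S a₀ V) i j b =
    condUtility (solveSlots S a₀ V) (storedWeights S a₀ V) i j (a₀ j)}
  have hBm : MeasurableSet B :=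
    (measurableSet_lt measurable_const (hdw j b).continuous.measurable).inter
      (measurableSet_eq_fun (hdc _).continuous.measurable (hdc _).continuous.measurable)
  have hB : volume B = 0 := by
    rw [measure_eq_zero_iff_ae_notMem]
    refine ae_notMem_of_subsingleton_lines volume hBm
      (unitPayoff i (Function.update a₀ j b)) fun V => ?_
    have hw1 : ∀ l, storedWeights S a₀ V l (a₀ l) = 1 := fun l => by simp [storedWeights]
    have key : ∀ t, V + t • unitPayoff i (Function.update a₀ j b) ∈ B →
        0 < storedWeights S a₀ V j b ∧
        t * (1 + storedWeights S a₀ V j b) =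
        condUtility (solveSlots S a₀ V) (storedWeights S a₀ V) i j (a₀ j) -
        condUtility (solveSlots S a₀ V) (storedWeights S a₀ V) i j b := by
      intro t ⟨ht1, ht2⟩
      obtain ⟨h1, h2⟩ := solveSlots_add_single ha₀ hij hb V t
      rw [h1] at ht1 ht2
      refine ⟨ht1, ?_⟩
      have h3 : ∀ c, condUtility (solveSlots S a₀
          (V + t • unitPayoff i (Function.update a₀ j b))) (storedWeights S a₀ V) i j c
          = condUtility (solveSlots S a₀ V) (storedWeights S a₀ V) i j c +
            t * ((Pi.single c 1 : Fin (m j) → ℝ) b -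
              storedWeights S a₀ V j b * (Pi.single c 1 : Fin (m j) → ℝ) (a₀ j)) := by
        intro c
        rw [condUtility, expectedUtility_congr h2, expectedUtility_add, expectedUtility_smul,
          expectedUtility_add, expectedUtility_smul,
          expectedUtility_of_eq_single (unitPayoff_self i _),
          expectedUtility_of_eq_single (unitPayoff_self i _), prod_update_apply,
          prod_update_apply, Finset.prod_eq_one, Finset.prod_eq_one, condUtility]
        · rw [Function.update_self]
          ring
        · intro l _
          exact hw1 l
        · intro l hl
          rw [Function.update_of_ne (Finset.ne_of_mem_erase hl), hw1]
      rw [h3, h3, Pi.single_eq_same, Pi.single_eq_same, Pi.single_eq_of_ne hb.symm,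
        Pi.single_eq_of_ne hb] at ht2
      linarith
    intro t ht t' ht'
    obtain ⟨h1, h2⟩ := key t ht
    obtain ⟨-, h3⟩ := key t' ht'
    rw [← h3] at h2
    exact mul_right_cancel₀ (by positivity) h2
  have h0 : volume (solveSlots S a₀ '' B) = 0 :=
    addHaar_image_eq_zero_of_differentiableOn_of_addHaar_eq_zero volume hds.differentiableOn hB
  filter_upwards [measure_eq_zero_iff_ae_notMem.1 h0] with U hU
  rintro ⟨p, hp1, hp2, hp3, hp4, hp5⟩
  obtain ⟨V, hV1, hV2⟩ := exists_solveSlots_eq ha₀ hp1 hp2 hp4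
  refine hU ⟨V, ⟨?_, ?_⟩, hV2⟩
  · rwa [hV1]
  · rwa [hV1, hV2]

end Generic

/-! ### Almost surely, every strong equilibrium is pure -/

section Pure

variable {n : ℕ} {m : Fin n → ℕ}

theorem ae_payoff_ne (j : Fin n) {c c' : Profile m} (h : c ≠ c') :
    ∀ᵐ V : Game m, V j c ≠ V j c' := by
  refine ae_notMem_of_subsingleton_lines volume (s := {V : Game m | V j c = V j c'})
    (measurableSet_eq_fun (by fun_prop) (by fun_prop)) (unitPayoff j c) fun V => ?_
  intro t ht t' ht'
  simp only [Set.mem_ofPred_eq, Pi.add_apply, Pi.smul_apply, unitPayoff_self, Pi.single_eq_same,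
    Pi.single_eq_of_ne h.symm, smul_eq_mul] at ht ht'
  linarith

theorem exists_pos_of_mem_stdSimplex {k : ℕ} {v : Fin k → ℝ} (hv : v ∈ stdSimplex ℝ (Fin k)) :
    ∃ a, 0 < v a := by
  by_contra! h
  have : ∑ a, v a ≤ 0 := Finset.sum_nonpos fun a _ => h a
  rw [hv.2] at this
  linarith

theorem exists_pos_of_ne_single {k : ℕ} {v : Fin k → ℝ} (hv : v ∈ stdSimplex ℝ (Fin k))
    {a : Fin k} (h : v ≠ Pi.single a 1) : ∃ b, b ≠ a ∧ 0 < v b := by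
  by_contra! h'
  have h0 : ∀ b, b ≠ a → v b = 0 := fun b hb => le_antisymm (h' b hb) (hv.1 b)
  refine h (funext fun b => ?_)
  by_cases hb : b = a
  · subst hb
    rw [Pi.single_eq_same, ← hv.2, Finset.sum_eq_single b (fun c _ hc => h0 c hc) (by simp)]
  · rw [Pi.single_eq_of_ne hb, h0 b hb]

theorem expectedUtility_pure (U : Game m) (c : Profile m) (i : Fin n) :
    expectedUtility U (fun l => Pi.single (c l) 1) i = U i c := by
  rw [expectedUtility, Finset.sum_eq_single c]
  · simp
  · intro a _ ha
    obtain ⟨l, hl⟩ := Function.ne_iff.1 ha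
    rw [Finset.prod_eq_zero (Finset.mem_univ l) (Pi.single_eq_of_ne hl _), zero_mul]
  · simp

/-- The factor leaves out agent `j` and does not depend on `b`, so equalities between her actions
survive a change of normalization. -/
theorem condUtility_rescale (U : Game m) (r : Fin n → ℝ) (x : Strategies m) (i j : Fin n)
    (b : Fin (m j)) : condUtility U (fun l c => r l * x l c) i j b =
      (∏ l, Function.update r j 1 l) * condUtility U x i j b := by
  rw [condUtility, condUtility, ← expectedUtility_smul_strategies]
  congr 1
  ext l c
  by_cases hl : l = j
  · subst hl; simp
  · simp [Function.update_of_ne hl]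

/-- Each strategy is divided by its weight at `a₀`, to reach the normalization in `Indifferent`. -/
theorem IsSNE.mem_indifferent {U : Game m} {x : Strategies m} (h : IsSNE U x) {a₀ : Profile m}
    (ha₀ : ∀ k, 0 < x k (a₀ k)) {i j : Fin n} {b : Fin (m j)} (hb : 0 < x j b)
    (he : condUtility U x i j b = condUtility U x i j (a₀ j)) :
    U ∈ Indifferent (fun k => Finset.univ.filter fun a => 0 < x k a) a₀ i j b := by
  refine ⟨fun l c => (x l (a₀ l))⁻¹ * x l c, fun k => inv_mul_cancel₀ (ha₀ k).ne', ?_, ?_, ?_, ?_⟩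
  · intro k a ha
    have h1 : ¬ 0 < x k a := by simpa using ha
    have h2 : x k a = 0 := le_antisymm (not_lt.1 h1) ((h.1 k).1 a)
    simp [h2]
  · exact mul_pos (inv_pos.2 (ha₀ j)) hb
  · intro k a ha
    have h1 : 0 < x k a := by simpa using ha
    rw [condUtility_rescale U (fun l => (x l (a₀ l))⁻¹),
      condUtility_rescale U (fun l => (x l (a₀ l))⁻¹), h.condUtility_eq k h1,
      h.condUtility_eq k (ha₀ k)]
  · rw [condUtility_rescale U (fun l => (x l (a₀ l))⁻¹),
      condUtility_rescale U (fun l => (x l (a₀ l))⁻¹), he]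

/-- There are finitely many supports, base profiles and pairs of actions, so all exceptional sets
can be avoided at once, before the equilibrium is chosen. -/
theorem ae_sne_isPure : ∀ᵐ V : Game m, ∀ x, IsSNE V x → IsPure x := by
  have h1 : ∀ᵐ V : Game m, ∀ (S : ∀ k, Finset (Fin (m k))) (a₀ : Profile m) (i j : Fin n)
      (b : Fin (m j)), (∀ k, a₀ k ∈ S k) → i ≠ j → b ≠ a₀ j → V ∉ Indifferent S a₀ i j b := by
    simp only [ae_all_iff]
    intro S a₀ i j b h1 h2 h3
    exact ae_notMem_indifferent h1 h2 h3
  have h2 : ∀ᵐ V : Game m, ∀ (j : Fin n) (c c' : Profile m), c ≠ c' → V j c ≠ V j c' := by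
    simp only [ae_all_iff]
    intro j c c' h
    exact ae_payoff_ne j h
  filter_upwards [h1, h2] with V h1 h2 x hx
  choose a₀ ha₀ using fun k => exists_pos_of_mem_stdSimplex (hx.1 k)
  by_contra hpure
  simp only [IsPure, not_forall, not_exists] at hpure
  obtain ⟨j, hj⟩ := hpure
  obtain ⟨b, hb, hxb⟩ := exists_pos_of_ne_single (hx.1 j) (hj (a₀ j))
  have ha₀' : ∀ k, a₀ k ∈ Finset.univ.filter fun a => 0 < x k a := fun k => by simpa using ha₀ k
  by_cases hall : ∀ i ≠ j, x i = Pi.single (a₀ i) 1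
  · have key : ∀ c, condUtility V x j j c = V j (Function.update a₀ j c) := by
      intro c
      rw [condUtility, ← expectedUtility_pure V]
      congr 1
      ext l : 1
      by_cases hl : l = j
      · subst hl; simp
      · rw [Function.update_of_ne hl, Function.update_of_ne hl, hall l hl]
    have h3 := hx.condUtility_eq j hxb
    rw [← hx.condUtility_eq j (ha₀ j), key, key, Function.update_eq_self] at h3
    refine h2 j _ _ ?_ h3
    intro h4
    apply hb
    rw [← h4, Function.update_self]
  · push Not at hall
    obtain ⟨i, hij, hi⟩ := hall
    obtain ⟨a, ha, hxa⟩ := exists_pos_of_ne_single (hx.1 i) hi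
    by_cases e1 : condUtility V x i j b = condUtility V x i j (a₀ j)
    · exact h1 _ a₀ i j b ha₀' hij hb (hx.mem_indifferent ha₀ hxb e1)
    by_cases e2 : condUtility V x j i a = condUtility V x j i (a₀ i)
    · exact h1 _ a₀ j i a ha₀' hij.symm ha (hx.mem_indifferent ha₀ hxa e2)
    -- The signs only decide in which direction each of the two agents shifts probability.
    rcases lt_or_gt_of_ne e1 with e1 | e1 <;> rcases lt_or_gt_of_ne e2 with e2 | e2
    · exact hx.not_both_reactive hij (ha₀ i) hxa (ha₀ j) hxb e1 e2
    · exact hx.not_both_reactive hij hxa (ha₀ i) (ha₀ j) hxb e1 e2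
    · exact hx.not_both_reactive hij (ha₀ i) hxa hxb (ha₀ j) e1 e2
    · exact hx.not_both_reactive hij hxa (ha₀ i) hxb (ha₀ j) e1 e2

end Pure

/-! ### Bimatrix games -/

section Bimatrix

/-- The dependent pair `(a, b)` as a function on `Fin 2`. -/
def pair {β : Fin 2 → Type*} (a : β 0) (b : β 1) : ∀ i, β i
  | 0 => a
  | 1 => b

theorem pair_eta {β : Fin 2 → Type*} (f : ∀ i, β i) : pair (f 0) (f 1) = f := by
  ext i
  fin_cases i <;> rfl

theorem sum_profile {m : Fin 2 → ℕ} (f : Profile m → ℝ) :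
    ∑ a, f a = ∑ a : Fin (m 0), ∑ b : Fin (m 1), f (pair a b) := by
  rw [← Fintype.sum_prod_type' fun (a : Fin (m 0)) (b : Fin (m 1)) => f (pair a b)]
  exact Fintype.sum_equiv (piFinTwoEquiv fun i => Fin (m i)) _ _ fun a => by
    simp [pair_eta]

variable {p q : ℕ}

/-- The bilinear form of a payoff matrix. -/
def bil (A : Fin p → Fin q → ℝ) (x : Fin p → ℝ) (y : Fin q → ℝ) : ℝ :=
  ∑ i, ∑ j, x i * y j * A i j

/-- Expected payoffs of the single rows. -/
def rowVal (A : Fin p → Fin q → ℝ) (y : Fin q → ℝ) (i : Fin p) : ℝ :=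
  ∑ j, y j * A i j

/-- The transposed payoff matrix. -/
def swp (A : Fin p → Fin q → ℝ) : Fin q → Fin p → ℝ := fun j i => A i j

theorem bil_eq_sum_rowVal (A : Fin p → Fin q → ℝ) (x : Fin p → ℝ) (y : Fin q → ℝ) :
    bil A x y = ∑ i, x i * rowVal A y i := by
  simp only [bil, rowVal, Finset.mul_sum, mul_assoc]

theorem bil_swp (A : Fin p → Fin q → ℝ) (x : Fin p → ℝ) (y : Fin q → ℝ) :
    bil (swp A) y x = bil A x y := by
  simp only [bil, swp]
  rw [Finset.sum_comm]
  exact Finset.sum_congr rfl fun i _ => Finset.sum_congr rfl fun j _ => by ring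

/-- Strong equilibria of the bimatrix game `(A, B)`. -/
structure BiSNE (A B : Fin p → Fin q → ℝ) (x : Fin p → ℝ) (y : Fin q → ℝ) : Prop where
  left_mem : x ∈ stdSimplex ℝ (Fin p)
  right_mem : y ∈ stdSimplex ℝ (Fin q)
  left_best : ∀ x' ∈ stdSimplex ℝ (Fin p), bil A x' y ≤ bil A x y
  right_best : ∀ y' ∈ stdSimplex ℝ (Fin q), bil B x y' ≤ bil B x y
  efficient : ∀ x' ∈ stdSimplex ℝ (Fin p), ∀ y' ∈ stdSimplex ℝ (Fin q),
    bil A x' y' ≤ bil A x y ∨ bil B x' y' ≤ bil B x y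

/-- The payoff matrix of agent `i`. -/
def payoffMatrix {m : Fin 2 → ℕ} (U : Game m) (i : Fin 2) : Fin (m 0) → Fin (m 1) → ℝ :=
  fun a b => U i (pair a b)

theorem expectedUtility_eq_bil {m : Fin 2 → ℕ} (U : Game m) (z : Strategies m) (i : Fin 2) :
    expectedUtility U z i = bil (payoffMatrix U i) (z 0) (z 1) := by
  rw [expectedUtility, sum_profile]
  simp only [Fin.prod_univ_two, bil, payoffMatrix]
  rfl

/-- Two agents form only three nonempty coalitions, one for each optimality clause of `BiSNE`. -/
theorem isSNE_iff_biSNE {m : Fin 2 → ℕ} (U : Game m) (z : Strategies m) :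
    IsSNE U z ↔ BiSNE (payoffMatrix U 0) (payoffMatrix U 1) (z 0) (z 1) := by
  simp only [IsSNE, expectedUtility_eq_bil]
  constructor
  · rintro ⟨h1, h2⟩
    refine ⟨h1 0, h1 1, fun x' hx' => ?_, fun y' hy' => ?_, fun x' hx' y' hy' => ?_⟩
    · obtain ⟨i, hi, h⟩ := h2 {0} ⟨0, by simp⟩ (pair x' (z 1)) (Fin.forall_fin_two.2 ⟨hx', h1 1⟩)
        (Fin.forall_fin_two.2 ⟨by simp, fun _ => rfl⟩)
      rw [Finset.mem_singleton] at hi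
      subst hi
      exact h
    · obtain ⟨i, hi, h⟩ := h2 {1} ⟨1, by simp⟩ (pair (z 0) y') (Fin.forall_fin_two.2 ⟨h1 0, hy'⟩)
        (Fin.forall_fin_two.2 ⟨fun _ => rfl, by simp⟩)
      rw [Finset.mem_singleton] at hi
      subst hi
      exact h
    · obtain ⟨i, hi, h⟩ := h2 Finset.univ ⟨0, by simp⟩ (pair x' y')
        (Fin.forall_fin_two.2 ⟨hx', hy'⟩) (by simp)
      fin_cases i
      · exact Or.inl h
      · exact Or.inr h
  · intro h
    refine ⟨Fin.forall_fin_two.2 ⟨h.left_mem, h.right_mem⟩, fun C hC y hy hyC => ?_⟩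
    rw [IsMixed, Fin.forall_fin_two] at hy
    by_cases h0 : (0 : Fin 2) ∈ C <;> by_cases h1 : (1 : Fin 2) ∈ C
    · rcases h.efficient _ hy.1 _ hy.2 with h2 | h2
      · exact ⟨0, h0, h2⟩
      · exact ⟨1, h1, h2⟩
    · refine ⟨0, h0, ?_⟩
      rw [hyC 1 h1]
      exact h.left_best _ hy.1
    · refine ⟨1, h1, ?_⟩
      rw [hyC 0 h0]
      exact h.right_best _ hy.2
    · obtain ⟨i, hi⟩ := hC
      fin_cases i
      · exact absurd hi h0
      · exact absurd hi h1

theorem bil_eq_rowVal {A : Fin p → Fin q → ℝ} {x : Fin p → ℝ} {y : Fin q → ℝ}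
    (hx : x ∈ stdSimplex ℝ (Fin p)) (h : ∀ i₀, 0 < x i₀ → ∀ i, rowVal A y i ≤ rowVal A y i₀)
    {i₀ : Fin p} (hi₀ : 0 < x i₀) : bil A x y = rowVal A y i₀ := by
  rw [bil_eq_sum_rowVal, ← one_mul (rowVal A y i₀), ← hx.2, Finset.sum_mul]
  refine Finset.sum_congr rfl fun i _ => ?_
  rcases (hx.1 i).eq_or_lt with h0 | h0
  · simp [← h0]
  · rw [le_antisymm (h i₀ hi₀ i) (h i h0 i₀)]

theorem bil_le_of_rowVal_le {A : Fin p → Fin q → ℝ} {x : Fin p → ℝ} {y : Fin q → ℝ} {v : ℝ}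
    (hx : x ∈ stdSimplex ℝ (Fin p)) (h : ∀ i, rowVal A y i ≤ v) : bil A x y ≤ v := by
  rw [bil_eq_sum_rowVal, ← one_mul v, ← hx.2, Finset.sum_mul]
  exact Finset.sum_le_sum fun i _ => mul_le_mul_of_nonneg_left (h i) (hx.1 i)

theorem bil_single (A : Fin p → Fin q → ℝ) (i : Fin p) (y : Fin q → ℝ) :
    bil A (Pi.single i 1) y = rowVal A y i := by
  rw [bil_eq_sum_rowVal]
  simp [Pi.single_apply]

/-- A strategy is a best response if and only if all actions in its support are. -/
theorem best_iff {A : Fin p → Fin q → ℝ} {x : Fin p → ℝ} {y : Fin q → ℝ}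
    (hx : x ∈ stdSimplex ℝ (Fin p)) :
    (∀ x' ∈ stdSimplex ℝ (Fin p), bil A x' y ≤ bil A x y) ↔
      ∀ i₀, 0 < x i₀ → ∀ i, rowVal A y i ≤ rowVal A y i₀ := by
  constructor
  · intro h
    have h1 : ∀ i, rowVal A y i ≤ bil A x y := fun i => by
      simpa [bil_single] using h _ (single_mem_stdSimplex ℝ i)
    have h2 : ∑ i, x i * (bil A x y - rowVal A y i) = 0 := by
      simp only [mul_sub, Finset.sum_sub_distrib, ← Finset.sum_mul, hx.2, ← bil_eq_sum_rowVal]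
      ring
    rw [Finset.sum_eq_zero_iff_of_nonneg fun i _ =>
      mul_nonneg (hx.1 i) (sub_nonneg.2 (h1 i))] at h2
    intro i₀ h0 i
    rcases mul_eq_zero.1 (h2 i₀ (Finset.mem_univ _)) with h3 | h3
    · exact absurd h3 h0.ne'
    · linarith [h1 i]
  · intro h x' hx'
    obtain ⟨i₀, h0⟩ := exists_pos_of_mem_stdSimplex hx
    rw [bil_eq_rowVal hx h h0]
    exact bil_le_of_rowVal_le hx' fun i => h i₀ h0 i

theorem best_iff' {B : Fin p → Fin q → ℝ} {x : Fin p → ℝ} {y : Fin q → ℝ}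
    (hy : y ∈ stdSimplex ℝ (Fin q)) :
    (∀ y' ∈ stdSimplex ℝ (Fin q), bil B x y' ≤ bil B x y) ↔
      ∀ j₀, 0 < y j₀ → ∀ j, rowVal (swp B) x j ≤ rowVal (swp B) x j₀ := by
  simp only [← best_iff hy, bil_swp]

/-- Some product distribution on the rows `i, k` and the columns `j, l` improves on the payoffs
`v` and `w`; the distributions need not be normalized. -/
def QuadImproves (A B : Fin p → Fin q → ℝ) (v w : ℝ) (i k : Fin p) (j l : Fin q) : Prop :=
  ∃ r₁ r₂ s₁ s₂ : ℝ, 0 ≤ r₁ ∧ 0 ≤ r₂ ∧ 0 ≤ s₁ ∧ 0 ≤ s₂ ∧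
    0 < r₁ * (s₁ * (A i j - v) + s₂ * (A i l - v)) + r₂ * (s₁ * (A k j - v) + s₂ * (A k l - v)) ∧
    0 < r₁ * (s₁ * (B i j - w) + s₂ * (B i l - w)) + r₂ * (s₁ * (B k j - w) + s₂ * (B k l - w))

/-- A nonnegative combination of points of the plane lying in the open positive quadrant can be
replaced by a combination of two of the points. -/
theorem exists_two_point {ι : Type*} [Fintype ι] {y α β : ι → ℝ} (hy : ∀ j, 0 ≤ y j)
    (hα : 0 < ∑ j, y j * α j) (hβ : 0 < ∑ j, y j * β j) :
    ∃ j l, ∃ s₁ s₂ : ℝ, 0 ≤ s₁ ∧ 0 ≤ s₂ ∧ 0 < s₁ * α j + s₂ * α l ∧ 0 < s₁ * β j + s₂ * β l := by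
  by_contra! H
  have hdiag : ∀ j, 0 < α j → β j ≤ 0 := fun j hj => by
    simpa using H j j 1 0 zero_le_one le_rfl (by simpa using hj)
  have hpair : ∀ j l, 0 < α j → 0 < β l → α j * β l ≤ α l * β j := by
    intro j l hj hl
    by_contra! hlt
    have hαl : α l ≤ 0 := by
      by_contra! h
      exact absurd (hdiag l h) (not_le.2 hl)
    have hβj := hdiag j hj
    -- the open interval of admissible ratios is nonempty
    set D := α j * β l - α l * β j with hD
    have hDpos : 0 < D := by linarith
    -- With the weights `β l - α l` and `α j - β j` both coordinates of the combination equal `D`.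
    have e1 : 0 < (β l - α l) * α j + (α j - β j) * α l := by nlinarith
    have e2 := H j l (β l - α l) (α j - β j) (by linarith) (by linarith) e1
    nlinarith
  have hP : ∃ j, 0 < α j := by
    by_contra! h
    exact absurd hα (not_lt.2 (Finset.sum_nonpos fun j _ =>
      mul_nonpos_of_nonneg_of_nonpos (hy j) (h j)))
  obtain ⟨j₁, hj₁⟩ := hP
  -- The line through the origin with the largest slope among the points with `0 < α` has
  -- nonpositive slope, and all points lie on or below it; so no nonnegative combination of them
  -- reaches the open quadrant.
  obtain ⟨j, hj, hmax⟩ := Finset.exists_max_image (Finset.univ.filter fun j => 0 < α j)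
    (fun j => β j / α j) ⟨j₁, by simpa using hj₁⟩
  simp only [Finset.mem_filter, Finset.mem_univ, true_and] at hj hmax
  have hκ : β j / α j ≤ 0 := div_nonpos_of_nonpos_of_nonneg (hdiag j hj) hj.le
  have key : ∀ l, β l ≤ β j / α j * α l := by
    intro l
    rcases lt_or_ge 0 (α l) with h1 | h1
    · rw [← div_le_iff₀ h1]
      exact hmax l h1
    · rcases lt_or_ge 0 (β l) with h2 | h2
      · have := hpair j l hj h2
        rw [div_mul_eq_mul_div, le_div_iff₀ hj]
        linarith
      · exact h2.trans (mul_nonneg_of_nonpos_of_nonpos hκ h1)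
  have : ∑ l, y l * β l ≤ β j / α j * ∑ l, y l * α l := by
    rw [Finset.mul_sum]
    refine Finset.sum_le_sum fun l _ => ?_
    have := mul_le_mul_of_nonneg_left (key l) (hy l)
    linarith
  nlinarith

theorem bil_sub_const {x : Fin p → ℝ} {y : Fin q → ℝ} (A : Fin p → Fin q → ℝ) (v : ℝ)
    (hx : x ∈ stdSimplex ℝ (Fin p)) (hy : y ∈ stdSimplex ℝ (Fin q)) :
    bil (fun i j => A i j - v) x y = bil A x y - v := by
  simp only [bil, mul_sub, Finset.sum_sub_distrib]
  congr 1
  simp only [mul_assoc, ← Finset.mul_sum, ← Finset.sum_mul, hy.2, one_mul, hx.2]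

/-- For fixed `x` the two gains are linear in `y`, which reduces to two columns; for these columns
they are linear in `x`, which reduces to two rows. Subtracting `v` and `w` from the entries first
makes normalization irrelevant. -/
theorem exists_quadImproves {A B : Fin p → Fin q → ℝ} {v w : ℝ} {x : Fin p → ℝ} {y : Fin q → ℝ}
    (hx : x ∈ stdSimplex ℝ (Fin p)) (hy : y ∈ stdSimplex ℝ (Fin q))
    (hA : v < bil A x y) (hB : w < bil B x y) : ∃ i k j l, QuadImproves A B v w i k j l := by
  have h1 : ∀ (C : Fin p → Fin q → ℝ) (u : ℝ), u < bil C x y →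
      0 < ∑ j, y j * ∑ i, x i * (C i j - u) := by
    intro C u h
    rw [← sub_pos, ← bil_sub_const C u hx hy, ← bil_swp, bil_eq_sum_rowVal] at h
    exact h
  obtain ⟨j, l, s₁, s₂, hs₁, hs₂, h2, h3⟩ := exists_two_point hy.1 (h1 A v hA) (h1 B w hB)
  have h4 : ∀ (C : Fin p → Fin q → ℝ) (u : ℝ),
      s₁ * ∑ i, x i * (C i j - u) + s₂ * ∑ i, x i * (C i l - u) =
      ∑ i, x i * (s₁ * (C i j - u) + s₂ * (C i l - u)) := by
    intro C u
    simp only [Finset.mul_sum, ← Finset.sum_add_distrib]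
    exact Finset.sum_congr rfl fun i _ => by ring
  rw [h4] at h2 h3
  obtain ⟨i, k, r₁, r₂, hr₁, hr₂, h5, h6⟩ := exists_two_point hx.1 h2 h3
  exact ⟨i, k, j, l, r₁, r₂, s₁, s₂, hr₁, hr₂, hs₁, hs₂, h5, h6⟩

theorem two_point_mem {k : ℕ} {r₁ r₂ : ℝ} (h₁ : 0 ≤ r₁) (h₂ : 0 ≤ r₂) (h : 0 < r₁ + r₂)
    (i j : Fin k) :
    ((r₁ + r₂)⁻¹ • (r₁ • Pi.single i 1 + r₂ • Pi.single j 1) : Fin k → ℝ) ∈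
      stdSimplex ℝ (Fin k) := by
  have := (convex_stdSimplex ℝ (Fin k)) (single_mem_stdSimplex ℝ i) (single_mem_stdSimplex ℝ j)
    (a := (r₁ + r₂)⁻¹ * r₁) (b := (r₁ + r₂)⁻¹ * r₂) (by positivity) (by positivity)
    (by field_simp)
  simpa [smul_add, smul_smul] using this

/-- The weights have positive sums, since otherwise the gains would vanish; so they can be
normalized. -/
theorem QuadImproves.exists_bil {A B : Fin p → Fin q → ℝ} {v w : ℝ} {i k : Fin p} {j l : Fin q}
    (h : QuadImproves A B v w i k j l) :
    ∃ x ∈ stdSimplex ℝ (Fin p), ∃ y ∈ stdSimplex ℝ (Fin q), v < bil A x y ∧ w < bil B x y := by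
  obtain ⟨r₁, r₂, s₁, s₂, hr₁, hr₂, hs₁, hs₂, hA, hB⟩ := h
  have hr : 0 < r₁ + r₂ := by
    by_contra! h
    have e1 : r₁ = 0 := by linarith
    have e2 : r₂ = 0 := by linarith
    simp [e1, e2] at hA
  have hs : 0 < s₁ + s₂ := by
    by_contra! h
    have e1 : s₁ = 0 := by linarith
    have e2 : s₂ = 0 := by linarith
    simp [e1, e2] at hA
  have hx := two_point_mem hr₁ hr₂ hr i k
  have hy := two_point_mem hs₁ hs₂ hs j l
  have key : ∀ (C : Fin p → Fin q → ℝ) (u : ℝ),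
      0 < r₁ * (s₁ * (C i j - u) + s₂ * (C i l - u)) + r₂ * (s₁ * (C k j - u) + s₂ * (C k l - u)) →
      u < bil C ((r₁ + r₂)⁻¹ • (r₁ • Pi.single i 1 + r₂ • Pi.single k 1))
        ((s₁ + s₂)⁻¹ • (s₁ • Pi.single j 1 + s₂ • Pi.single l 1)) := by
    intro C u h
    rw [← sub_pos, ← bil_sub_const C u hx hy]
    have : bil (fun i j => C i j - u) ((r₁ + r₂)⁻¹ • (r₁ • Pi.single i 1 + r₂ • Pi.single k 1))
        ((s₁ + s₂)⁻¹ • (s₁ • Pi.single j 1 + s₂ • Pi.single l 1)) =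
        (r₁ + r₂)⁻¹ * (s₁ + s₂)⁻¹ * (r₁ * (s₁ * (C i j - u) + s₂ * (C i l - u)) +
          r₂ * (s₁ * (C k j - u) + s₂ * (C k l - u))) := by
      rw [bil_eq_sum_rowVal]
      simp only [rowVal, Pi.smul_apply, Pi.add_apply, smul_eq_mul, Pi.single_apply, mul_add,
        add_mul, Finset.sum_add_distrib, mul_ite, ite_mul, mul_one, mul_zero, zero_mul,
        Finset.sum_ite_eq', Finset.mem_univ, if_true]
      ring
    rw [this]
    positivity
  exact ⟨_, hx, _, hy, key A v hA, key B w hB⟩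

/-- At mutual best responses the equilibrium payoffs are those of any support row and support
column. Comparing with these makes every clause a statement about finitely many indices. -/
theorem biSNE_iff {A B : Fin p → Fin q → ℝ} {x : Fin p → ℝ} {y : Fin q → ℝ}
    (hx : x ∈ stdSimplex ℝ (Fin p)) (hy : y ∈ stdSimplex ℝ (Fin q)) :
    BiSNE A B x y ↔ ∀ i₀ j₀, 0 < x i₀ → 0 < y j₀ → ∀ i k j l,
      rowVal A y i ≤ rowVal A y i₀ ∧ rowVal (swp B) x j ≤ rowVal (swp B) x j₀ ∧
      ¬ QuadImproves A B (rowVal A y i₀) (rowVal (swp B) x j₀) i k j l := by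
  constructor
  · intro h i₀ j₀ hi₀ hj₀ i k j l
    have h1 := (best_iff hx).1 h.left_best
    have h2 := (best_iff' hy).1 h.right_best
    refine ⟨h1 i₀ hi₀ i, h2 j₀ hj₀ j, fun hq => ?_⟩
    obtain ⟨x', hx', y', hy', h3, h4⟩ := hq.exists_bil
    rw [← bil_eq_rowVal hx h1 hi₀] at h3
    rw [← bil_eq_rowVal hy h2 hj₀, bil_swp] at h4
    rcases h.efficient x' hx' y' hy' with h5 | h5 <;> linarith
  · intro h
    obtain ⟨i₀, hi₀⟩ := exists_pos_of_mem_stdSimplex hx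
    obtain ⟨j₀, hj₀⟩ := exists_pos_of_mem_stdSimplex hy
    have h1 : ∀ i₀, 0 < x i₀ → ∀ i, rowVal A y i ≤ rowVal A y i₀ :=
      fun i₁ hi₁ i => (h i₁ j₀ hi₁ hj₀ i i₀ j₀ j₀).1
    have h2 : ∀ j₀, 0 < y j₀ → ∀ j, rowVal (swp B) x j ≤ rowVal (swp B) x j₀ :=
      fun j₁ hj₁ j => (h i₀ j₁ hi₀ hj₁ i₀ i₀ j j₀).2.1
    refine ⟨hx, hy, (best_iff hx).2 h1, (best_iff' hy).2 h2, fun x' hx' y' hy' => ?_⟩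
    by_contra! hc
    rw [bil_eq_rowVal hx h1 hi₀, ← bil_swp B x y, bil_eq_rowVal hy h2 hj₀] at hc
    obtain ⟨i, k, j, l, hq⟩ := exists_quadImproves hx' hy' hc.1 hc.2
    exact (h i₀ j₀ hi₀ hj₀ i k j l).2.2 hq

/-- Strategies with smaller support, keeping all best responses and not decreasing the payoffs,
again form a strong equilibrium. -/
theorem BiSNE.exchange {A B : Fin p → Fin q → ℝ} {x x' : Fin p → ℝ} {y y' : Fin q → ℝ}
    (h : BiSNE A B x y) {i₀ : Fin p} {j₀ : Fin q} (hi₀ : 0 < x i₀) (hj₀ : 0 < y j₀)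
    (hx' : x' ∈ stdSimplex ℝ (Fin p)) (hy' : y' ∈ stdSimplex ℝ (Fin q))
    (hsx : ∀ i, 0 < x' i → 0 < x i) (hsy : ∀ j, 0 < y' j → 0 < y j)
    (hbx : ∀ j l, rowVal (swp B) x l ≤ rowVal (swp B) x j →
      rowVal (swp B) x' l ≤ rowVal (swp B) x' j)
    (hby : ∀ i k, rowVal A y k ≤ rowVal A y i → rowVal A y' k ≤ rowVal A y' i)
    (hw : rowVal (swp B) x j₀ ≤ rowVal (swp B) x' j₀) (hv : rowVal A y i₀ ≤ rowVal A y' i₀) :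
    BiSNE A B x' y' := by
  have h1 := (best_iff h.left_mem).1 h.left_best
  have h2 := (best_iff' h.right_mem).1 h.right_best
  have h1' : ∀ i₀, 0 < x' i₀ → ∀ i, rowVal A y' i ≤ rowVal A y' i₀ :=
    fun i₁ hi₁ i => hby _ _ (h1 i₁ (hsx _ hi₁) i)
  have h2' : ∀ j₀, 0 < y' j₀ → ∀ j, rowVal (swp B) x' j ≤ rowVal (swp B) x' j₀ :=
    fun j₁ hj₁ j => hbx _ _ (h2 j₁ (hsy _ hj₁) j)
  -- The row `i₀` need not be in the support of `x'`, but its payoff against `y'` is still a lower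
  -- bound for the best-response payoff.
  have hA : bil A x y ≤ bil A x' y' := by
    obtain ⟨i₁, hi₁⟩ := exists_pos_of_mem_stdSimplex hx'
    rw [bil_eq_rowVal h.left_mem h1 hi₀, bil_eq_rowVal hx' h1' hi₁]
    exact hv.trans (h1' i₁ hi₁ i₀)
  have hB : bil B x y ≤ bil B x' y' := by
    obtain ⟨j₁, hj₁⟩ := exists_pos_of_mem_stdSimplex hy'
    rw [← bil_swp B x y, ← bil_swp B x' y', bil_eq_rowVal h.right_mem h2 hj₀,
      bil_eq_rowVal hy' h2' hj₁]
    exact hw.trans (h2' j₁ hj₁ j₀)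
  refine ⟨hx', hy', (best_iff hx').2 h1', (best_iff' hy').2 h2', fun a ha b hb => ?_⟩
  exact (h.efficient a ha b hb).imp (fun h => h.trans hA) fun h => h.trans hB

end Bimatrix

/-! ### Mixed strong equilibria of bimatrix games are degenerate -/

/-! ### Proportionality of linear and bilinear forms of opposite sign -/

section Forms

variable {V W : Type*} [AddCommGroup V] [Module ℝ V] [AddCommGroup W] [Module ℝ W]

/-- If `g` were not a multiple of `f`, it would be nonzero at some `u` in the kernel of `f`; near
`u` the sign of `g` is fixed, while that of `f` can be chosen. -/
theorem linear_proportional {f g : V →ₗ[ℝ] ℝ} (h : ∀ v, f v * g v ≤ 0) {v₀ : V} (h₀ : f v₀ ≠ 0)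
    (v : V) : g v * f v₀ = g v₀ * f v := by
  set u := f v₀ • v - f v • v₀ with hu
  have hf : f u = 0 := by simp [hu]; ring
  have hg : g u = g v * f v₀ - g v₀ * f v := by simp [hu]; ring
  by_contra hne
  have hγ : g u ≠ 0 := by rw [hg]; exact sub_ne_zero.2 hne
  have key : ∀ τ : ℝ, τ * (f v₀ * g u) + τ ^ 2 * (f v₀ * g v₀) ≤ 0 := by
    intro τ
    have := h (u + τ • v₀)
    simp only [map_add, map_smul, smul_eq_mul, hf] at this
    linarith
  have h1 : f v₀ * g v₀ ≤ 0 := h v₀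
  have h2 : f v₀ * g u ≠ 0 := mul_ne_zero h₀ hγ
  set c := f v₀ * g u
  set b := f v₀ * g v₀
  -- This value of `τ` turns the left-hand side of `key` into `τ ^ 2`, which forces `τ = 0` and
  -- hence `c = 0`.
  have h3 := key (c / (1 - b))
  have hb : 0 < 1 - b := by linarith
  have h4 : c / (1 - b) * c + (c / (1 - b)) ^ 2 * b = (c / (1 - b)) ^ 2 := by
    field_simp
    ring
  rw [h4] at h3
  exact h2 (by simpa [hb.ne'] using (le_antisymm h3 (sq_nonneg _)))

/-- Two bilinear forms that never have the same strict sign are proportional. -/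
theorem bilinear_proportional {α β : V →ₗ[ℝ] W →ₗ[ℝ] ℝ} (h : ∀ v w, α v w * β v w ≤ 0) :
    ∃ s t : ℝ, (s ≠ 0 ∨ t ≠ 0) ∧ ∀ v w, s * α v w + t * β v w = 0 := by
  by_cases h0 : ∀ v w, α v w = 0
  · exact ⟨1, 0, Or.inl one_ne_zero, fun v w => by simp [h0]⟩
  push Not at h0
  obtain ⟨v₀, w₀, h0⟩ := h0
  refine ⟨-β v₀ w₀, α v₀ w₀, Or.inr h0, ?_⟩
  have h1 : ∀ v, β v w₀ * α v₀ w₀ = β v₀ w₀ * α v w₀ := fun v =>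
    linear_proportional (f := α.flip w₀) (g := β.flip w₀) (fun v => h v w₀) h0 v
  have h2 : ∀ v, α v w₀ ≠ 0 → ∀ w, -β v₀ w₀ * α v w + α v₀ w₀ * β v w = 0 := by
    intro v hv w
    have h3 := linear_proportional (f := α v) (g := β v) (h v) hv w
    apply mul_left_cancel₀ hv
    have := h1 v
    linear_combination α v₀ w₀ * h3 + α v w * this
  intro v w
  -- Such a `v` is the difference of `v + v₀` and `v₀`, and on both of these `α` does not vanish at
  -- `w₀`.
  by_cases hv : α v w₀ = 0
  · have h3 := h2 (v + v₀) (by simp [hv, h0]) w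
    have h4 := h2 v₀ h0 w
    simp only [map_add, LinearMap.add_apply] at h3
    linarith
  · exact h2 v hv w

end Forms

/-! ### Variations of an equilibrium within its supports -/

section Degenerate

variable {p q : ℕ}

/-- Coincidences among payoffs that are necessary for mixed strong equilibria. -/
def Coincidence (A B : Fin p → Fin q → ℝ) (i k : Fin p) (j l : Fin q) : Prop :=
  (i ≠ k ∧ A i j = A k j) ∨ (j ≠ l ∧ B i j = B i l) ∨
    (i ≠ k ∧ j ≠ l ∧ (A k j - A i j) * (B i l - B i j) = (B k j - B i j) * (A i l - A i j))

theorem bil_add_left (A : Fin p → Fin q → ℝ) (x x' : Fin p → ℝ) (y : Fin q → ℝ) :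
    bil A (x + x') y = bil A x y + bil A x' y := by
  simp only [bil, Pi.add_apply, add_mul, Finset.sum_add_distrib]

theorem bil_smul_left (A : Fin p → Fin q → ℝ) (c : ℝ) (x : Fin p → ℝ) (y : Fin q → ℝ) :
    bil A (c • x) y = c * bil A x y := by
  simp only [bil, Pi.smul_apply, smul_eq_mul, Finset.mul_sum, mul_assoc]

theorem bil_add_right (A : Fin p → Fin q → ℝ) (x : Fin p → ℝ) (y y' : Fin q → ℝ) :
    bil A x (y + y') = bil A x y + bil A x y' := by
  simp only [← bil_swp A, bil_add_left]

theorem bil_smul_right (A : Fin p → Fin q → ℝ) (c : ℝ) (x : Fin p → ℝ) (y : Fin q → ℝ) :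
    bil A x (c • y) = c * bil A x y := by
  simp only [← bil_swp A, bil_smul_left]

/-- `bil` as a bilinear map. -/
def bilin (A : Fin p → Fin q → ℝ) : (Fin p → ℝ) →ₗ[ℝ] (Fin q → ℝ) →ₗ[ℝ] ℝ :=
  LinearMap.mk₂ ℝ (bil A) (bil_add_left A) (bil_smul_left A) (bil_add_right A)
    fun c x y => bil_smul_right A c x y

/-- Directions in which `x` can be moved within its support. -/
def tangent (x : Fin p → ℝ) : Submodule ℝ (Fin p → ℝ) where
  carrier := {d | ∑ i, d i = 0 ∧ ∀ i, x i = 0 → d i = 0}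
  add_mem' := fun {a b} ha hb =>
    ⟨by simp [Finset.sum_add_distrib, ha.1, hb.1], fun i hi => by simp [ha.2 i hi, hb.2 i hi]⟩
  zero_mem' := ⟨by simp, fun _ _ => rfl⟩
  smul_mem' := fun c a ha =>
    ⟨by simp [← Finset.mul_sum, ha.1], fun i hi => by simp [ha.2 i hi]⟩

theorem single_sub_single_mem_tangent {x : Fin p → ℝ} {i k : Fin p} (hi : 0 < x i) (hk : 0 < x k) :
    (Pi.single i 1 - Pi.single k 1 : Fin p → ℝ) ∈ tangent x := by
  refine ⟨by simp, fun a ha => ?_⟩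
  have h1 : a ≠ i := by rintro rfl; exact hi.ne' ha
  have h2 : a ≠ k := by rintro rfl; exact hk.ne' ha
  simp [h1, h2]

theorem eventually_add_smul_mem {x d : Fin p → ℝ} (hx : x ∈ stdSimplex ℝ (Fin p))
    (hd : d ∈ tangent x) :
    ∀ᶠ ε : ℝ in nhdsWithin 0 (Set.Ioi 0), x + ε • d ∈ stdSimplex ℝ (Fin p) := by
  have h : ∀ᶠ ε : ℝ in nhdsWithin 0 (Set.Ioi 0), ∀ i, 0 ≤ x i + ε * d i := by
    rw [Filter.eventually_all]
    intro i
    rcases (hx.1 i).eq_or_lt with h0 | h0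
    · simp [hd.2 i h0.symm, ← h0]
    · have h1 : Filter.Tendsto (fun ε : ℝ => x i + ε * d i) (nhdsWithin 0 (Set.Ioi 0))
          (nhds (x i + 0 * d i)) :=
        ((continuous_const.add (continuous_id.mul continuous_const)).tendsto 0).mono_left
          nhdsWithin_le_nhds
      filter_upwards [h1.eventually (lt_mem_nhds (a := 0) (by simpa using h0))] with ε h2
      exact h2.le
  filter_upwards [h] with ε hε
  exact ⟨fun i => by simpa using hε i, by simp [Finset.sum_add_distrib, ← Finset.mul_sum, hx.2, hd.1]⟩

theorem BiSNE.swap {A B : Fin p → Fin q → ℝ} {x : Fin p → ℝ} {y : Fin q → ℝ}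
    (h : BiSNE A B x y) : BiSNE (swp B) (swp A) y x := by
  refine ⟨h.right_mem, h.left_mem, ?_, ?_, ?_⟩
  · simpa only [bil_swp] using h.right_best
  · simpa only [bil_swp] using h.left_best
  · simp only [bil_swp]
    exact fun y' hy' x' hx' => (h.efficient x' hx' y' hy').symm

/-- All support rows earn the same against `y`, and the entries of `d` sum to zero. -/
theorem BiSNE.bil_tangent {A B : Fin p → Fin q → ℝ} {x : Fin p → ℝ} {y : Fin q → ℝ}
    (h : BiSNE A B x y) {d : Fin p → ℝ} (hd : d ∈ tangent x) : bil A d y = 0 := by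
  have h1 := (best_iff h.left_mem).1 h.left_best
  obtain ⟨i₀, hi₀⟩ := exists_pos_of_mem_stdSimplex h.left_mem
  have h2 : ∀ i, d i * rowVal A y i = d i * rowVal A y i₀ := by
    intro i
    rcases (h.left_mem.1 i).eq_or_lt with h0 | h0
    · simp [hd.2 i h0.symm]
    · rw [le_antisymm (h1 i₀ hi₀ i) (h1 i h0 i₀)]
  rw [bil_eq_sum_rowVal, Finset.sum_congr rfl fun i _ => h2 i, ← Finset.sum_mul, hd.1, zero_mul]

/-- Efficiency, expanded along tangent directions. The terms in which an agent's own move meets the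
other's unchanged strategy vanish by indifference, so only the effect of the opponent's move and the
mixed term remain. -/
theorem BiSNE.eventually_not_improving {A B : Fin p → Fin q → ℝ} {x : Fin p → ℝ} {y : Fin q → ℝ}
    (h : BiSNE A B x y) {d : Fin p → ℝ} (hd : d ∈ tangent x) {e : Fin q → ℝ}
    (he : e ∈ tangent y) : ∃ s ∈ nhdsWithin (0 : ℝ) (Set.Ioi 0), ∀ ε ∈ s, ∀ δ ∈ s, 0 < ε ∧ 0 < δ ∧
      (δ * bil A x e + ε * δ * bil A d e ≤ 0 ∨ ε * bil B d y + ε * δ * bil B d e ≤ 0) := by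
  refine ⟨_, Filter.inter_mem (Filter.inter_mem (eventually_add_smul_mem h.left_mem hd)
    (eventually_add_smul_mem h.right_mem he)) self_mem_nhdsWithin, ?_⟩
  rintro ε ⟨⟨h1, -⟩, h2⟩ δ ⟨⟨-, h3⟩, h4⟩
  refine ⟨h2, h4, ?_⟩
  have hA := h.bil_tangent hd
  have hB : bil B x e = 0 := by
    have := h.swap.bil_tangent he
    rwa [bil_swp] at this
  have key := h.efficient _ h1 _ h3
  simp only [bil_add_left, bil_add_right, bil_smul_left, bil_smul_right, hA, hB] at key
  rcases key with key | key
  · left; linarith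
  · right; linarith

theorem eventually_pos_add {P : ℝ} (hP : 0 < P) (K : ℝ) :
    ∀ᶠ ε : ℝ in nhdsWithin 0 (Set.Ioi 0), 0 < P + ε * K := by
  filter_upwards [eventually_pos_add_mul_sq hP K, self_mem_nhdsWithin] with ε h1 h2
  have h2 : 0 < ε := h2
  have : 0 < ε * (P + ε * K) := by nlinarith
  exact pos_of_mul_pos_right this h2.le

/-- No first-order improvement for both agents. -/
theorem BiSNE.first_order {A B : Fin p → Fin q → ℝ} {x : Fin p → ℝ} {y : Fin q → ℝ}
    (h : BiSNE A B x y) {d : Fin p → ℝ} (hd : d ∈ tangent x) {e : Fin q → ℝ}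
    (he : e ∈ tangent y) (h1 : bil B d y ≠ 0) : bil A x e = 0 := by
  by_contra h2
  obtain ⟨d', hd', h1'⟩ : ∃ d' ∈ tangent x, 0 < bil B d' y := by
    rcases lt_or_gt_of_ne h1 with h3 | h3
    · refine ⟨(-1 : ℝ) • d, Submodule.smul_mem _ _ hd, ?_⟩
      rw [bil_smul_left]; linarith
    · exact ⟨d, hd, h3⟩
  obtain ⟨e', he', h2'⟩ : ∃ e' ∈ tangent y, 0 < bil A x e' := by
    rcases lt_or_gt_of_ne h2 with h3 | h3
    · refine ⟨(-1 : ℝ) • e, Submodule.smul_mem _ _ he, ?_⟩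
      rw [bil_smul_right]; linarith
    · exact ⟨e, he, h3⟩
  obtain ⟨s, hs, hs'⟩ := h.eventually_not_improving hd' he'
  obtain ⟨ε, h3, h4, h5⟩ := ((eventually_pos_add h2' (bil A d' e')).and
    ((eventually_pos_add h1' (bil B d' e')).and hs)).exists
  obtain ⟨h6, -, h7⟩ := hs' ε h5 ε h5
  rcases h7 with h7 | h7
  · nlinarith
  · nlinarith

/-- A move of the first agent can help the second to first order. By `BiSNE.first_order`, moves of
the second agent then have no first-order effect on the first, whose gain is exactly the mixed term.
If that term were nonzero, a choice of the sign of `e` would make both agents gain. -/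
theorem BiSNE.second_order_of_ne {A B : Fin p → Fin q → ℝ} {x : Fin p → ℝ} {y : Fin q → ℝ}
    (h : BiSNE A B x y) {d₀ : Fin p → ℝ} (hd₀ : d₀ ∈ tangent x) (h₀ : bil B d₀ y ≠ 0)
    {d : Fin p → ℝ} (hd : d ∈ tangent x) {e : Fin q → ℝ} (he : e ∈ tangent y) : bil A d e = 0 := by
  -- the claim for directions moving the payoff of the second agent
  have key : ∀ d ∈ tangent x, bil B d y ≠ 0 → bil A d e = 0 := by
    intro d hd h1
    by_contra h2
    obtain ⟨d', hd', h1', h2'⟩ : ∃ d' ∈ tangent x, 0 < bil B d' y ∧ bil A d' e ≠ 0 := by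
      rcases lt_or_gt_of_ne h1 with h3 | h3
      · refine ⟨(-1 : ℝ) • d, Submodule.smul_mem _ _ hd, ?_, ?_⟩
        · rw [bil_smul_left]; linarith
        · rw [bil_smul_left]; simpa using h2
      · exact ⟨d, hd, h3, h2⟩
    obtain ⟨e', he', h3'⟩ : ∃ e' ∈ tangent y, 0 < bil A d' e' := by
      rcases lt_or_gt_of_ne h2' with h3 | h3
      · refine ⟨(-1 : ℝ) • e, Submodule.smul_mem _ _ he, ?_⟩
        rw [bil_smul_right]; linarith
      · exact ⟨e, he, h3⟩
    have h4 := h.first_order hd' he' h1'.ne'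
    obtain ⟨s, hs, hs'⟩ := h.eventually_not_improving hd' he'
    obtain ⟨δ, h5, h6⟩ := ((eventually_pos_add h1' (bil B d' e')).and hs).exists
    obtain ⟨hδ, -, h7⟩ := hs' δ h6 δ h6
    rw [h4] at h7
    rcases h7 with h7 | h7
    · have : 0 < δ * δ * bil A d' e' := by positivity
      linarith
    · nlinarith
  by_cases h1 : bil B d y = 0
  -- A direction without first-order effect is the difference of two directions that have one.
  · have h2 := key (d + d₀) (Submodule.add_mem _ hd hd₀) (by rw [bil_add_left, h1]; simpa using h₀)
    rw [bil_add_left, key d₀ hd₀ h₀] at h2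
    linarith
  · exact key d hd h1

/-- A matrix without second-order terms and with indifferent rows is constant on columns. -/
theorem eq_of_bil_eq_zero {C : Fin p → Fin q → ℝ} {y : Fin q → ℝ}
    (hy : y ∈ stdSimplex ℝ (Fin q)) {i k : Fin p} {j : Fin q} (hj : 0 < y j)
    (h1 : bil C (Pi.single i 1 - Pi.single k 1) y = 0)
    (h2 : ∀ e ∈ tangent y, bil C (Pi.single i 1 - Pi.single k 1) e = 0) : C i j = C k j := by
  have h3 : ∀ e, bil C (Pi.single i 1 - Pi.single k 1) e = ∑ l, e l * (C i l - C k l) := by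
    intro e
    rw [bil_eq_sum_rowVal]
    simp [sub_mul, Pi.single_apply, rowVal, mul_sub]
  have h4 : ∀ l, y l * (C i l - C k l) = y l * (C i j - C k j) := by
    intro l
    rcases (hy.1 l).eq_or_lt with h0 | h0
    · simp [← h0]
    · have h5 := h2 _ (single_sub_single_mem_tangent h0 hj)
      rw [h3] at h5
      simp only [Pi.sub_apply, sub_mul, Finset.sum_sub_distrib, Pi.single_apply, ite_mul, one_mul,
        zero_mul, Finset.sum_ite_eq', Finset.mem_univ, if_true] at h5
      rw [sub_eq_zero.1 h5]
  rw [h3, Finset.sum_congr rfl fun l _ => h4 l, ← Finset.sum_mul, hy.2] at h1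
  linarith

theorem BiSNE.coincidence_of_reactive {A B : Fin p → Fin q → ℝ} {x : Fin p → ℝ} {y : Fin q → ℝ}
    (h : BiSNE A B x y) {d : Fin p → ℝ} (hd : d ∈ tangent x) (h0 : bil B d y ≠ 0) {i k : Fin p}
    {j : Fin q} (hi : 0 < x i) (hk : 0 < x k) (hj : 0 < y j) : A i j = A k j :=
  eq_of_bil_eq_zero h.right_mem hj (h.bil_tangent (single_sub_single_mem_tangent hi hk))
    fun _ he => h.second_order_of_ne hd h0 (single_sub_single_mem_tangent hi hk) he

theorem bil_comb (A B : Fin p → Fin q → ℝ) (s t : ℝ) (x : Fin p → ℝ) (y : Fin q → ℝ) :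
    bil (fun i j => s * A i j + t * B i j) x y = s * bil A x y + t * bil B x y := by
  simp only [bil, Finset.mul_sum, ← Finset.sum_add_distrib]
  exact Finset.sum_congr rfl fun i _ => Finset.sum_congr rfl fun j _ => by ring

/-- Without coincidences, every strong equilibrium is pure. -/
theorem BiSNE.pure_of_no_coincidence {A B : Fin p → Fin q → ℝ} {x : Fin p → ℝ} {y : Fin q → ℝ}
    (h : BiSNE A B x y) (hc : ∀ i k j l, ¬ Coincidence A B i k j l) :
    ∃ i j, x = Pi.single i 1 ∧ y = Pi.single j 1 := by
  obtain ⟨i, hi⟩ := exists_pos_of_mem_stdSimplex h.left_mem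
  obtain ⟨j, hj⟩ := exists_pos_of_mem_stdSimplex h.right_mem
  by_cases hx : x = Pi.single i 1
  · by_cases hy : y = Pi.single j 1
    · exact ⟨i, j, hx, hy⟩
    · obtain ⟨l, hl, hyl⟩ := exists_pos_of_ne_single h.right_mem hy
      have h1 := (best_iff' h.right_mem).1 h.right_best
      have h2 := le_antisymm (h1 l hyl j) (h1 j hj l)
      simp only [rowVal, swp, hx, Pi.single_apply, ite_mul, one_mul, zero_mul,
        Finset.sum_ite_eq', Finset.mem_univ, if_true] at h2
      exact absurd (Or.inr (Or.inl ⟨hl.symm, h2⟩)) (hc i i j l)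
  · obtain ⟨k, hk, hxk⟩ := exists_pos_of_ne_single h.left_mem hx
    exfalso
    by_cases hy : y = Pi.single j 1
    · have h1 := (best_iff h.left_mem).1 h.left_best
      have h2 := le_antisymm (h1 k hxk i) (h1 i hi k)
      simp only [rowVal, hy, Pi.single_apply, ite_mul, one_mul, zero_mul,
        Finset.sum_ite_eq', Finset.mem_univ, if_true] at h2
      exact hc i k j j (Or.inl ⟨hk.symm, h2⟩)
    obtain ⟨l, hl, hyl⟩ := exists_pos_of_ne_single h.right_mem hy
    by_cases hB : ∃ d ∈ tangent x, bil B d y ≠ 0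
    · obtain ⟨d, hd, h0⟩ := hB
      exact hc i k j j (Or.inl ⟨hk.symm, h.coincidence_of_reactive hd h0 hi hxk hj⟩)
    by_cases hA : ∃ e ∈ tangent y, bil A x e ≠ 0
    · obtain ⟨e, he, h0⟩ := hA
      rw [← bil_swp] at h0
      exact hc i i j l (Or.inr (Or.inl ⟨hl.symm, h.swap.coincidence_of_reactive he h0 hj hyl hi⟩))
    push Not at hA hB
    -- Without first-order effects both changes of payoff are pure mixed terms, so the two forms are
    -- never both positive; replacing `d` by its negative shows that they are never both negative.
    have hneg : ∀ (d : tangent x) (e : tangent y), (bilin A).domRestrict₁₂ (tangent x) (tangent y) d e *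
        (bilin B).domRestrict₁₂ (tangent x) (tangent y) d e ≤ 0 := by
      have hboth : ∀ d ∈ tangent x, ∀ e ∈ tangent y, 0 < bil A d e → bil B d e ≤ 0 := by
        intro d hd e he h1
        by_contra! h2
        obtain ⟨s, hs, hs'⟩ := h.eventually_not_improving hd he
        obtain ⟨δ, h6⟩ := Filter.nonempty_of_mem hs
        obtain ⟨hδ, -, h7⟩ := hs' δ h6 δ h6
        rw [hA e he, hB d hd] at h7
        have e1 : 0 < δ * δ * bil A d e := by positivity
        have e2 : 0 < δ * δ * bil B d e := by positivity
        rcases h7 with h7 | h7 <;> linarith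
      rintro ⟨d, hd⟩ ⟨e, he⟩
      change bil A d e * bil B d e ≤ 0
      rcases lt_trichotomy (bil A d e) 0 with h1 | h1 | h1
      · have h2 := hboth _ (Submodule.smul_mem _ (-1) hd) e he (by rw [bil_smul_left]; linarith)
        rw [bil_smul_left] at h2
        exact mul_nonpos_of_nonpos_of_nonneg h1.le (by linarith)
      · rw [h1, zero_mul]
      · exact mul_nonpos_of_nonneg_of_nonpos h1.le (hboth d hd e he h1)
    obtain ⟨s, t, hst, hC⟩ := bilinear_proportional hneg
    have hC : ∀ d ∈ tangent x, ∀ e ∈ tangent y, s * bil A d e + t * bil B d e = 0 :=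
      fun d hd e he => hC ⟨d, hd⟩ ⟨e, he⟩
    set C : Fin p → Fin q → ℝ := fun i j => s * A i j + t * B i j with hCdef
    have hd := single_sub_single_mem_tangent hi hxk
    have he := single_sub_single_mem_tangent hj hyl
    have c1 : C i j = C k j := by
      refine eq_of_bil_eq_zero h.right_mem hj ?_ fun e he => ?_
      · rw [bil_comb, h.bil_tangent hd, hB _ hd]; ring
      · rw [bil_comb, hC _ hd _ he]
    have c2 : swp C j i = swp C l i := by
      refine eq_of_bil_eq_zero h.left_mem hi ?_ fun d hd => ?_
      · rw [bil_swp, bil_comb, hA _ he, ← bil_swp B, h.swap.bil_tangent he]; ring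
      · rw [bil_swp, bil_comb, hC _ hd _ he]
    simp only [swp, hCdef] at c1 c2
    refine hc i k j l (Or.inr (Or.inr ⟨hk.symm, hl.symm, ?_⟩))
    -- The payoff pairs gained by changing the row and by changing the column are both orthogonal to
    -- the nonzero vector `(s, t)`; hence they are parallel and their determinant vanishes.
    rcases hst with h0 | h0
    · apply mul_left_cancel₀ h0
      linear_combination -(B i l - B i j) * c1 + (B k j - B i j) * c2
    · apply mul_left_cancel₀ h0
      linear_combination -(A k j - A i j) * c2 + (A i l - A i j) * c1

end Degenerate

/-! ### Generic bimatrix games -/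

/-- Each identity is affine in a single payoff. For the determinant this payoff is that of agent `0`
at `(k, j)`, with the difference `B i l - B i j` as coefficient. This is why nonvanishing of that
difference is part of the null set in `h3`; it holds almost surely by `h2`. -/
theorem ae_no_coincidence (m : Fin 2 → ℕ) : ∀ᵐ V : Game m, ∀ i k j l,
    ¬ Coincidence (payoffMatrix V 0) (payoffMatrix V 1) i k j l := by
  simp only [ae_all_iff]
  intro i k j l
  have hne1 : i ≠ k → ∀ j' l', (pair i j' : Profile m) ≠ pair k l' :=
    fun h j' l' h' => h (congrFun h' 0)
  have hne2 : j ≠ l → ∀ i' k', (pair i' j : Profile m) ≠ pair k' l :=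
    fun h i' k' h' => h (congrFun h' 1)
  have h1 : ∀ᵐ V : Game m, i ≠ k → payoffMatrix V 0 i j ≠ payoffMatrix V 0 k j := by
    by_cases h : i = k
    · simp [h]
    · filter_upwards [ae_payoff_ne 0 (hne1 h j j)] with V hV _ using hV
  have h2 : ∀ᵐ V : Game m, j ≠ l → payoffMatrix V 1 i j ≠ payoffMatrix V 1 i l := by
    by_cases h : j = l
    · simp [h]
    · filter_upwards [ae_payoff_ne 1 (hne2 h i i)] with V hV _ using hV
  have h3 : ∀ᵐ V : Game m, i ≠ k → j ≠ l → ¬ (V 1 (pair i l) - V 1 (pair i j) ≠ 0 ∧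
      (V 0 (pair k j) - V 0 (pair i j)) * (V 1 (pair i l) - V 1 (pair i j)) =
      (V 1 (pair k j) - V 1 (pair i j)) * (V 0 (pair i l) - V 0 (pair i j))) := by
    by_cases h : i = k
    · simp [h]
    by_cases h' : j = l
    · simp [h']
    have h4 := ae_notMem_of_subsingleton_lines (volume : Measure (Game m))
      (s := {V | V 1 (pair i l) - V 1 (pair i j) ≠ 0 ∧
      (V 0 (pair k j) - V 0 (pair i j)) * (V 1 (pair i l) - V 1 (pair i j)) =
      (V 1 (pair k j) - V 1 (pair i j)) * (V 0 (pair i l) - V 0 (pair i j))})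
      ((measurableSet_eq_fun (by fun_prop) (by fun_prop)).compl.inter
        (measurableSet_eq_fun (by fun_prop) (by fun_prop))) (unitPayoff 0 (pair k j)) (by
        have e0 : ∀ c, (unitPayoff 0 (pair k j) : Game m) 1 c = 0 := fun c => by
          simp [unitPayoff]
        have e1 : (unitPayoff 0 (pair k j) : Game m) 0 (pair i j) = 0 := by
          rw [unitPayoff_self, Pi.single_eq_of_ne (hne1 h j j)]
        have e2 : (unitPayoff 0 (pair k j) : Game m) 0 (pair i l) = 0 := by
          rw [unitPayoff_self, Pi.single_eq_of_ne (hne1 h l j)]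
        have e3 : (unitPayoff 0 (pair k j) : Game m) 0 (pair k j) = 1 := by
          rw [unitPayoff_self, Pi.single_eq_same]
        rintro V t ⟨ht1, ht2⟩ t' ⟨-, ht2'⟩
        simp only [Pi.add_apply, Pi.smul_apply, smul_eq_mul, e0, e1, e2, e3, mul_zero, add_zero,
          mul_one] at ht1 ht2 ht2'
        apply mul_right_cancel₀ ht1
        linear_combination ht2 - ht2')
    filter_upwards [h4] with V hV _ _ using hV
  filter_upwards [h1, h2, h3] with V h1 h2 h3
  rintro (⟨h, e⟩ | ⟨h, e⟩ | ⟨h, h', e⟩)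
  · exact h1 h e
  · exact h2 h e
  · exact h3 h h' ⟨sub_ne_zero.2 (h2 h').symm, e⟩

/-! ### Cutting convex hulls by hyperplanes -/

section Cutting

variable {E : Type*} [AddCommGroup E] [Module ℝ E]

/-- The point of the segment from `P` to `Q` at which `h` vanishes. -/
noncomputable def crossing (h : E →ₗ[ℝ] ℝ) (P Q : E) : E :=
  (h P - h Q)⁻¹ • (h P • Q - h Q • P)

theorem crossing_mem {h : E →ₗ[ℝ] ℝ} {C : Set E} (hC : Convex ℝ C) {P Q : E} (hP : P ∈ C)
    (hQ : Q ∈ C) (h1 : 0 ≤ h P) (h2 : h Q < 0) : crossing h P Q ∈ C := by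
  have h3 : 0 < h P - h Q := by linarith
  have := hC hP hQ (a := (h P - h Q)⁻¹ * (-h Q)) (b := (h P - h Q)⁻¹ * h P)
    (mul_nonneg (inv_nonneg.2 h3.le) (by linarith)) (by positivity) (by field_simp; ring)
  convert this using 1
  rw [crossing]
  module

theorem map_crossing (h : E →ₗ[ℝ] ℝ) (P Q : E) : h (crossing h P Q) = 0 := by
  simp only [crossing, map_smul, map_sub, smul_eq_mul]
  ring

/-- Central projection from `Q` to the hyperplane: the crossing point of a convex combination is a
convex combination of the crossing points, with weights rescaled by the height differences `h P - h
Q`. -/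
theorem convex_crossing_left (h : E →ₗ[ℝ] ℝ) {C : Set E} (hC : Convex ℝ C) {Q : E}
    (hQ : h Q < 0) : Convex ℝ {P | 0 ≤ h P ∧ crossing h P Q ∈ C} := by
  rintro P ⟨h1, h2⟩ P' ⟨h1', h2'⟩ a b ha hb hab
  have hnn : 0 ≤ h (a • P + b • P') := by
    simp only [map_add, map_smul, smul_eq_mul]
    positivity
  refine ⟨hnn, ?_⟩
  have hD : 0 < h (a • P + b • P') - h Q := by linarith
  have := hC h2 h2' (a := (h (a • P + b • P') - h Q)⁻¹ * (a * (h P - h Q)))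
    (b := (h (a • P + b • P') - h Q)⁻¹ * (b * (h P' - h Q)))
    (mul_nonneg (inv_nonneg.2 hD.le) (mul_nonneg ha (by linarith)))
    (mul_nonneg (inv_nonneg.2 hD.le) (mul_nonneg hb (by linarith))) (by
      rw [← mul_add, inv_mul_eq_one₀ hD.ne']
      simp only [map_add, map_smul, smul_eq_mul]
      linear_combination (h Q) * hab)
  convert this using 1
  have e1 : h P - h Q ≠ 0 := by linarith
  have e2 : h P' - h Q ≠ 0 := by linarith
  simp only [crossing, smul_smul, mul_assoc]
  rw [mul_inv_cancel₀ e1, mul_inv_cancel₀ e2]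
  simp only [map_add, map_smul, smul_eq_mul]
  module

theorem convex_crossing_right (h : E →ₗ[ℝ] ℝ) {C : Set E} (hC : Convex ℝ C) {P : E}
    (hP : 0 ≤ h P) : Convex ℝ {Q | h Q < 0 ∧ crossing h P Q ∈ C} := by
  rintro Q ⟨h1, h2⟩ Q' ⟨h1', h2'⟩ a b ha hb hab
  have hneg : h (a • Q + b • Q') < 0 := by
    have : Convex ℝ {Q | h Q < 0} := convex_halfSpace_lt h.isLinear 0
    exact this h1 h1' ha hb hab
  refine ⟨hneg, ?_⟩
  have hD : 0 < h P - h (a • Q + b • Q') := by linarith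
  have := hC h2 h2' (a := (h P - h (a • Q + b • Q'))⁻¹ * (a * (h P - h Q)))
    (b := (h P - h (a • Q + b • Q'))⁻¹ * (b * (h P - h Q')))
    (mul_nonneg (inv_nonneg.2 hD.le) (mul_nonneg ha (by linarith)))
    (mul_nonneg (inv_nonneg.2 hD.le) (mul_nonneg hb (by linarith))) (by
      rw [← mul_add, inv_mul_eq_one₀ hD.ne']
      simp only [map_add, map_smul, smul_eq_mul]
      linear_combination -(h P) * hab)
  convert this using 1
  have e1 : h P - h Q ≠ 0 := by linarith
  have e2 : h P - h Q' ≠ 0 := by linarith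
  simp only [crossing, smul_smul, mul_assoc]
  rw [mul_inv_cancel₀ e1, mul_inv_cancel₀ e2]
  simp only [map_add, map_smul, smul_eq_mul]
  module

/-- The part of a convex hull in a half-space is spanned by the points in the half-space and the
crossing points of the other segments. -/
theorem mem_convexHull_of_crossing {h : E →ₗ[ℝ] ℝ} {S S' : Set E} {z : E}
    (hz : z ∈ convexHull ℝ S) (h0 : 0 ≤ h z) (h1 : ∀ P ∈ S, 0 ≤ h P → P ∈ S')
    (h2 : ∀ P ∈ S, ∀ Q ∈ S, 0 < h P → h Q < 0 → crossing h P Q ∈ S') :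
    z ∈ convexHull ℝ S' := by
  set C := convexHull ℝ S'
  have hC : Convex ℝ C := convex_convexHull ℝ S'
  have hSC : S' ⊆ C := subset_convexHull ℝ S'
  set Sp := {P ∈ S | 0 ≤ h P}
  set Sn := {P ∈ S | h P < 0}
  have hS : S = Sp ∪ Sn := by
    ext P
    constructor
    · intro hP
      rcases lt_or_ge (h P) 0 with h3 | h3
      · exact Or.inr ⟨hP, h3⟩
      · exact Or.inl ⟨hP, h3⟩
    · rintro (hP | hP) <;> exact hP.1
  have hp : convexHull ℝ Sp ⊆ C ∩ {P | 0 ≤ h P} :=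
    convexHull_min (fun P hP => ⟨hSC (h1 P hP.1 hP.2), hP.2⟩)
      (hC.inter (convex_halfSpace_ge h.isLinear 0))
  have hn : convexHull ℝ Sn ⊆ {P | h P < 0} :=
    convexHull_min (fun P hP => hP.2) (convex_halfSpace_lt h.isLinear 0)
  rcases Sn.eq_empty_or_nonempty with hne | hne
  · rw [hS, hne, Set.union_empty] at hz
    exact (hp hz).1
  rcases Sp.eq_empty_or_nonempty with hpe | hpe
  · rw [hS, hpe, Set.empty_union] at hz
    exact absurd (hn hz) (not_lt.2 h0)
  rw [hS, convexHull_union hpe hne, mem_convexJoin] at hz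
  obtain ⟨P, hP, Q, hQ, hz⟩ := hz
  obtain ⟨hPC, hP0⟩ := hp hP
  have hP0 : 0 ≤ h P := hP0
  have hQ0 : h Q < 0 := hn hQ
  -- The crossing point of `P` and `Q` is moved into `C` one end at a time: here `Q` is a generator
  -- and `P` varies over the hull of the nonnegative ones. A generator on the hyperplane is its own
  -- crossing point.
  have hstep : ∀ Q ∈ Sn, crossing h P Q ∈ C := by
    intro Q hQ
    have : convexHull ℝ Sp ⊆ {P | 0 ≤ h P ∧ crossing h P Q ∈ C} := by
      refine convexHull_min (fun P hP => ⟨hP.2, ?_⟩) (convex_crossing_left h hC hQ.2)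
      rcases hP.2.eq_or_lt with h3 | h3
      · have : crossing h P Q = P := by
          have hq : -h Q ≠ 0 := by linarith [hQ.2]
          rw [crossing, ← h3, zero_smul, zero_sub, zero_sub, ← neg_smul, smul_smul,
            inv_mul_cancel₀ hq, one_smul]
        rw [this]
        exact hSC (h1 P hP.1 hP.2)
      · exact hSC (h2 P hP.1 Q hQ.1 h3 hQ.2)
    exact (this hP).2
  have hcr : crossing h P Q ∈ C := by
    have : convexHull ℝ Sn ⊆ {Q | h Q < 0 ∧ crossing h P Q ∈ C} :=
      convexHull_min (fun Q hQ => ⟨hQ.2, hstep Q hQ⟩) (convex_crossing_right h hC hP0)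
    exact (this hQ).2
  obtain ⟨a, b, ha, hb, hab, rfl⟩ := hz
  simp only [map_add, map_smul, smul_eq_mul] at h0
  rcases hP0.eq_or_lt with h3 | h3
  · have hb0 : b = 0 := by
      rw [← h3] at h0
      by_contra hne
      have : 0 < b := lt_of_le_of_ne hb (Ne.symm hne)
      nlinarith
    subst hb0
    have : a = 1 := by linarith
    subst this
    simpa using hPC
  · have hpq : 0 < h P - h Q := by linarith
    -- Since `h` is nonnegative at `z`, this point lies between `P` and the crossing point. The
    -- weights result from eliminating `Q` in favour of the crossing point.
    have := hC hPC hcr (a := 1 - b * (h P - h Q) / h P) (b := b * (h P - h Q) / h P)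
      (by
        rw [sub_nonneg, div_le_one h3]
        have : a = 1 - b := by linarith
        subst this
        linarith) (by positivity) (by ring)
    convert this using 1
    rw [crossing, smul_smul]
    have e1 : b * (h P - h Q) / h P * (h P - h Q)⁻¹ = b / h P := by
      field_simp
    have e2 : a = 1 - b := by linarith
    rw [e1, e2, smul_sub, smul_smul, smul_smul, div_mul_cancel₀ _ h3.ne']
    have e3 : b * (h P - h Q) / h P = b - b / h P * h Q := by
      field_simp
    rw [e3]
    module

end Cutting

/-! ### Families of candidate strategies -/

section Covering

variable {d : ℕ}

/-- Every strategy `z` is a convex combination of points of `L` on which every functional in `H`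
is nonnegative if it is so at `z`. -/
def Covers (H : Set ((Fin d → ℝ) →ₗ[ℝ] ℝ)) (L : Set (Fin d → ℝ)) : Prop :=
  ∀ z ∈ stdSimplex ℝ (Fin d), z ∈ convexHull ℝ {P ∈ L | ∀ h ∈ H, 0 ≤ h z → 0 ≤ h P}

/-- If `h` is negative at `z`, there is no new condition. Otherwise the representing points with
negative value are replaced by crossing points, which lie on segments between old representing
points and so inherit all earlier sign conditions. -/
theorem Covers.insert {H : Set ((Fin d → ℝ) →ₗ[ℝ] ℝ)} {L L' : Set (Fin d → ℝ)}
    (hL : Covers H L) (hsub : L ⊆ L') {h : (Fin d → ℝ) →ₗ[ℝ] ℝ}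
    (hcross : ∀ P ∈ L, ∀ Q ∈ L, 0 < h P → h Q < 0 → crossing h P Q ∈ L') :
    Covers (insert h H) L' := by
  intro z hz
  rcases lt_or_ge (h z) 0 with h0 | h0
  · refine convexHull_mono ?_ (hL z hz)
    rintro P ⟨h1, h2⟩
    refine ⟨hsub h1, ?_⟩
    rintro g (rfl | hg) hgz
    · exact absurd hgz (not_le.2 h0)
    · exact h2 g hg hgz
  · refine mem_convexHull_of_crossing (hL z hz) h0 ?_ ?_
    · rintro P ⟨h1, h2⟩ h3
      refine ⟨hsub h1, ?_⟩
      rintro g (rfl | hg) hgz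
      · exact h3
      · exact h2 g hg hgz
    · rintro P ⟨h1, h2⟩ Q ⟨h3, h4⟩ h5 h6
      refine ⟨hcross P h1 Q h3 h5 h6, ?_⟩
      rintro g (rfl | hg) hgz
      · rw [map_crossing]
      · exact crossing_mem (convex_halfSpace_ge g.isLinear 0) (h2 g hg hgz) (h4 g hg hgz) h5.le h6

/-- The functionals `x ↦ -x i`. -/
def negCoords (d : ℕ) : Set ((Fin d → ℝ) →ₗ[ℝ] ℝ) :=
  Set.range fun i => -LinearMap.proj i

/-- For a strategy, `-x j` is nonnegative only off the support, and the unit vectors of the support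
suffice to represent it. -/
theorem covers_units {L : Set (Fin d → ℝ)} (hL : ∀ i, Pi.single i 1 ∈ L) :
    Covers (negCoords d) L := by
  intro z hz
  have h1 : ∑ i ∈ Finset.univ.filter (fun i => 0 < z i), z i • (Pi.single i 1 : Fin d → ℝ) = z := by
    rw [Finset.sum_filter_of_ne]
    · ext j
      simp [Finset.sum_apply, Pi.single_apply]
    · intro i _ hi
      exact lt_of_le_of_ne (hz.1 i) fun h => hi (by rw [← h, zero_smul])
  have h2 : ∑ i ∈ Finset.univ.filter (fun i => 0 < z i), z i = 1 := by
    rw [Finset.sum_filter_of_ne, hz.2]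
    intro i _ hi
    exact lt_of_le_of_ne (hz.1 i) (Ne.symm hi)
  rw [← h1]
  refine (convex_convexHull ℝ _).sum_mem (fun i _ => hz.1 i) h2 fun i hi => ?_
  rw [h1]
  simp only [Finset.mem_filter, Finset.mem_univ, true_and] at hi
  refine subset_convexHull ℝ _ ⟨hL i, ?_⟩
  rintro _ ⟨j, rfl⟩ hj
  simp only [LinearMap.neg_apply, LinearMap.proj_apply] at hj ⊢
  have : j ≠ i := by rintro rfl; linarith
  simp [this]

theorem Covers.exists_ge {H : Set ((Fin d → ℝ) →ₗ[ℝ] ℝ)} {L : Set (Fin d → ℝ)} (hL : Covers H L)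
    {z : Fin d → ℝ} (hz : z ∈ stdSimplex ℝ (Fin d)) (φ : (Fin d → ℝ) →ₗ[ℝ] ℝ) :
    ∃ P ∈ L, (∀ h ∈ H, 0 ≤ h z → 0 ≤ h P) ∧ φ z ≤ φ P := by
  obtain ⟨P, ⟨h1, h2⟩, h3⟩ := (φ.convexOn convex_univ).exists_ge_of_mem_convexHull
    (Set.subset_univ _) (hL z hz)
  exact ⟨P, h1, h2, h3⟩

variable {e : ℕ}

/-- The expected payoff of row `j` as a linear functional. -/
def rowLin (F : Fin e → Fin d → ℝ) (j : Fin e) : (Fin d → ℝ) →ₗ[ℝ] ℝ where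
  toFun x := rowVal F x j
  map_add' x y := by simp only [rowVal, Pi.add_apply, add_mul, Finset.sum_add_distrib]
  map_smul' c x := by
    simp only [rowVal, Pi.smul_apply, smul_eq_mul, mul_assoc, ← Finset.mul_sum, RingHom.id_apply]

/-- The difference of the expected payoffs of two rows. -/
def rowDiff (F : Fin e → Fin d → ℝ) (j l : Fin e) : (Fin d → ℝ) →ₗ[ℝ] ℝ :=
  rowLin F j - rowLin F l

theorem rowDiff_apply (F : Fin e → Fin d → ℝ) (j l : Fin e) (x : Fin d → ℝ) :
    rowDiff F j l x = rowVal F x j - rowVal F x l := rfl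

/-- A family of mixed strategies representing all supports and best responses of the opponent. -/
structure Candidates (F : Fin e → Fin d → ℝ) (L : Set (Fin d → ℝ)) : Prop where
  mem : ∀ x ∈ L, x ∈ stdSimplex ℝ (Fin d)
  covers : Covers (negCoords d ∪ Set.range fun r : Fin e × Fin e => rowDiff F r.1 r.2) L

/-- Among the candidates whose convex combination is `z`, one gives the opponent's action `j₀` at
least the value at `z`. The sign conditions become inclusion of supports and preservation of weak
comparisons, as `BiSNE.exchange` requires. -/
theorem Candidates.exists_ge {F : Fin e → Fin d → ℝ} {L : Set (Fin d → ℝ)} (hL : Candidates F L)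
    {z : Fin d → ℝ} (hz : z ∈ stdSimplex ℝ (Fin d)) (j₀ : Fin e) :
    ∃ x ∈ L, (∀ i, 0 < x i → 0 < z i) ∧
      (∀ j l, rowVal F z l ≤ rowVal F z j → rowVal F x l ≤ rowVal F x j) ∧
      rowVal F z j₀ ≤ rowVal F x j₀ := by
  obtain ⟨x, h1, h2, h3⟩ := hL.covers.exists_ge hz (rowLin F j₀)
  refine ⟨x, h1, fun i hi => ?_, fun j l hjl => ?_, h3⟩
  · by_contra hzi
    have := h2 _ (Or.inl ⟨i, rfl⟩) (by simpa using hzi)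
    simp only [LinearMap.neg_apply, LinearMap.proj_apply] at this
    linarith
  · have := h2 _ (Or.inr ⟨(j, l), rfl⟩) (by rw [rowDiff_apply]; exact sub_nonneg.2 hjl)
    rw [rowDiff_apply] at this
    exact sub_nonneg.1 this

theorem exists_biSNE_candidates {p q : ℕ} {A B : Fin p → Fin q → ℝ} {LX : Set (Fin p → ℝ)}
    {LY : Set (Fin q → ℝ)} (hX : Candidates (swp B) LX) (hY : Candidates A LY)
    (h : ∃ x y, BiSNE A B x y) : ∃ x ∈ LX, ∃ y ∈ LY, BiSNE A B x y := by
  obtain ⟨x, y, h⟩ := h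
  obtain ⟨i₀, hi₀⟩ := exists_pos_of_mem_stdSimplex h.left_mem
  obtain ⟨j₀, hj₀⟩ := exists_pos_of_mem_stdSimplex h.right_mem
  obtain ⟨x', h1, h2, h3, h4⟩ := hX.exists_ge h.left_mem j₀
  obtain ⟨y', h5, h6, h7, h8⟩ := hY.exists_ge h.right_mem i₀
  exact ⟨x', h1, y', h5, h.exchange hi₀ hj₀ (hX.mem _ h1) (hY.mem _ h5) h2 h6 h3 h7 h4 h8⟩

end Covering

/-! ### Deciding improvements in `2 × 2` games by field operations -/

section Planar

variable {R : Type*} [Add R] [Sub R] [Mul R]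

/-- Value of the linear form with coefficients `l` at `g`. -/
def lin (l g : R × R) : R := l.1 * g.1 + l.2 * g.2

/-- The vector of the cone spanned by `g` and `h` on which `l` vanishes, if `0 < l g` and
`l h < 0`. -/
def cutPoint (l g h : R × R) : R × R :=
  (lin l g * h.1 - lin l h * g.1, lin l g * h.2 - lin l h * g.2)

/-- Possible results of cutting the cone spanned by the two vectors with a half-plane. -/
def cuts (l : R × R) (c : (R × R) × (R × R)) : List ((R × R) × (R × R)) :=
  [c, (c.1, cutPoint l c.1 c.2), (cutPoint l c.2 c.1, c.2)]

/-- All candidate cones for the part of the positive quadrant in two half-planes. -/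
def cones [Zero R] [One R] (a d : R × R) : List ((R × R) × (R × R)) :=
  (cuts a ((1, 0), (0, 1))).flatMap (cuts d)

/-- The quadratic form `a d - b c`. -/
def detForm (a b c d g : R × R) : R := lin a g * lin d g - lin b g * lin c g

/-- Twice the polar form of `detForm`. -/
def detPolar (a b c d g h : R × R) : R :=
  (lin a g * lin d h + lin a h * lin d g) - (lin b g * lin c h + lin b h * lin c g)

end Planar

/-! ### Planar cones and binary quadratic forms over the reals -/

section RealPlanar

/-- `q` is a nonnegative combination of `g` and `h`. -/
def InCone (g h q : ℝ × ℝ) : Prop := ∃ α β : ℝ, 0 ≤ α ∧ 0 ≤ β ∧ q = α • g + β • h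

theorem lin_comb (l g h : ℝ × ℝ) (α β : ℝ) :
    lin l (α • g + β • h) = α * lin l g + β * lin l h := by
  simp only [lin, Prod.fst_add, Prod.snd_add, Prod.smul_fst, Prod.smul_snd, smul_eq_mul]
  ring

theorem InCone.lin_nonneg {l g h q : ℝ × ℝ} (hq : InCone g h q) (hg : 0 ≤ lin l g)
    (hh : 0 ≤ lin l h) : 0 ≤ lin l q := by
  obtain ⟨α, β, hα, hβ, rfl⟩ := hq
  rw [lin_comb]
  positivity

theorem inCone_left (g h : ℝ × ℝ) : InCone g h g := ⟨1, 0, zero_le_one, le_rfl, by simp⟩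

theorem inCone_right (g h : ℝ × ℝ) : InCone g h h := ⟨0, 1, le_rfl, zero_le_one, by simp⟩

theorem InCone.symm {g h q : ℝ × ℝ} (hq : InCone g h q) : InCone h g q := by
  obtain ⟨α, β, hα, hβ, rfl⟩ := hq
  exact ⟨β, α, hβ, hα, add_comm _ _⟩

theorem cutPoint_eq (l g h : ℝ × ℝ) : cutPoint l g h = lin l g • h - lin l h • g := rfl

/-- If `l` is positive at `q` and negative at `h`, it must be positive at `g`. The ray on which `l`
vanishes then subdivides the cone, and `q` lies in the part next to `g`. -/
theorem inCone_cutPoint {l g h q : ℝ × ℝ} (hq : InCone g h q) (hlq : 0 < lin l q)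
    (hh : lin l h < 0) : InCone g h (cutPoint l g h) ∧ InCone g (cutPoint l g h) q ∧
      0 < lin l g ∧ lin l (cutPoint l g h) = 0 := by
  obtain ⟨α, β, hα, hβ, rfl⟩ := hq
  rw [lin_comb] at hlq
  have hg : 0 < lin l g := by
    by_contra! hg
    nlinarith
  refine ⟨⟨-lin l h, lin l g, by linarith, hg.le, ?_⟩, ⟨α + β * lin l h / lin l g, β / lin l g, ?_,
    by positivity, ?_⟩, hg, ?_⟩
  · rw [cutPoint_eq]; module
  · have : α + β * lin l h / lin l g = (α * lin l g + β * lin l h) / lin l g := by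
      field_simp
    rw [this]
    positivity
  · have e1 : β / lin l g * lin l g = β := div_mul_cancel₀ _ hg.ne'
    rw [cutPoint_eq, smul_sub, smul_smul, smul_smul, e1]
    have e2 : β * lin l h / lin l g = β / lin l g * lin l h := by ring
    rw [e2]
    module
  · rw [cutPoint_eq, sub_eq_add_neg, ← neg_smul, lin_comb]
    ring

theorem exists_cut {l g h q : ℝ × ℝ} (hq : InCone g h q) (hlq : 0 < lin l q) :
    ∃ c ∈ cuts l (g, h), InCone g h c.1 ∧ InCone g h c.2 ∧ InCone c.1 c.2 q ∧
      0 ≤ lin l c.1 ∧ 0 ≤ lin l c.2 := by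
  by_cases hh : lin l h < 0
  · obtain ⟨h1, h2, h3, h4⟩ := inCone_cutPoint hq hlq hh
    exact ⟨(g, cutPoint l g h), by simp [cuts], inCone_left g h, h1, h2, h3.le, h4.ge⟩
  by_cases hg : lin l g < 0
  · obtain ⟨h1, h2, h3, h4⟩ := inCone_cutPoint hq.symm hlq hg
    exact ⟨(cutPoint l h g, h), by simp [cuts], h1.symm, inCone_right g h, h2.symm, h4.ge, h3.le⟩
  exact ⟨(g, h), by simp [cuts], inCone_left g h, inCone_right g h, hq, not_lt.1 hg, not_lt.1 hh⟩

/-- The cone spanned by the two vectors lies in the given half-planes and the positive quadrant,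
and the quadratic form `a d - b c` is positive somewhere in its interior. -/
def ConeGood (a b c d g h : ℝ × ℝ) : Prop :=
  (0 ≤ g.1 ∧ 0 ≤ g.2 ∧ 0 ≤ h.1 ∧ 0 ≤ h.2) ∧
  (0 ≤ lin a g ∧ 0 ≤ lin a h ∧ 0 ≤ lin d g ∧ 0 ≤ lin d h) ∧
  (0 < lin a g + lin a h ∧ 0 < lin d g + lin d h) ∧
  (0 < detForm a b c d g ∨ 0 < detForm a b c d h ∨
    (0 < detPolar a b c d g h ∧
      4 * (detForm a b c d g * detForm a b c d h) <
        detPolar a b c d g h * detPolar a b c d g h))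

theorem detForm_comb (a b c d g h : ℝ × ℝ) (α β : ℝ) :
    detForm a b c d (α • g + β • h) = α ^ 2 * detForm a b c d g +
      α * β * detPolar a b c d g h + β ^ 2 * detForm a b c d h := by
  simp only [detForm, detPolar, lin_comb]
  ring

theorem ConeGood.symm {a b c d g h : ℝ × ℝ} (H : ConeGood a b c d g h) :
    ConeGood a b c d h g := by
  obtain ⟨⟨h1, h2, h3, h4⟩, ⟨h5, h6, h7, h8⟩, ⟨h9, h10⟩, h11⟩ := H
  have hp : detPolar a b c d h g = detPolar a b c d g h := by
    simp only [detPolar]; ring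
  refine ⟨⟨h3, h4, h1, h2⟩, ⟨h6, h5, h8, h7⟩, ⟨by linarith, by linarith⟩, ?_⟩
  rw [hp]
  rcases h11 with k | k | ⟨k, k'⟩
  · exact Or.inr (Or.inl k)
  · exact Or.inl k
  · exact Or.inr (Or.inr ⟨k, by rwa [mul_comm (detForm a b c d h)]⟩)

theorem ConeGood.exists_of_comb {a b c d g h : ℝ × ℝ} (H : ConeGood a b c d g h) {α β : ℝ}
    (hα : 0 < α) (hβ : 0 < β) (hQ : 0 < detForm a b c d (α • g + β • h)) :
    ∃ q : ℝ × ℝ, 0 ≤ q.1 ∧ 0 ≤ q.2 ∧ 0 < lin a q ∧ 0 < lin d q ∧ 0 < detForm a b c d q := by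
  obtain ⟨⟨h1, h2, h3, h4⟩, ⟨h5, h6, h7, h8⟩, ⟨h9, h10⟩, -⟩ := H
  have pos : ∀ u v : ℝ, 0 ≤ u → 0 ≤ v → 0 < u + v → 0 < α * u + β * v := by
    intro u v hu hv huv
    rcases hu.eq_or_lt with h | h
    · have : 0 < v := by linarith
      positivity
    · positivity
  refine ⟨α • g + β • h, ?_, ?_, ?_, ?_, hQ⟩
  · simp only [Prod.fst_add, Prod.smul_fst, smul_eq_mul]
    positivity
  · simp only [Prod.snd_add, Prod.smul_snd, smul_eq_mul]
    positivity
  · rw [lin_comb]; exact pos _ _ h5 h6 h9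
  · rw [lin_comb]; exact pos _ _ h7 h8 h10

/-- The ray of `g` may lie on the boundary of a half-plane; a small multiple of `h` moves it into
the interior without losing positivity of the form. -/
theorem ConeGood.exists_of_pos {a b c d g h : ℝ × ℝ} (H : ConeGood a b c d g h)
    (hg : 0 < detForm a b c d g) :
    ∃ q : ℝ × ℝ, 0 ≤ q.1 ∧ 0 ≤ q.2 ∧ 0 < lin a q ∧ 0 < lin d q ∧ 0 < detForm a b c d q := by
  have h1 : Filter.Tendsto (fun ε : ℝ => detForm a b c d g + ε * detPolar a b c d g h +
      ε ^ 2 * detForm a b c d h) (nhdsWithin 0 (Set.Ioi 0))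
      (nhds (detForm a b c d g + 0 * detPolar a b c d g h + 0 ^ 2 * detForm a b c d h)) := by
    refine Filter.Tendsto.mono_left ?_ nhdsWithin_le_nhds
    exact Continuous.tendsto (by fun_prop) 0
  obtain ⟨ε, h2, h3⟩ := ((h1.eventually (lt_mem_nhds (a := 0) (by simpa using hg))).and
    self_mem_nhdsWithin).exists
  refine H.exists_of_comb one_pos (show 0 < ε from h3) ?_
  rw [detForm_comb]
  linarith

theorem ConeGood.exists_point {a b c d g h : ℝ × ℝ} (H : ConeGood a b c d g h) :
    ∃ q : ℝ × ℝ, 0 ≤ q.1 ∧ 0 ≤ q.2 ∧ 0 < lin a q ∧ 0 < lin d q ∧ 0 < detForm a b c d q := by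
  by_cases hg : 0 < detForm a b c d g
  · exact H.exists_of_pos hg
  by_cases hh : 0 < detForm a b c d h
  · exact H.symm.exists_of_pos hh
  obtain ⟨hp, hlt⟩ : 0 < detPolar a b c d g h ∧
      4 * (detForm a b c d g * detForm a b c d h) <
        detPolar a b c d g h * detPolar a b c d g h := by
    rcases H.2.2.2 with h' | h' | h'
    · exact absurd h' hg
    · exact absurd h' hh
    · exact h'
  rcases (not_lt.1 hg).eq_or_lt with h0 | h0
  -- The coefficient is chosen so that the form takes the value one.
  · refine H.exists_of_comb (α := (1 - detForm a b c d h) / detPolar a b c d g h)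
      (div_pos (by linarith) hp) one_pos ?_
    rw [detForm_comb, h0, mul_one, div_mul_cancel₀ _ hp.ne']
    linarith
  -- At the critical ratio the value is the discriminant times the positive number `-detForm a b c d
  -- g`.
  · refine H.exists_of_comb hp (β := -2 * detForm a b c d g) (by linarith) ?_
    rw [detForm_comb]
    have : 0 < -detForm a b c d g * (detPolar a b c d g h * detPolar a b c d g h -
      4 * (detForm a b c d g * detForm a b c d h)) := mul_pos (by linarith) (by linarith)
    linarith

/-- If all alternatives fail, the form is nonpositive on the quadrant: clear for `B ≤ 0`, and by
completing the square after multiplication by `4 * Qg` when `B > 0` and `Qg < 0`. -/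
theorem quadratic_pos_cases {Qg Qh B α β : ℝ} (hα : 0 ≤ α) (hβ : 0 ≤ β)
    (h : 0 < α ^ 2 * Qg + α * β * B + β ^ 2 * Qh) :
    0 < Qg ∨ 0 < Qh ∨ (0 < B ∧ 4 * (Qg * Qh) < B * B) := by
  by_contra! hc
  obtain ⟨h1, h2, h3⟩ := hc
  have e1 : α ^ 2 * Qg ≤ 0 := mul_nonpos_of_nonneg_of_nonpos (sq_nonneg _) h1
  have e2 : β ^ 2 * Qh ≤ 0 := mul_nonpos_of_nonneg_of_nonpos (sq_nonneg _) h2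
  rcases le_or_gt B 0 with hB | hB
  · have : α * β * B ≤ 0 := mul_nonpos_of_nonneg_of_nonpos (mul_nonneg hα hβ) hB
    linarith
  · have h4 := h3 hB
    rcases h1.eq_or_lt with h0 | h0
    · rw [h0] at h4
      nlinarith
    · have e3 : 0 ≤ (2 * α * Qg + β * B) ^ 2 + β ^ 2 * (4 * (Qg * Qh) - B * B) :=
        add_nonneg (sq_nonneg _) (mul_nonneg (sq_nonneg _) (by linarith))
      nlinarith

/-- The quadrant is cut by the two half-planes. `cones` lists the outcomes of all sign patterns
without deciding which occurs; false ones do no harm, since `ConeGood` checks the half-planes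
itself. -/
theorem exists_coneGood_iff (a b c d : ℝ × ℝ) :
    (∃ p ∈ cones a d, ConeGood a b c d p.1 p.2) ↔
      ∃ q : ℝ × ℝ, 0 ≤ q.1 ∧ 0 ≤ q.2 ∧ 0 < lin a q ∧ 0 < lin d q ∧ 0 < detForm a b c d q := by
  constructor
  · rintro ⟨p, -, hp⟩
    exact hp.exists_point
  · rintro ⟨q, h1, h2, h3, h4, h5⟩
    have hq : InCone (1, 0) (0, 1) q := ⟨q.1, q.2, h1, h2, by ext <;> simp⟩
    obtain ⟨p, hp, c1, c2, c3, c4, c5⟩ := exists_cut hq h3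
    obtain ⟨r, hr, d1, d2, d3, d4, d5⟩ := exists_cut c3 h4
    have fst : ∀ g : ℝ × ℝ, g.1 = lin (1, 0) g := fun g => by simp [lin]
    have snd : ∀ g : ℝ × ℝ, g.2 = lin (0, 1) g := fun g => by simp [lin]
    have nn1 : ∀ g, InCone (1, 0) (0, 1) g → 0 ≤ g.1 := fun g hg => by
      rw [fst]; exact hg.lin_nonneg (by simp [lin]) (by simp [lin])
    have nn2 : ∀ g, InCone (1, 0) (0, 1) g → 0 ≤ g.2 := fun g hg => by
      rw [snd]; exact hg.lin_nonneg (by simp [lin]) (by simp [lin])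
    have nn1' : ∀ g, InCone p.1 p.2 g → 0 ≤ g.1 := fun g hg => by
      rw [fst]; exact hg.lin_nonneg (by rw [← fst]; exact nn1 _ c1) (by rw [← fst]; exact nn1 _ c2)
    have nn2' : ∀ g, InCone p.1 p.2 g → 0 ≤ g.2 := fun g hg => by
      rw [snd]; exact hg.lin_nonneg (by rw [← snd]; exact nn2 _ c1) (by rw [← snd]; exact nn2 _ c2)
    have a1 := d1.lin_nonneg c4 c5
    have a2 := d2.lin_nonneg c4 c5
    refine ⟨r, List.mem_flatMap.2 ⟨p, hp, hr⟩, ⟨nn1' _ d1, nn2' _ d1, nn1' _ d2, nn2' _ d2⟩,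
      ⟨a1, a2, d4, d5⟩, ?_, ?_⟩
    · have sum_pos : ∀ l, 0 ≤ lin l r.1 → 0 ≤ lin l r.2 → 0 < lin l q →
          0 < lin l r.1 + lin l r.2 := by
        intro l e1 e2 e3
        obtain ⟨α, β, hα, hβ, hq'⟩ := d3
        rw [hq', lin_comb] at e3
        by_contra! h
        have f1 : lin l r.1 = 0 := by linarith
        have f2 : lin l r.2 = 0 := by linarith
        simp [f1, f2] at e3
      exact ⟨sum_pos a a1 a2 h3, sum_pos d d4 d5 h4⟩
    · obtain ⟨α, β, hα, hβ, hq'⟩ := d3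
      rw [hq', detForm_comb] at h5
      exact quadratic_pos_cases hα hβ h5

/-- Two points span a cone meeting the open quadrant if one of them lies in it, or if they lie on
different sides of it and the determinant has the right sign. -/
theorem exists_two_point_iff (α₁ α₂ β₁ β₂ : ℝ) :
    (∃ s₁ s₂ : ℝ, 0 ≤ s₁ ∧ 0 ≤ s₂ ∧ 0 < s₁ * α₁ + s₂ * α₂ ∧ 0 < s₁ * β₁ + s₂ * β₂) ↔
      (0 < α₁ ∧ 0 < β₁) ∨ (0 < α₂ ∧ 0 < β₂) ∨ (0 < α₁ ∧ 0 < β₂ ∧ β₁ * α₂ < α₁ * β₂) ∨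
        (0 < α₂ ∧ 0 < β₁ ∧ β₂ * α₁ < α₂ * β₁) := by
  have sound : ∀ α₁ α₂ β₁ β₂ : ℝ, 0 < α₁ → 0 < β₂ → β₁ * α₂ < α₁ * β₂ →
      ∃ s₁ s₂ : ℝ, 0 ≤ s₁ ∧ 0 ≤ s₂ ∧ 0 < s₁ * α₁ + s₂ * α₂ ∧ 0 < s₁ * β₁ + s₂ * β₂ := by
    intro α₁ α₂ β₁ β₂ h1 h2 h3
    rcases lt_or_ge 0 β₁ with hb | hb
    · exact ⟨1, 0, zero_le_one, le_rfl, by simpa using h1, by simpa using hb⟩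
    rcases lt_or_ge 0 α₂ with ha | ha
    · exact ⟨0, 1, le_rfl, zero_le_one, by simpa using ha, by simpa using h2⟩
    -- These weights make both coordinates equal to the determinant.
    exact ⟨β₂ - α₂, α₁ - β₁, by linarith, by linarith, by nlinarith, by nlinarith⟩
  have complete : ∀ α₁ α₂ β₁ β₂ s₁ s₂ : ℝ, 0 ≤ s₁ → 0 ≤ s₂ → 0 < s₁ * α₁ + s₂ * α₂ →
      0 < s₁ * β₁ + s₂ * β₂ → α₂ ≤ 0 → β₁ ≤ 0 →
      0 < α₁ ∧ 0 < β₂ ∧ β₁ * α₂ < α₁ * β₂ := by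
    intro α₁ α₂ β₁ β₂ s₁ s₂ hs₁ hs₂ h1 h2 ha hb
    have e1 : s₂ * α₂ ≤ 0 := mul_nonpos_of_nonneg_of_nonpos hs₂ ha
    have e2 : s₁ * β₁ ≤ 0 := mul_nonpos_of_nonneg_of_nonpos hs₁ hb
    have f1 : 0 < s₁ * α₁ := by linarith
    have f2 : 0 < s₂ * β₂ := by linarith
    have g1 := pos_of_mul_pos_right f1 hs₁
    have g2 := pos_of_mul_pos_right f2 hs₂
    have k1 : 0 < s₁ := pos_of_mul_pos_left f1 g1.le
    have k2 : 0 < s₂ := pos_of_mul_pos_left f2 g2.le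
    refine ⟨g1, g2, ?_⟩
    have m1 : (-(s₂ * α₂)) * (-(s₁ * β₁)) ≤ (s₁ * α₁) * (-(s₁ * β₁)) :=
      mul_le_mul_of_nonneg_right (by linarith) (by linarith)
    have m2 : (s₁ * α₁) * (-(s₁ * β₁)) < (s₁ * α₁) * (s₂ * β₂) :=
      mul_lt_mul_of_pos_left (by linarith) f1
    have m3 : (s₁ * s₂) * (β₁ * α₂) < (s₁ * s₂) * (α₁ * β₂) := by linarith
    exact lt_of_mul_lt_mul_left m3 (by positivity)
  constructor
  · rintro ⟨s₁, s₂, hs₁, hs₂, h1, h2⟩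
    rcases lt_or_ge 0 α₁ with a1 | a1 <;> rcases lt_or_ge 0 β₁ with b1 | b1
    · exact Or.inl ⟨a1, b1⟩
    · rcases lt_or_ge 0 α₂ with a2 | a2
      · refine Or.inr (Or.inl ⟨a2, ?_⟩)
        by_contra! b2
        have e1 : s₂ * β₂ ≤ 0 := mul_nonpos_of_nonneg_of_nonpos hs₂ b2
        have e2 : s₁ * β₁ ≤ 0 := mul_nonpos_of_nonneg_of_nonpos hs₁ b1
        linarith
      · exact Or.inr (Or.inr (Or.inl (complete _ _ _ _ _ _ hs₁ hs₂ h1 h2 a2 b1)))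
    · rcases lt_or_ge 0 β₂ with b2 | b2
      · refine Or.inr (Or.inl ⟨?_, b2⟩)
        by_contra! a2
        have e1 : s₂ * α₂ ≤ 0 := mul_nonpos_of_nonneg_of_nonpos hs₂ a2
        have e2 : s₁ * α₁ ≤ 0 := mul_nonpos_of_nonneg_of_nonpos hs₁ a1
        linarith
      · exact Or.inr (Or.inr (Or.inr (complete _ _ _ _ _ _ hs₂ hs₁ (by linarith) (by linarith)
          a1 b2)))
    · refine Or.inr (Or.inl ⟨?_, ?_⟩)
      · by_contra! a2
        have e1 : s₂ * α₂ ≤ 0 := mul_nonpos_of_nonneg_of_nonpos hs₂ a2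
        have e2 : s₁ * α₁ ≤ 0 := mul_nonpos_of_nonneg_of_nonpos hs₁ a1
        linarith
      · by_contra! b2
        have e1 : s₂ * β₂ ≤ 0 := mul_nonpos_of_nonneg_of_nonpos hs₂ b2
        have e2 : s₁ * β₁ ≤ 0 := mul_nonpos_of_nonneg_of_nonpos hs₁ b1
        linarith
  · rintro (⟨h1, h2⟩ | ⟨h1, h2⟩ | ⟨h1, h2, h3⟩ | ⟨h1, h2, h3⟩)
    · exact ⟨1, 0, zero_le_one, le_rfl, by simpa using h1, by simpa using h2⟩
    · exact ⟨0, 1, le_rfl, zero_le_one, by simpa using h1, by simpa using h2⟩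
    · exact sound _ _ _ _ h1 h2 h3
    · obtain ⟨s₁, s₂, k1, k2, k3, k4⟩ := sound _ _ _ _ h1 h2 h3
      exact ⟨s₂, s₁, k2, k1, by linarith, by linarith⟩

/-- Decidable criterion for improvements in a `2 × 2` game with the rows `a, c` of the first and
`b, d` of the second agent. -/
def QuadCriterion (a b c d : ℝ × ℝ) : Prop :=
  (0 < a.1 ∧ 0 < b.1) ∨ (0 < a.1 ∧ 0 < b.2 ∧ b.1 * a.2 < a.1 * b.2) ∨
    ∃ p ∈ cones a d, ConeGood a b c d p.1 p.2

end RealPlanar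

/-! ### Refutation of equilibria by the criterion for two rows and two columns -/

section Quad

variable {p q : ℕ}

/-- The payoffs of row `i` in the columns `j` and `l`, relative to `v`. -/
def rowPair (A : Fin p → Fin q → ℝ) (v : ℝ) (i : Fin p) (j l : Fin q) : ℝ × ℝ :=
  (A i j - v, A i l - v)

theorem quadImproves_iff (A B : Fin p → Fin q → ℝ) (v w : ℝ) (i k : Fin p) (j l : Fin q) :
    QuadImproves A B v w i k j l ↔ ∃ r₁ r₂ : ℝ, ∃ s : ℝ × ℝ, 0 ≤ s.1 ∧ 0 ≤ s.2 ∧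
      0 ≤ r₁ ∧ 0 ≤ r₂ ∧ 0 < r₁ * lin (rowPair A v i j l) s + r₂ * lin (rowPair A v k j l) s ∧
      0 < r₁ * lin (rowPair B w i j l) s + r₂ * lin (rowPair B w k j l) s := by
  constructor
  · rintro ⟨r₁, r₂, s₁, s₂, hr₁, hr₂, hs₁, hs₂, h1, h2⟩
    refine ⟨r₁, r₂, (s₁, s₂), hs₁, hs₂, hr₁, hr₂, ?_, ?_⟩
    · simp only [lin, rowPair]; linarith
    · simp only [lin, rowPair]; linarith
  · rintro ⟨r₁, r₂, ⟨s₁, s₂⟩, hs₁, hs₂, hr₁, hr₂, h1, h2⟩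
    refine ⟨r₁, r₂, s₁, s₂, hr₁, hr₂, hs₁, hs₂, ?_, ?_⟩
    · simp only [lin, rowPair] at h1; linarith
    · simp only [lin, rowPair] at h2; linarith

/-- For fixed column weights each row gives a point of the plane. The first two cases use row `i`
alone; in the third, row `i` serves the first agent and row `k` the second, and the determinant of
`exists_two_point_iff` is `detForm` in the column weights. -/
theorem quadImproves_of_criterion {A B : Fin p → Fin q → ℝ} {v w : ℝ} {i k : Fin p} {j l : Fin q}
    (h : QuadCriterion (rowPair A v i j l) (rowPair B w i j l) (rowPair A v k j l)
      (rowPair B w k j l)) : QuadImproves A B v w i k j l := by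
  rw [quadImproves_iff]
  have row : ((0 < A i j - v ∧ 0 < B i j - w) ∨ (0 < A i j - v ∧ 0 < B i l - w ∧
      (B i j - w) * (A i l - v) < (A i j - v) * (B i l - w))) →
      ∃ r₁ r₂ : ℝ, ∃ s : ℝ × ℝ, 0 ≤ s.1 ∧ 0 ≤ s.2 ∧
      0 ≤ r₁ ∧ 0 ≤ r₂ ∧ 0 < r₁ * lin (rowPair A v i j l) s + r₂ * lin (rowPair A v k j l) s ∧
      0 < r₁ * lin (rowPair B w i j l) s + r₂ * lin (rowPair B w k j l) s := by
    intro h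
    obtain ⟨s₁, s₂, h1, h2, h3, h4⟩ := (exists_two_point_iff (A i j - v) (A i l - v) (B i j - w)
      (B i l - w)).2 (by
        rcases h with h | h
        · exact Or.inl h
        · exact Or.inr (Or.inr (Or.inl h)))
    refine ⟨1, 0, (s₁, s₂), h1, h2, zero_le_one, le_rfl, ?_, ?_⟩
    · simp only [lin, rowPair]; linarith
    · simp only [lin, rowPair]; linarith
  rcases h with h | h | h
  · exact row (Or.inl h)
  · exact row (Or.inr h)
  · obtain ⟨s, h1, h2, h3, h4, h5⟩ := (exists_coneGood_iff _ _ _ _).1 h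
    simp only [detForm, sub_pos] at h5
    obtain ⟨r₁, r₂, g1, g2, g3, g4⟩ := (exists_two_point_iff _ _ _ _).2
      (Or.inr (Or.inr (Or.inl ⟨h3, h4, h5⟩)))
    exact ⟨r₁, r₂, s, h1, h2, g1, g2, g3, g4⟩

/-- The criterion is not symmetric in the two rows or the two columns. The omitted cases are
recovered by exchanging indices, which is harmless because all index tuples are searched. -/
theorem exists_criterion_of_quadImproves {A B : Fin p → Fin q → ℝ} {v w : ℝ} {i k : Fin p}
    {j l : Fin q} (h : QuadImproves A B v w i k j l) :
    ∃ i k j l, QuadCriterion (rowPair A v i j l) (rowPair B w i j l) (rowPair A v k j l)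
      (rowPair B w k j l) := by
  rw [quadImproves_iff] at h
  obtain ⟨r₁, r₂, s, hs₁, hs₂, hr₁, hr₂, h1, h2⟩ := h
  have row : ∀ i, 0 < lin (rowPair A v i j l) s → 0 < lin (rowPair B w i j l) s →
      ∃ i k j l, QuadCriterion (rowPair A v i j l) (rowPair B w i j l) (rowPair A v k j l)
      (rowPair B w k j l) := by
    intro i h1 h2
    rcases (exists_two_point_iff (A i j - v) (A i l - v) (B i j - w)
      (B i l - w)).1 ⟨s.1, s.2, hs₁, hs₂, by simp only [lin, rowPair] at h1; linarith,
        by simp only [lin, rowPair] at h2; linarith⟩ with h | h | h | h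
    · exact ⟨i, i, j, l, Or.inl h⟩
    · exact ⟨i, i, l, j, Or.inl h⟩
    · exact ⟨i, i, j, l, Or.inr (Or.inl h)⟩
    · exact ⟨i, i, l, j, Or.inr (Or.inl h)⟩
  rcases (exists_two_point_iff _ _ _ _).1 ⟨r₁, r₂, hr₁, hr₂, h1, h2⟩ with h | h | h | h
  · exact row i h.1 h.2
  · exact row k h.1 h.2
  · exact ⟨i, k, j, l, Or.inr (Or.inr ((exists_coneGood_iff _ _ _ _).2
      ⟨s, hs₁, hs₂, h.1, h.2.1, sub_pos.2 h.2.2⟩))⟩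
  · exact ⟨k, i, j, l, Or.inr (Or.inr ((exists_coneGood_iff _ _ _ _).2
      ⟨s, hs₁, hs₂, h.1, h.2.1, sub_pos.2 h.2.2⟩))⟩

/-- A witness that `(x, y)` is not a strong equilibrium. -/
def Refutes (A B : Fin p → Fin q → ℝ) (x : Fin p → ℝ) (y : Fin q → ℝ) (i₀ : Fin p) (j₀ : Fin q)
    (i k : Fin p) (j l : Fin q) : Prop :=
  0 < x i₀ ∧ 0 < y j₀ ∧ (rowVal A y i₀ < rowVal A y i ∨ rowVal (swp B) x j₀ < rowVal (swp B) x j ∨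
    QuadCriterion (rowPair A (rowVal A y i₀) i j l) (rowPair B (rowVal (swp B) x j₀) i j l)
      (rowPair A (rowVal A y i₀) k j l) (rowPair B (rowVal (swp B) x j₀) k j l))

theorem biSNE_iff_not_refutes {A B : Fin p → Fin q → ℝ} {x : Fin p → ℝ} {y : Fin q → ℝ}
    (hx : x ∈ stdSimplex ℝ (Fin p)) (hy : y ∈ stdSimplex ℝ (Fin q)) :
    BiSNE A B x y ↔ ¬ ∃ i₀ j₀ i k j l, Refutes A B x y i₀ j₀ i k j l := by
  rw [biSNE_iff hx hy]
  constructor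
  · rintro h ⟨i₀, j₀, i, k, j, l, h1, h2, h3⟩
    obtain ⟨g1, g2, g3⟩ := h i₀ j₀ h1 h2 i k j l
    rcases h3 with h3 | h3 | h3
    · exact absurd g1 (not_le.2 h3)
    · exact absurd g2 (not_le.2 h3)
    · exact g3 (quadImproves_of_criterion h3)
  · intro h i₀ j₀ h1 h2 i k j l
    refine ⟨?_, ?_, ?_⟩
    · by_contra! hc
      exact h ⟨i₀, j₀, i, k, j, l, h1, h2, Or.inl hc⟩
    · by_contra! hc
      exact h ⟨i₀, j₀, i, k, j, l, h1, h2, Or.inr (Or.inl hc)⟩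
    · intro hc
      obtain ⟨i', k', j', l', hc'⟩ := exists_criterion_of_quadImproves hc
      exact h ⟨i₀, j₀, i', k', j', l', h1, h2, Or.inr (Or.inr hc')⟩

end Quad

/-! ### Expressions and tests -/

section Expressions

instance : Add RealExpr := ⟨RealExpr.add⟩
instance : Sub RealExpr := ⟨RealExpr.sub⟩
instance : Mul RealExpr := ⟨RealExpr.mul⟩
instance : Zero RealExpr := ⟨RealExpr.const 0⟩
instance : One RealExpr := ⟨RealExpr.const 1⟩

theorem RealExpr.eval_add (s : State) (e f : RealExpr) : (e + f).eval s = e.eval s + f.eval s := rfl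
theorem RealExpr.eval_sub (s : State) (e f : RealExpr) : (e - f).eval s = e.eval s - f.eval s := rfl
theorem RealExpr.eval_mul (s : State) (e f : RealExpr) : (e * f).eval s = e.eval s * f.eval s := rfl
theorem RealExpr.eval_zero (s : State) : (0 : RealExpr).eval s = 0 := by
  simp [RealExpr.eval]
theorem RealExpr.eval_one (s : State) : (1 : RealExpr).eval s = 1 := by
  simp [RealExpr.eval]

/-- Disjunction of tests. -/
def Test.or (b c : Test) : Test := .not (.and (.not b) (.not c))

/-- Strict comparison of reals. -/
def Test.realLt (e f : RealExpr) : Test := .not (.realLe f e)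

/-- Equality of reals. -/
def Test.realEq (e f : RealExpr) : Test := .and (.realLe e f) (.realLe f e)

/-- Inequality of integer variables. -/
def Test.varNe (v w : ℕ) : Test := .not (.and (.natLe (.var v) (.var w)) (.natLe (.var w) (.var v)))

/-- Disjunction of a list of tests. -/
def Test.any : List Test → Test
  | [] => .not (.natLe (.const 0) (.const 0))
  | b :: l => .or b (.any l)

@[simp] theorem Test.holds_not {s : State} {b : Test} : (Test.not b).Holds s ↔ ¬ b.Holds s := Iff.rfl

@[simp] theorem Test.holds_and {s : State} {b c : Test} :
    (Test.and b c).Holds s ↔ b.Holds s ∧ c.Holds s := Iff.rfl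

@[simp] theorem Test.holds_or {s : State} {b c : Test} :
    (Test.or b c).Holds s ↔ b.Holds s ∨ c.Holds s := by
  simp only [Test.or, Test.holds_not, Test.holds_and]
  tauto

@[simp] theorem Test.holds_realLt {s : State} {e f : RealExpr} :
    (Test.realLt e f).Holds s ↔ e.eval s < f.eval s := not_le

@[simp] theorem Test.holds_realLe {s : State} {e f : RealExpr} :
    (Test.realLe e f).Holds s ↔ e.eval s ≤ f.eval s := Iff.rfl

@[simp] theorem Test.holds_realEq {s : State} {e f : RealExpr} :
    (Test.realEq e f).Holds s ↔ e.eval s = f.eval s := le_antisymm_iff.symm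

@[simp] theorem Test.holds_varNe {s : State} {v w : ℕ} :
    (Test.varNe v w).Holds s ↔ s.var v ≠ s.var w := not_congr le_antisymm_iff.symm

@[simp] theorem Test.holds_any {s : State} {l : List Test} :
    (Test.any l).Holds s ↔ ∃ b ∈ l, b.Holds s := by
  induction l with
  | nil => simp [Test.any, Test.Holds]
  | cons b l ih => simp [Test.any, ih]

/-- Values of a pair of expressions. -/
noncomputable def evalPair (s : State) (g : RealExpr × RealExpr) : ℝ × ℝ := (g.1.eval s, g.2.eval s)

/-- The planar formulas are polymorphic in the operations, so the same definitions produce both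
expressions and real numbers, and evaluation commutes with them definitionally. -/
theorem eval_lin (s : State) (l g : RealExpr × RealExpr) :
    (lin l g).eval s = lin (evalPair s l) (evalPair s g) := rfl

theorem eval_detForm (s : State) (a b c d g : RealExpr × RealExpr) :
    (detForm a b c d g).eval s =
      detForm (evalPair s a) (evalPair s b) (evalPair s c) (evalPair s d) (evalPair s g) := rfl

theorem eval_detPolar (s : State) (a b c d g h : RealExpr × RealExpr) :
    (detPolar a b c d g h).eval s = detPolar (evalPair s a) (evalPair s b) (evalPair s c)
      (evalPair s d) (evalPair s g) (evalPair s h) := rfl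

theorem map_cuts (s : State) (l : RealExpr × RealExpr)
    (c : (RealExpr × RealExpr) × (RealExpr × RealExpr)) :
    (cuts l c).map (Prod.map (evalPair s) (evalPair s)) =
      cuts (evalPair s l) (Prod.map (evalPair s) (evalPair s) c) := rfl

theorem map_cones (s : State) (a d : RealExpr × RealExpr) :
    (cones a d).map (Prod.map (evalPair s) (evalPair s)) = cones (evalPair s a) (evalPair s d) := by
  have h : cuts (evalPair s a) ((1, 0), (0, 1)) =
      (cuts a ((1, 0), (0, 1))).map (Prod.map (evalPair s) (evalPair s)) := by
    rw [map_cuts]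
    simp [evalPair, RealExpr.eval_one, RealExpr.eval_zero]
  rw [cones, cones, h, List.map_flatMap, List.flatMap_map]
  rfl

/-- The test for `ConeGood`. -/
def coneTest (a b c d g h : RealExpr × RealExpr) : Test :=
  .and (.and (.and (.realLe 0 g.1) (.realLe 0 g.2)) (.and (.realLe 0 h.1) (.realLe 0 h.2)))
    (.and (.and (.and (.realLe 0 (lin a g)) (.realLe 0 (lin a h)))
      (.and (.realLe 0 (lin d g)) (.realLe 0 (lin d h))))
    (.and (.and (.realLt 0 (lin a g + lin a h)) (.realLt 0 (lin d g + lin d h)))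
      (.or (.realLt 0 (detForm a b c d g)) (.or (.realLt 0 (detForm a b c d h))
        (.and (.realLt 0 (detPolar a b c d g h))
          (.realLt (.const 4 * (detForm a b c d g * detForm a b c d h))
            (detPolar a b c d g h * detPolar a b c d g h)))))))

theorem holds_coneTest {s : State} {a b c d g h : RealExpr × RealExpr} :
    (coneTest a b c d g h).Holds s ↔ ConeGood (evalPair s a) (evalPair s b) (evalPair s c)
      (evalPair s d) (evalPair s g) (evalPair s h) := by
  simp only [coneTest, Test.holds_and, Test.holds_or, Test.holds_realLe, Test.holds_realLt,
    RealExpr.eval_zero, RealExpr.eval_add, RealExpr.eval_mul, eval_lin, eval_detForm, eval_detPolar,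
    ConeGood, and_assoc]
  have h4 : (RealExpr.const 4).eval s = 4 := by simp [RealExpr.eval]
  rw [h4]
  rfl

/-- The test for `QuadCriterion`. -/
def quadTest (a b c d : RealExpr × RealExpr) : Test :=
  .or (.and (.realLt 0 a.1) (.realLt 0 b.1))
    (.or (.and (.realLt 0 a.1) (.and (.realLt 0 b.2) (.realLt (b.1 * a.2) (a.1 * b.2))))
      (.any ((cones a d).map fun p => coneTest a b c d p.1 p.2)))

theorem holds_quadTest {s : State} {a b c d : RealExpr × RealExpr} :
    (quadTest a b c d).Holds s ↔ QuadCriterion (evalPair s a) (evalPair s b) (evalPair s c)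
      (evalPair s d) := by
  simp only [quadTest, Test.holds_and, Test.holds_or, Test.holds_realLt, RealExpr.eval_zero,
    RealExpr.eval_mul, Test.holds_any, List.mem_map, exists_exists_and_eq_and, holds_coneTest,
    QuadCriterion, ← map_cones, Prod.map_fst, Prod.map_snd]
  rfl

end Expressions

/-! ### Program logic -/

section Logic

/-- From `s`, the program `p` halts within `T` steps in a state satisfying `Q`. -/
def Ensures (p : Program) (s : State) (T : ℕ∞) (Q : State → Prop) : Prop :=
  ∃ t s', Runs p s t s' ∧ (t : ℕ∞) ≤ T ∧ Q s'

/-- `p` contains an assignment to the integer variable `w`. -/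
def Program.writesVar (w : ℕ) : Program → Bool
  | .nop => false
  | .setNat v _ => decide (v = w)
  | .putNat _ _ _ => false
  | .putReal _ _ _ => false
  | .seq p q => p.writesVar w || q.writesVar w
  | .ite _ p q => p.writesVar w || q.writesVar w
  | .loop _ p => p.writesVar w

/-- `p` contains an assignment to the real array `arr`. -/
def Program.writesReal (arr : ℕ) : Program → Bool
  | .nop => false
  | .setNat _ _ => false
  | .putNat _ _ _ => false
  | .putReal a _ _ => decide (a = arr)
  | .seq p q => p.writesReal arr || q.writesReal arr
  | .ite _ p q => p.writesReal arr || q.writesReal arr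
  | .loop _ p => p.writesReal arr

/-- `s` and `s'` agree in all variables and real arrays to which `p` does not write. -/
def SameOff (p : Program) (s s' : State) : Prop :=
  (∀ w, p.writesVar w = false → s'.var w = s.var w) ∧
    ∀ arr, p.writesReal arr = false → s'.realArr arr = s.realArr arr

theorem SameOff.refl (p : Program) (s : State) : SameOff p s s := ⟨fun _ _ => rfl, fun _ _ => rfl⟩

theorem SameOff.trans {p : Program} {s s' s'' : State} (h : SameOff p s s')
    (h' : SameOff p s' s'') : SameOff p s s'' :=
  ⟨fun w hw => (h'.1 w hw).trans (h.1 w hw), fun a ha => (h'.2 a ha).trans (h.2 a ha)⟩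

theorem SameOff.mono {p q : Program} {s s' : State} (h : SameOff p s s')
    (hv : ∀ w, q.writesVar w = false → p.writesVar w = false)
    (hr : ∀ w, q.writesReal w = false → p.writesReal w = false) : SameOff q s s' :=
  ⟨fun w hw => h.1 w (hv w hw), fun a ha => h.2 a (hr a ha)⟩

/-- A syntactic frame rule: it spares the specifications from listing what a program leaves
unchanged, since the writes of a concrete program can be computed. -/
theorem Runs.sameOff {p : Program} {s s' : State} {t : ℕ} (h : Runs p s t s') : SameOff p s s' := by
  induction h with
  | nop s => exact SameOff.refl _ _
  | setNat s v e =>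
    refine ⟨fun w hw => ?_, fun _ _ => rfl⟩
    have : w ≠ v := fun h => by simp [Program.writesVar, h] at hw
    simp [State.setNat, this]
  | putNat s arr i e => exact ⟨fun _ _ => rfl, fun _ _ => rfl⟩
  | putReal s arr i e =>
    refine ⟨fun _ _ => rfl, fun w hw => ?_⟩
    have : w ≠ arr := fun h => by simp [Program.writesReal, h] at hw
    simp [State.putReal, this]
  | seq _ _ h1 h2 =>
    refine (h1.mono ?_ ?_).trans (h2.mono ?_ ?_) <;>
      simp +contextual [Program.writesVar, Program.writesReal]
  | iteTrue q _ _ h =>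
    refine h.mono ?_ ?_ <;> simp +contextual [Program.writesVar, Program.writesReal]
  | iteFalse q _ _ h =>
    refine h.mono ?_ ?_ <;> simp +contextual [Program.writesVar, Program.writesReal]
  | loopDone p _ => exact SameOff.refl _ _
  | loopStep _ _ _ h1 h2 =>
    exact (h1.mono (by simp [Program.writesVar]) (by simp [Program.writesReal])).trans h2

theorem Ensures.frame {p : Program} {s : State} {T : ℕ∞} {Q : State → Prop}
    (h : Ensures p s T Q) : Ensures p s T fun s' => Q s' ∧ SameOff p s s' := by
  obtain ⟨t, s', h1, h2, h3⟩ := h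
  exact ⟨t, s', h1, h2, h3, h1.sameOff⟩

theorem Ensures.mono {p : Program} {s : State} {T T' : ℕ∞} {Q Q' : State → Prop}
    (h : Ensures p s T Q) (hT : T ≤ T') (hQ : ∀ s', Q s' → Q' s') : Ensures p s T' Q' := by
  obtain ⟨t, s', h1, h2, h3⟩ := h
  exact ⟨t, s', h1, h2.trans hT, hQ s' h3⟩

theorem ensures_nop {s : State} {Q : State → Prop} (h : Q s) : Ensures .nop s 1 Q :=
  ⟨1, s, Runs.nop s, le_rfl, h⟩

theorem ensures_setNat {s : State} {v : ℕ} {e : NatExpr} {Q : State → Prop}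
    (h : Q (s.setNat v (e.eval s))) : Ensures (.setNat v e) s (e.cost + 1 : ℕ) Q :=
  ⟨_, _, Runs.setNat s v e, le_rfl, h⟩

theorem ensures_putReal {s : State} {arr : ℕ} {i : NatExpr} {e : RealExpr} {Q : State → Prop}
    (h : Q (s.putReal arr (i.eval s) (e.eval s))) :
    Ensures (.putReal arr i e) s (i.cost + e.cost + 1 : ℕ) Q :=
  ⟨_, _, Runs.putReal s arr i e, le_rfl, h⟩

theorem Ensures.seq {p q : Program} {s : State} {T T' : ℕ∞} {P Q : State → Prop}
    (h : Ensures p s T P) (h' : ∀ s', P s' → SameOff p s s' → Ensures q s' T' Q) :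
    Ensures (.seq p q) s (T + T') Q := by
  obtain ⟨t, s', h1, h2, h3⟩ := h
  obtain ⟨t', s'', h4, h5, h6⟩ := h' s' h3 h1.sameOff
  exact ⟨t + t', s'', h1.seq h4, by push_cast; exact add_le_add h2 h5, h6⟩

theorem ensures_ite {b : Test} {p q : Program} {s : State} {T : ℕ∞} {Q : State → Prop}
    (hp : b.Holds s → Ensures p s T Q) (hq : ¬ b.Holds s → Ensures q s T Q) :
    Ensures (.ite b p q) s (b.cost + 1 + T) Q := by
  by_cases hb : b.Holds s
  · obtain ⟨t, s', h1, h2, h3⟩ := hp hb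
    exact ⟨_, s', Runs.iteTrue q hb h1, by push_cast; exact add_le_add le_rfl h2, h3⟩
  · obtain ⟨t, s', h1, h2, h3⟩ := hq hb
    exact ⟨_, s', Runs.iteFalse p hb h1, by push_cast; exact add_le_add le_rfl h2, h3⟩

/-- `for v in 0..<n do p`. -/
def forLoop (v : ℕ) (n : NatExpr) (p : Program) : Program :=
  .seq (.setNat v (.const 0))
    (.loop (.not (.natLe n (.var v))) (.seq p (.setNat v (.add (.var v) (.const 1)))))

theorem writesVar_forLoop (w v : ℕ) (n : NatExpr) (p : Program) :
    (forLoop v n p).writesVar w = (decide (v = w) || p.writesVar w) := by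
  simp only [forLoop, Program.writesVar]
  cases decide (v = w) <;> cases p.writesVar w <;> rfl

theorem writesReal_forLoop (w v : ℕ) (n : NatExpr) (p : Program) :
    (forLoop v n p).writesReal w = p.writesReal w := by
  simp [forLoop, Program.writesReal]

/-- The invariant must tolerate assignments to the counter, which occur between iterations. The
overhead per iteration is `n.cost + 4` for the test and `4` for the increment; the last summand
covers the initialization and the final test. The bound `T` may be infinite. -/
theorem ensures_forLoop {v : ℕ} {n : NatExpr} {p : Program} {s : State} {T : ℕ∞} {N : ℕ}
    (Inv : ℕ → State → Prop) (hN : ∀ s', SameOff (forLoop v n p) s s' → n.eval s' = N)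
    (hv : p.writesVar v = false) (hInv : ∀ k s' x, Inv k s' → Inv k (s'.setNat v x))
    (h0 : Inv 0 s)
    (hstep : ∀ k < N, ∀ s', SameOff (forLoop v n p) s s' → s'.var v = k → Inv k s' →
      Ensures p s' T (Inv (k + 1))) :
    Ensures (forLoop v n p) s (N * (T + (n.cost + 8 : ℕ)) + (n.cost + 8 : ℕ)) (Inv N) := by
  have hp : ∀ s₁ s₂, SameOff p s₁ s₂ → SameOff (forLoop v n p) s₁ s₂ := fun s₁ s₂ h =>
    h.mono (fun w => by rw [writesVar_forLoop]; simp +contextual)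
      (fun w => by rw [writesReal_forLoop]; exact id)
  have hset : ∀ s₁ x, SameOff (forLoop v n p) s₁ (s₁.setNat v x) := fun s₁ x => by
    refine ⟨fun w hw => ?_, fun _ _ => rfl⟩
    have : w ≠ v := fun h => by simp [writesVar_forLoop, h] at hw
    simp [State.setNat, this]
  have key : ∀ r k s', k + r = N → SameOff (forLoop v n p) s s' → s'.var v = k → Inv k s' →
      Ensures (.loop (.not (.natLe n (.var v))) (.seq p (.setNat v (.add (.var v) (.const 1))))) s'
        (r * (T + (n.cost + 8 : ℕ)) + (n.cost + 4 : ℕ)) (Inv N) := by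
    intro r
    induction r with
    | zero =>
      intro k s' hk hs hvk hI
      have hkN : k = N := by omega
      subst hkN
      refine ⟨_, s', Runs.loopDone _ ?_, ?_, hI⟩
      · simp [Test.Holds, NatExpr.eval, hN s' hs, hvk]
      · simp [Test.cost, NatExpr.cost, add_assoc]
    | succ r ih =>
      intro k s' hk hs hvk hI
      obtain ⟨t, s₁, h1, h2, h3⟩ := hstep k (by omega) s' hs hvk hI
      have e1 : s₁.var v = k := by rw [h1.sameOff.1 v hv, hvk]
      have hs₁ := (hs.trans (hp _ _ h1.sameOff)).trans (hset s₁ (k + 1))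
      obtain ⟨t', s₂, h4, h5, h6⟩ := ih (k + 1) (s₁.setNat v (k + 1)) (by omega) hs₁
        (by simp [State.setNat]) (hInv _ _ _ h3)
      have h7 : Runs (.setNat v (.add (.var v) (.const 1))) s₁
          ((NatExpr.add (.var v) (.const 1)).cost + 1) (s₁.setNat v (k + 1)) := by
        have := Runs.setNat s₁ v (.add (.var v) (.const 1))
        rwa [NatExpr.eval, NatExpr.eval, NatExpr.eval, e1] at this
      refine ⟨_, s₂, Runs.loopStep ?_ (h1.seq h7) h4, ?_, h6⟩
      · have : k < N := by omega
        simp [Test.Holds, NatExpr.eval, hN s' hs, hvk, this]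
      · simp only [Test.cost, NatExpr.cost]
        push_cast
        calc _ = ((t : ℕ∞) + (n.cost + 8)) + t' := by
              have : (8 : ℕ∞) = 1 + 1 + 1 + 1 + (1 + 1 + 1 + 1) := by norm_num
              rw [this]
              ring
          _ ≤ (T + (n.cost + 8)) + (r * (T + (n.cost + 8)) + (n.cost + 4)) := by
              refine add_le_add (add_le_add h2 le_rfl) ?_
              exact_mod_cast h5
          _ = _ := by ring
  obtain ⟨t, s', h1, h2, h3⟩ := key N 0 (s.setNat v 0) (by simp) (hset s 0)
    (by simp [State.setNat]) (hInv _ _ _ h0)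
  have h4 : Runs (.setNat v (.const 0)) s _ (s.setNat v 0) := Runs.setNat s v (.const 0)
  refine ⟨_, s', h4.seq h1, ?_, h3⟩
  simp only [NatExpr.cost]
  push_cast
  calc ((1 : ℕ∞) + 1 + t) ≤ 1 + 1 + (N * (T + (n.cost + 8)) + (n.cost + 4)) := by
        refine add_le_add le_rfl ?_
        exact_mod_cast h2
    _ = N * (T + (n.cost + 8)) + (n.cost + 6) := by
        have : (6 : ℕ∞) = 1 + 1 + 4 := by norm_num
        rw [this]
        ring
    _ ≤ _ := by gcongr; norm_num

end Logic

/-! ### Exhaustive search -/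

section Search

/-- Nested loops over the variables in the first components, bounded by the variables in the second
components, setting the flag `f` if the test `b` holds at some point. -/
def search (b : Test) (f : ℕ) : List (ℕ × ℕ) → Program
  | [] => .ite b (.setNat f (.const 1)) .nop
  | (v, w) :: l => forLoop v (.var w) (search b f l)

/-- The test `b` holds for some values of the loop variables. -/
def Found (b : Test) : List (ℕ × ℕ) → State → Prop
  | [], s => b.Holds s
  | (v, w) :: l, s => ∃ k < s.var w, Found b l (s.setNat v k)

/-- Agreement of the real arrays and of the variables outside `W`. -/
def AgreeOff (W : List ℕ) (s s' : State) : Prop :=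
  (∀ w ∉ W, s'.var w = s.var w) ∧ s'.realArr = s.realArr

/-- The test does not depend on the variable `f` and on integer arrays. -/
def Test.Ignores (b : Test) (f : ℕ) : Prop :=
  ∀ s s', AgreeOff [f] s s' → (b.Holds s ↔ b.Holds s')

theorem AgreeOff.setNat {W : List ℕ} {s s' : State} {v : ℕ} (h : AgreeOff W s s') (k : ℕ)
    {W' : List ℕ} (hW : ∀ w ∈ W, w = v ∨ w ∈ W') : AgreeOff W' (s.setNat v k) (s'.setNat v k) := by
  refine ⟨fun w hw => ?_, h.2⟩
  by_cases hwv : w = v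
  · simp [State.setNat, hwv]
  · simp only [State.setNat, Function.update_of_ne hwv]
    exact h.1 w fun hw' => (hW w hw').elim hwv hw

/-- The loops overwrite their variables before the test reads them, so leftovers of earlier
iterations and the flag do not matter, as long as no bound is among them. -/
theorem found_congr {b : Test} {f : ℕ} (hb : b.Ignores f) (l : List (ℕ × ℕ)) :
    ∀ s s', (∀ p ∈ l, p.2 ∉ f :: l.map Prod.fst) → AgreeOff (f :: l.map Prod.fst) s s' →
      (Found b l s ↔ Found b l s') := by
  induction l with
  | nil => exact fun s s' _ h => hb s s' (by simpa using h)
  | cons p l ih =>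
    obtain ⟨v, w⟩ := p
    intro s s' hl h
    have hw := h.1 w (hl (v, w) (by simp))
    simp only [Found, hw]
    refine exists_congr fun k => and_congr_right fun _ => ih _ _ (fun p hp => ?_) (h.setNat k ?_)
    · have := hl p (by simp [hp])
      simp only [List.map_cons, List.mem_cons, not_or] at this ⊢
      exact ⟨this.1, this.2.2⟩
    · intro w hw
      simp only [List.map_cons, List.mem_cons] at hw ⊢
      tauto

theorem writesVar_search {b : Test} {f w : ℕ} {l : List (ℕ × ℕ)} :
    (search b f l).writesVar w = false ↔ w ∉ f :: l.map Prod.fst := by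
  induction l with
  | nil => simp [search, Program.writesVar, eq_comm]
  | cons p l ih =>
    obtain ⟨v, w'⟩ := p
    rw [search, writesVar_forLoop, Bool.or_eq_false_iff, ih]
    simp only [List.map_cons, List.mem_cons, decide_eq_false_iff_not, eq_comm (a := v)]
    tauto

theorem writesReal_search {b : Test} {f w : ℕ} {l : List (ℕ × ℕ)} :
    (search b f l).writesReal w = false := by
  induction l with
  | nil => simp [search, Program.writesReal]
  | cons p l ih => rw [search, writesReal_forLoop, ih]

theorem SameOff.agreeOff_search {b : Test} {f : ℕ} {l : List (ℕ × ℕ)} {s s' : State}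
    (h : SameOff (search b f l) s s') : AgreeOff (f :: l.map Prod.fst) s s' :=
  ⟨fun w hw => h.1 w (writesVar_search.2 hw), funext fun a => h.2 a writesReal_search⟩

/-- The flag is never cleared, so it accumulates a disjunction. One level of nesting turns a bound
`X` into at most `M * (X + 9) + 9`, which is at most `19 * M * X`. -/
theorem ensures_search {b : Test} {f : ℕ} (hb : b.Ignores f) {M : ℕ} (hM : 1 ≤ M)
    (l : List (ℕ × ℕ)) :
    ∀ s, (∀ p ∈ l, p.2 ∉ f :: l.map Prod.fst) → (f :: l.map Prod.fst).Nodup →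
      (∀ p ∈ l, s.var p.2 ≤ M) →
      Ensures (search b f l) s (((b.cost + 4) * (19 * M) ^ l.length : ℕ) : ℕ∞)
        (fun s' => s'.var f ≠ 0 ↔ s.var f ≠ 0 ∨ Found b l s) := by
  induction l with
  | nil =>
    intro s _ _ _
    refine (ensures_ite (T := 2) (fun h => ?_) fun h => ?_).mono (Q := _) ?_ fun _ h => h
    · refine (ensures_setNat ?_).mono (Q := _) ?_ fun _ h => h
      · simp [State.setNat, NatExpr.eval, Found, h]
      · simp [NatExpr.cost]
    · refine (ensures_nop ?_).mono (Q := _) ?_ fun _ h => h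
      · simp [Found, h]
      · norm_num
    · simp only [List.length_nil, pow_zero, mul_one]
      push_cast
      rw [add_assoc]
      gcongr
      norm_num
  | cons p l ih =>
    obtain ⟨v, w⟩ := p
    intro s hl hnd hsM
    have hw : w ∉ f :: v :: l.map Prod.fst := hl (v, w) (by simp)
    have hl' : ∀ p ∈ l, p.2 ∉ f :: l.map Prod.fst := fun p hp => by
      have := hl p (by simp [hp])
      simp only [List.map_cons, List.mem_cons, not_or] at this ⊢
      exact ⟨this.1, this.2.2⟩
    simp only [List.map_cons, List.nodup_cons, List.mem_cons, not_or] at hnd hw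
    obtain ⟨⟨hfv, hfl⟩, hvl, hnd⟩ := hnd
    have hww : (search b f ((v, w) :: l)).writesVar w = false :=
      writesVar_search.2 (by simp only [List.map_cons, List.mem_cons, not_or]; exact hw)
    have hvf : f ≠ v := hfv
    refine (ensures_forLoop (T := (((b.cost + 4) * (19 * M) ^ l.length : ℕ) : ℕ∞)) (N := s.var w)
      (fun k s' => s'.var f ≠ 0 ↔ s.var f ≠ 0 ∨ ∃ k' < k, Found b l (s.setNat v k'))
      ?_ ?_ ?_ ?_ ?_).mono ?_ fun _ h => h
    · intro s' hs'
      exact hs'.1 w hww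
    · exact writesVar_search.2 (by simp [hvl, Ne.symm hvf])
    · intro k s' x h
      simpa [State.setNat, hvf] using h
    · simp
    · intro k hk s' hs' hvk hI
      have hag : AgreeOff (f :: l.map Prod.fst) (s.setNat v k) s' := by
        have h1 : AgreeOff (f :: v :: l.map Prod.fst) s s' := hs'.agreeOff_search
          (l := (v, w) :: l)
        refine ⟨fun u hu => ?_, h1.2⟩
        by_cases huv : u = v
        · simp [State.setNat, huv, hvk]
        · simp only [State.setNat, Function.update_of_ne huv]
          exact h1.1 u (by simp only [List.mem_cons, not_or] at hu ⊢; exact ⟨hu.1, huv, hu.2⟩)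
      refine (ih s' hl' (List.nodup_cons.2 ⟨hfl, hnd⟩) fun p hp => ?_).mono le_rfl fun s'' h => ?_
      · have h2 := hs'.1 p.2 (writesVar_search.2 (hl p (by simp [hp])))
        rw [h2]
        exact hsM p (by simp [hp])
      · rw [h, hI, ← found_congr hb l _ _ hl' hag]
        constructor
        · rintro ((h | ⟨k', hk', h⟩) | h)
          · exact Or.inl h
          · exact Or.inr ⟨k', by omega, h⟩
          · exact Or.inr ⟨k, by omega, h⟩
        · rintro (h | ⟨k', hk', h⟩)
          · exact Or.inl (Or.inl h)
          · rcases Nat.lt_succ_iff_lt_or_eq.1 hk' with h' | rfl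
            · exact Or.inl (Or.inr ⟨k', h', h⟩)
            · exact Or.inr h
    · have h1 : s.var w ≤ M := hsM (v, w) (by simp)
      simp only [NatExpr.cost]
      norm_cast
      set X := (b.cost + 4) * (19 * M) ^ l.length with hX
      have hX1 : 1 ≤ X := Nat.mul_pos (by omega) (Nat.pow_pos (by omega))
      have h2 : (b.cost + 4) * (19 * M) ^ (l.length + 1) = X * (19 * M) := by
        rw [hX, pow_succ]; ring
      rw [List.length_cons, h2]
      have h3 : s.var w * (X + (1 + 8)) ≤ M * (X + (1 + 8)) := Nat.mul_le_mul_right _ h1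
      nlinarith [Nat.mul_le_mul hM hX1]

end Search

/-! ### Time bounds -/

section PolynomialBounds

theorem Ensures.seq_poly {p q : Program} {s : State} {C C' M k : ℕ} {P Q : State → Prop}
    (h : Ensures p s ((C * M ^ k : ℕ) : ℕ∞) P)
    (h' : ∀ s', P s' → SameOff p s s' → Ensures q s' ((C' * M ^ k : ℕ) : ℕ∞) Q) :
    Ensures (.seq p q) s (((C + C') * M ^ k : ℕ) : ℕ∞) Q :=
  (h.seq h').mono (by rw [add_mul, Nat.cast_add]) fun _ h => h

theorem Ensures.poly_mono {p : Program} {s : State} {C M k k' : ℕ} {Q : State → Prop}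
    (hM : 1 ≤ M) (hk : k ≤ k') (h : Ensures p s ((C * M ^ k : ℕ) : ℕ∞) Q) :
    Ensures p s ((C * M ^ k' : ℕ) : ℕ∞) Q :=
  h.mono (by exact_mod_cast Nat.mul_le_mul_left C (Nat.pow_le_pow_right hM hk)) fun _ h => h

theorem Ensures.poly_of_const {p : Program} {s : State} {C M : ℕ} (k : ℕ) {Q : State → Prop}
    (hM : 1 ≤ M) (h : Ensures p s (C : ℕ∞) Q) : Ensures p s ((C * M ^ k : ℕ) : ℕ∞) Q :=
  Ensures.poly_mono hM (Nat.zero_le k) (h.mono (by simp) fun _ h => h)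

theorem forLoop_bound {C M k N c : ℕ} (hM : 1 ≤ M) (hN : N ≤ M) :
    (N : ℕ∞) * (((C * M ^ k : ℕ) : ℕ∞) + (c : ℕ)) + (c : ℕ) ≤
      (((C + 2 * c) * M ^ (k + 1) : ℕ) : ℕ∞) := by
  norm_cast
  have h1 : 1 ≤ M ^ k := Nat.one_le_pow _ _ hM
  have h2 : N * (C * M ^ k + c) ≤ M * (C * M ^ k + c) := Nat.mul_le_mul_right _ hN
  have h3 : c * M ≤ c * M ^ (k + 1) := by
    rw [pow_succ]
    exact Nat.mul_le_mul_left c (Nat.le_mul_of_pos_left M h1)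
  have h4 : c ≤ c * M := Nat.le_mul_of_pos_right c hM
  have h5 : (C + 2 * c) * M ^ (k + 1) = M * (C * M ^ k) + 2 * (c * M ^ (k + 1)) := by
    rw [pow_succ]; ring
  nlinarith

end PolynomialBounds

/-! ### Lists of candidate strategies in memory -/

theorem putReal_realArr (s : State) (arr i i' : ℕ) (r : ℝ) :
    (s.putReal arr i r).realArr arr i' = if i' = i then r else s.realArr arr i' := by
  simp [State.putReal, Function.update_apply]

theorem cell_ne {N t t' c c' : ℕ} (hc : c < N) (hc' : c' < N) (h : t ≠ t' ∨ c ≠ c') :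
    t * N + c ≠ t' * N + c' := by
  intro he
  have hN : 0 < N := by omega
  have h1 : (t * N + c) % N = c := by
    rw [mul_comm, Nat.mul_add_mod, Nat.mod_eq_of_lt hc]
  have h2 : (t' * N + c') % N = c' := by
    rw [mul_comm, Nat.mul_add_mod, Nat.mod_eq_of_lt hc']
  have h3 : c = c' := by rw [← h1, ← h2, he]
  subst h3
  have h4 : t * N = t' * N := by omega
  rcases h with h | h
  · exact h (Nat.eq_of_mul_eq_mul_right hN h4)
  · exact h rfl

theorem cell_lt {N t n c : ℕ} (hc : c < N) (ht : t < n) : t * N + c < n * N := by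
  calc t * N + c < t * N + N := by omega
    _ = (t + 1) * N := by ring
    _ ≤ n * N := Nat.mul_le_mul_right N ht

section Lists

variable {d e : ℕ}

/-- The entries stored for a strategy: its probabilities, then the payoffs of the opponent's
actions. -/
noncomputable def extFun (F : Fin e → Fin d → ℝ) (c : ℕ) : (Fin d → ℝ) →ₗ[ℝ] ℝ :=
  if h : c < d then LinearMap.proj ⟨c, h⟩
  else if h : c - d < e then rowLin F ⟨c - d, h⟩ else 0

theorem extFun_left (F : Fin e → Fin d → ℝ) (a : Fin d) (x : Fin d → ℝ) :
    extFun F a x = x a := by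
  simp [extFun]

theorem extFun_right (F : Fin e → Fin d → ℝ) (j : Fin e) (x : Fin d → ℝ) :
    extFun F (d + j) x = rowVal F x j := by
  simp [extFun, rowLin]

/-- The strategy `x` is stored as entry `t` of the list in the array `arr`. -/
def Stored (F : Fin e → Fin d → ℝ) (s : State) (arr t : ℕ) (x : Fin d → ℝ) : Prop :=
  ∀ c < d + e, s.realArr arr (t * (d + e) + c) = extFun F c x

/-- The first `n` entries of the list in the array `arr` form the set `L`. -/
def Listed (F : Fin e → Fin d → ℝ) (s : State) (arr n : ℕ) (L : Set (Fin d → ℝ)) : Prop :=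
  ∃ X : ℕ → Fin d → ℝ, (∀ t < n, Stored F s arr t (X t)) ∧ L = X '' Set.Iio n

theorem Stored.congr {F : Fin e → Fin d → ℝ} {s s' : State} {arr t n : ℕ} {x : Fin d → ℝ}
    (h : Stored F s arr t x) (ht : t < n)
    (hs : ∀ i < n * (d + e), s'.realArr arr i = s.realArr arr i) : Stored F s' arr t x :=
  fun c hc => (hs _ (cell_lt hc ht)).trans (h c hc)

theorem Listed.congr {F : Fin e → Fin d → ℝ} {s s' : State} {arr n : ℕ} {L : Set (Fin d → ℝ)}
    (h : Listed F s arr n L) (hs : s'.realArr arr = s.realArr arr) : Listed F s' arr n L := by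
  obtain ⟨X, h1, h2⟩ := h
  exact ⟨X, fun t ht c hc => by rw [hs]; exact h1 t ht c hc, h2⟩

theorem Listed.append {F : Fin e → Fin d → ℝ} {s s' : State} {arr n : ℕ} {L : Set (Fin d → ℝ)}
    (h : Listed F s arr n L) (hs : ∀ i < n * (d + e), s'.realArr arr i = s.realArr arr i)
    {x : Fin d → ℝ} (hx : Stored F s' arr n x) : Listed F s' arr (n + 1) (insert x L) := by
  obtain ⟨X, h1, rfl⟩ := h
  refine ⟨Function.update X n x, fun t ht => ?_, ?_⟩
  · rcases Nat.lt_succ_iff_lt_or_eq.1 ht with h | rfl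
    · rw [Function.update_of_ne h.ne]
      exact (h1 t h).congr h hs
    · rwa [Function.update_self]
  · ext z
    constructor
    · rintro (rfl | ⟨t, ht, rfl⟩)
      · exact ⟨n, Nat.lt_succ_self n, Function.update_self _ _ _⟩
      · have ht : t < n := ht
        exact ⟨t, Nat.lt_succ_of_lt ht, Function.update_of_ne ht.ne _ _⟩
    · rintro ⟨t, ht, rfl⟩
      rcases Nat.lt_succ_iff_lt_or_eq.1 (show t < n + 1 from ht) with h | rfl
      · rw [Function.update_of_ne h.ne]
        exact Or.inr ⟨t, h, rfl⟩
      · rw [Function.update_self]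
        exact Or.inl rfl

/-- The array, and the variable for the length, of the list of strategies of an agent
(`false` for agent `0`, `true` for agent `1`). -/
def listOf (side : Bool) : ℕ := cond side 5 4

/-- The variable with the number of actions of the agent. -/
def own (side : Bool) : ℕ := cond side 1 0

/-- The variable with the number of actions of the opponent. -/
def opp (side : Bool) : ℕ := cond side 0 1

/-- The index of entry `c` of the strategy number `t`. -/
def entryIdx (side : Bool) (t c : NatExpr) : NatExpr :=
  .add (.mul t (.add (.var (own side)) (.var (opp side)))) c

/-- The opponent's payoff at the action `var 7` of the agent and `var 8` of the opponent. -/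
def oppPayoff (side : Bool) : RealExpr :=
  cond side (.get 0 (.add (.mul (.var 8) (.var 1)) (.var 7)))
    (.get 1 (.add (.mul (.var 7) (.var 1)) (.var 8)))

/-- Initialization of the list with the pure strategies. -/
def initList (side : Bool) : Program :=
  .seq (forLoop 7 (.var (own side))
    (.seq (.putReal (listOf side) (entryIdx side (.var 7) (.var 7)) (.const 1))
      (forLoop 8 (.var (opp side))
        (.putReal (listOf side) (entryIdx side (.var 7) (.add (.var (own side)) (.var 8)))
          (oppPayoff side)))))
    (.setNat (listOf side) (.var (own side)))

/-- Only the diagonal probability and the opponent's payoffs are written. The other probabilities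
are zero because the array starts out zero, so the outer invariant also records that later rows are
untouched. -/
theorem ensures_initList (side : Bool) {F : Fin e → Fin d → ℝ} {s : State}
    {M : ℕ} (hM : 1 ≤ M) (hdM : d ≤ M) (heM : e ≤ M) (hd : s.var (own side) = d)
    (he : s.var (opp side) = e) (hzero : ∀ i, s.realArr (listOf side) i = 0)
    (hF : ∀ s' : State, s'.var 1 = s.var 1 → s'.realArr 0 = s.realArr 0 →
      s'.realArr 1 = s.realArr 1 → ∀ (a : Fin d) (j : Fin e), s'.var 7 = a → s'.var 8 = j →
        (oppPayoff side).eval s' = F j a) :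
    Ensures (initList side) s ((66 * M ^ 2 : ℕ) : ℕ∞) fun s' => s'.var (listOf side) = d ∧
      ∀ a : Fin d, Stored F s' (listOf side) a (Pi.single a 1) := by
  refine Ensures.seq_poly (C := 64) (C' := 2) (P := fun s' => ∀ a : Fin d, Stored F s' (listOf side) a (Pi.single a 1))
    ((ensures_forLoop (N := d) (fun k s' =>
      (∀ a : Fin d, (a : ℕ) < k → Stored F s' (listOf side) a (Pi.single a 1)) ∧
        ∀ i, k * (d + e) ≤ i → s'.realArr (listOf side) i = 0)
      ?_ ?_ ?_ ?_ ?_).mono (forLoop_bound (k := 1) (C := 46) hM hdM) fun s' h a => h.1 a a.2) ?_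
  · intro s' hs'
    rw [NatExpr.eval, hs'.1 (own side) (by cases side <;> rfl), hd]
  · cases side <;> rfl
  · exact fun _ _ _ h => h
  · exact ⟨fun a ha => absurd ha (Nat.not_lt_zero _), fun i _ => hzero i⟩
  · intro k hk s₁ hs₁ hv7 hI
    have hd₁ : s₁.var (own side) = d := by rw [hs₁.1 (own side) (by cases side <;> rfl), hd]
    have he₁ : s₁.var (opp side) = e := by rw [hs₁.1 (opp side) (by cases side <;> rfl), he]
    have h1₁ : s₁.var 1 = s.var 1 := hs₁.1 1 (by cases side <;> rfl)
    have hr0 : s₁.realArr 0 = s.realArr 0 := hs₁.2 0 (by cases side <;> rfl)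
    have hr1 : s₁.realArr 1 = s.realArr 1 := hs₁.2 1 (by cases side <;> rfl)
    -- entries of the row `k` after `j` steps of the inner loop
    refine Ensures.seq_poly (C := 9) (C' := 37) (k := 1) (P := fun s' => ∀ i, s'.realArr (listOf side) i =
        if i = k * (d + e) + k then 1 else s₁.realArr (listOf side) i)
      (Ensures.poly_of_const 1 hM (ensures_putReal fun i => ?_)) fun s₂ hs₂ hf₂ => ?_
    · rw [putReal_realArr]
      simp [entryIdx, NatExpr.eval, RealExpr.eval, hv7, hd₁, he₁]
    have hd₂ : s₂.var (own side) = d := by rw [hf₂.1 (own side) (by cases side <;> rfl), hd₁]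
    have he₂ : s₂.var (opp side) = e := by rw [hf₂.1 (opp side) (by cases side <;> rfl), he₁]
    have h7₂ : s₂.var 7 = k := by rw [hf₂.1 7 (by cases side <;> rfl), hv7]
    have h1₂ : s₂.var 1 = s.var 1 := by rw [hf₂.1 1 (by cases side <;> rfl), h1₁]
    have hr0₂ : s₂.realArr 0 = s.realArr 0 := by rw [hf₂.2 0 (by cases side <;> rfl), hr0]
    have hr1₂ : s₂.realArr 1 = s.realArr 1 := by rw [hf₂.2 1 (by cases side <;> rfl), hr1]
    refine (ensures_forLoop (N := e) (fun j s' =>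
      (∀ i, (∀ j' : Fin e, i ≠ k * (d + e) + (d + j')) →
        s'.realArr (listOf side) i = s₂.realArr (listOf side) i) ∧
      ∀ j' : Fin e, (j' : ℕ) < j →
        s'.realArr (listOf side) (k * (d + e) + (d + j')) = F j' ⟨k, hk⟩)
      ?_ ?_ ?_ ?_ ?_).mono (forLoop_bound (k := 0) (C := 19) hM heM) ?_
    · intro s' hs'
      rw [NatExpr.eval, hs'.1 (opp side) (by cases side <;> rfl), he₂]
    · cases side <;> rfl
    · exact fun _ _ _ h => h
    · exact ⟨fun _ _ => rfl, fun j' hj' => absurd hj' (Nat.not_lt_zero _)⟩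
    · intro j hj s₃ hs₃ hv8 hI₃
      refine (ensures_putReal ?_).mono (Q := _) ?_ fun _ h => h
      · have hpay : (oppPayoff side).eval s₃ = F ⟨j, hj⟩ ⟨k, hk⟩ := by
          refine hF s₃ ?_ ?_ ?_ ⟨k, hk⟩ ⟨j, hj⟩ ?_ hv8
          · rw [hs₃.1 1 (by cases side <;> rfl), h1₂]
          · rw [hs₃.2 0 (by cases side <;> rfl), hr0₂]
          · rw [hs₃.2 1 (by cases side <;> rfl), hr1₂]
          · rw [hs₃.1 7 (by cases side <;> rfl), h7₂]
        have hidx : (entryIdx side (.var 7) (.add (.var (own side)) (.var 8))).eval s₃ =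
            k * (d + e) + (d + j) := by
          simp only [entryIdx, NatExpr.eval, hv8, hs₃.1 7 (by cases side <;> rfl),
            hs₃.1 (own side) (by cases side <;> rfl), hs₃.1 (opp side) (by cases side <;> rfl),
            h7₂, hd₂, he₂]
        rw [hpay, hidx]
        refine ⟨fun i hi => ?_, fun j' hj' => ?_⟩
        · rw [putReal_realArr, if_neg (hi ⟨j, hj⟩)]
          exact hI₃.1 i hi
        · rw [putReal_realArr]
          by_cases hjj : (j' : ℕ) = j
          · rw [if_pos (by rw [hjj])]
            congr 1
            exact Fin.ext hjj.symm
          · rw [if_neg (by omega)]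
            exact hI₃.2 j' (by omega)
      · rw [pow_zero, mul_one]
        cases side <;> exact Nat.cast_le.2 (by decide)
    · rintro s₃ ⟨hI₃, hI₄⟩
      refine ⟨fun a ha c hc => ?_, fun i hi => ?_⟩
      · by_cases hak : (a : ℕ) = k
        · have haa : a = ⟨k, hk⟩ := Fin.ext hak
          subst haa
          by_cases hcd : c < d
          · rw [hI₃ _ fun j' => by simp only; omega, hs₂]
            have : extFun F c (Pi.single ⟨k, hk⟩ 1) = (Pi.single ⟨k, hk⟩ 1 : Fin d → ℝ) ⟨c, hcd⟩ :=
              extFun_left F ⟨c, hcd⟩ _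
            rw [this]
            by_cases hck : c = k
            · subst hck
              simp
            · rw [if_neg (by simp only; omega), hI.2 _ (by simp),
                Pi.single_eq_of_ne fun h => hck (Fin.mk.inj_iff.1 h)]
          · obtain ⟨j, rfl⟩ : ∃ j, c = d + j := ⟨c - d, by omega⟩
            have hje : j < e := by omega
            have h5 := hI₄ ⟨j, hje⟩ hje
            rw [h5]
            have : extFun F (d + j) (Pi.single ⟨k, hk⟩ 1) =
                rowVal F (Pi.single ⟨k, hk⟩ 1) ⟨j, hje⟩ := extFun_right F ⟨j, hje⟩ _
            rw [this]
            simp [rowVal, Pi.single_apply]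
        · have hlt : (a : ℕ) < k := by omega
          have h6 := cell_lt hc hlt
          rw [hI₃ _ fun j' => by omega, hs₂, if_neg (by omega)]
          exact hI.1 a hlt c hc
      · have h6 : k * (d + e) + (d + e) ≤ i := by
          calc k * (d + e) + (d + e) = (k + 1) * (d + e) := by ring
            _ ≤ i := hi
        rw [hI₃ _ fun j' => by have := j'.2; omega, hs₂, if_neg (by omega)]
        exact hI.2 i (by omega)
  · intro s' hs' hf
    refine Ensures.poly_of_const 2 hM (ensures_setNat ⟨?_, hs'⟩)
    simp [State.setNat, NatExpr.eval, hf.1 (own side) (by cases side <;> rfl), hd]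

end Lists

/-! ### Expansion of the candidate lists -/

section Expansion

/-- A loop rule for invariants indexed by a growing set: iteration `k` contributes `S k` to whatever
has been collected. -/
theorem ensures_forLoop_union {α : Type*} {v : ℕ} {n : NatExpr} {p : Program} {s : State} {T : ℕ∞} {N : ℕ}
    (P : Set α → State → Prop) (S : ℕ → Set α) {R : Set α}
    (hN : ∀ s', SameOff (forLoop v n p) s s' → n.eval s' = N)
    (hv : p.writesVar v = false) (hP : ∀ R s' x, P R s' → P R (s'.setNat v x)) (h0 : P R s)
    (hstep : ∀ k < N, ∀ s' R, SameOff (forLoop v n p) s s' → s'.var v = k → P R s' →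
      Ensures p s' T (P (R ∪ S k))) :
    Ensures (forLoop v n p) s (N * (T + (n.cost + 8 : ℕ)) + (n.cost + 8 : ℕ))
      (P (R ∪ ⋃ k < N, S k)) := by
  refine ensures_forLoop (fun k => P (R ∪ ⋃ k' < k, S k')) hN hv (fun _ _ _ => hP _ _ _)
    (by simpa using h0) fun k hk s' hs hvk h => ?_
  refine (hstep k hk s' _ hs hvk h).mono le_rfl fun s'' h' => ?_
  rwa [Set.biUnion_lt_succ, ← Set.union_assoc]

variable {d e : ℕ}

/-- Entry `c` of the strategy whose number is the value of the variable `v`. -/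
def cell (side : Bool) (v : ℕ) (c : NatExpr) : RealExpr :=
  .get (listOf side) (entryIdx side (.var v) c)

/-- The difference of the opponent's payoffs at the actions `var 13` and `var 14` against the
strategy whose number is the value of `v`. -/
def diffExpr (side : Bool) (v : ℕ) : RealExpr :=
  cell side v (.add (.var (own side)) (.var 13)) - cell side v (.add (.var (own side)) (.var 14))

theorem eval_cell {side : Bool} {F : Fin e → Fin d → ℝ} {s : State} {t : ℕ} {x : Fin d → ℝ}
    (h : Stored F s (listOf side) t x) (hd : s.var (own side) = d) (he : s.var (opp side) = e)
    {v : ℕ} (hv : s.var v = t) {c : NatExpr} {k : ℕ} (hc : c.eval s = k) (hk : k < d + e) :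
    (cell side v c).eval s = extFun F k x := by
  rw [← h k hk]
  simp [cell, RealExpr.eval, entryIdx, NatExpr.eval, hd, he, hv, hc]

theorem eval_diffExpr {side : Bool} {F : Fin e → Fin d → ℝ} {s : State} {t : ℕ} {x : Fin d → ℝ}
    (h : Stored F s (listOf side) t x) (hd : s.var (own side) = d) (he : s.var (opp side) = e)
    {v : ℕ} (hv : s.var v = t) {j l : Fin e} (hj : s.var 13 = j) (hl : s.var 14 = l) :
    (diffExpr side v).eval s = rowDiff F j l x := by
  rw [diffExpr, RealExpr.eval_sub,
    eval_cell h hd he hv (k := d + j) (by simp [NatExpr.eval, hd, hj]) (by omega),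
    eval_cell h hd he hv (k := d + l) (by simp [NatExpr.eval, hd, hl]) (by omega),
    extFun_right, extFun_right, rowDiff_apply]

/-- The list contains `R`, consists of mixed strategies, and starts with `X 0, …, X (n - 1)`. -/
def Grown (side : Bool) (F : Fin e → Fin d → ℝ) (X : ℕ → Fin d → ℝ) (n : ℕ)
    (R : Set (Fin d → ℝ)) (s : State) : Prop :=
  n ≤ s.var (listOf side) ∧ (∀ t < n, Stored F s (listOf side) t (X t)) ∧
    ∃ L, Listed F s (listOf side) (s.var (listOf side)) L ∧ R ⊆ L ∧ L ⊆ stdSimplex ℝ (Fin d)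

/-- Append the crossing point of the strategies number `var 7` and `var 8`. -/
def appendCrossing (side : Bool) : Program :=
  .seq (forLoop 18 (.add (.var (own side)) (.var (opp side)))
    (.putReal (listOf side) (entryIdx side (.var (listOf side)) (.var 18))
      (.div (diffExpr side 7 * cell side 8 (.var 18) - diffExpr side 8 * cell side 7 (.var 18))
        (diffExpr side 7 - diffExpr side 8))))
    (.setNat (listOf side) (.add (.var (listOf side)) (.const 1)))

/-- Every stored entry is a linear functional of the strategy, so one formula computes the
probabilities and the payoffs of the crossing point alike. Writing starts behind the list, hence the
two entries being combined stay intact. -/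
theorem ensures_appendCrossing {side : Bool} {F : Fin e → Fin d → ℝ} {X : ℕ → Fin d → ℝ} {n : ℕ}
    {R : Set (Fin d → ℝ)} {s : State} (h : Grown side F X n R s) (hd : s.var (own side) = d)
    (he : s.var (opp side) = e) {j l : Fin e} (hj : s.var 13 = j) (hl : s.var 14 = l) {t u : ℕ}
    (ht : t < n) (hu : u < n) (h7 : s.var 7 = t) (h8 : s.var 8 = u)
    (hX : crossing (rowDiff F j l) (X t) (X u) ∈ stdSimplex ℝ (Fin d)) :
    Ensures (appendCrossing side) s ⊤
      (Grown side F X n (R ∪ {crossing (rowDiff F j l) (X t) (X u)})) := by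
  obtain ⟨hn, hst, L, hL, hRL, hLs⟩ := h
  set m := s.var (listOf side) with hm
  set z := crossing (rowDiff F j l) (X t) (X u) with hz
  refine (Ensures.seq (T := ⊤) (T' := ⊤) (P := fun s' =>
    (∀ i < m * (d + e), s'.realArr (listOf side) i = s.realArr (listOf side) i) ∧
      Stored F s' (listOf side) m z)
    ((ensures_forLoop (T := ⊤) (N := d + e) (fun k s' =>
      (∀ i < m * (d + e), s'.realArr (listOf side) i = s.realArr (listOf side) i) ∧
        ∀ c < k, s'.realArr (listOf side) (m * (d + e) + c) = extFun F c z)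
      ?_ ?_ ?_ ?_ ?_).mono le_top fun _ h => h) ?_).mono le_top fun _ h => h
  · intro s' hs'
    simp only [NatExpr.eval]
    rw [hs'.1 (own side) (by cases side <;> rfl), hs'.1 (opp side) (by cases side <;> rfl), hd, he]
  · rfl
  · exact fun _ _ _ h => h
  · exact ⟨fun _ _ => rfl, fun c hc => absurd hc (Nat.not_lt_zero _)⟩
  · rintro k hk s' hs' h18 ⟨hI, hI'⟩
    have hd' : s'.var (own side) = d := by rw [hs'.1 (own side) (by cases side <;> rfl), hd]
    have he' : s'.var (opp side) = e := by rw [hs'.1 (opp side) (by cases side <;> rfl), he]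
    have hm' : s'.var (listOf side) = m := hs'.1 (listOf side) (by cases side <;> rfl)
    have h7' : s'.var 7 = t := by rw [hs'.1 7 (by cases side <;> rfl), h7]
    have h8' : s'.var 8 = u := by rw [hs'.1 8 (by cases side <;> rfl), h8]
    have hj' : s'.var 13 = j := by rw [hs'.1 13 (by cases side <;> rfl), hj]
    have hl' : s'.var 14 = l := by rw [hs'.1 14 (by cases side <;> rfl), hl]
    have hSt := (hst t ht).congr (ht.trans_le hn) hI
    have hSu := (hst u hu).congr (hu.trans_le hn) hI
    refine (ensures_putReal ?_).mono (Q := _) le_top fun _ h => h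
    have hidx : (entryIdx side (.var (listOf side)) (.var 18)).eval s' = m * (d + e) + k := by
      simp only [entryIdx, NatExpr.eval, hm', h18, hd', he']
    have hval : (RealExpr.div
        (diffExpr side 7 * cell side 8 (.var 18) - diffExpr side 8 * cell side 7 (.var 18))
        (diffExpr side 7 - diffExpr side 8)).eval s' = extFun F k z := by
      simp only [RealExpr.eval, RealExpr.eval_sub,
        eval_diffExpr hSt hd' he' h7' hj' hl', eval_diffExpr hSu hd' he' h8' hj' hl',
        eval_cell hSt hd' he' h7' (c := .var 18) h18 hk,
        eval_cell hSu hd' he' h8' (c := .var 18) h18 hk]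
      rw [hz, crossing, map_smul, map_sub, map_smul, map_smul, smul_eq_mul, smul_eq_mul,
        smul_eq_mul, div_eq_inv_mul]
    rw [hidx, hval]
    refine ⟨fun i hi => ?_, fun c hc => ?_⟩
    · rw [putReal_realArr, if_neg (by omega)]
      exact hI i hi
    · rw [putReal_realArr]
      by_cases hck : c = k
      · rw [if_pos (by rw [hck]), hck]
      · rw [if_neg (by omega)]
        exact hI' c (by omega)
  · rintro s' ⟨hI, hI'⟩ hs'
    have hm' : s'.var (listOf side) = m := hs'.1 (listOf side) (by cases side <;> rfl)
    refine (ensures_setNat ?_).mono (Q := _) le_top fun _ h => h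
    have hv : (s'.setNat (listOf side)
        ((NatExpr.add (.var (listOf side)) (.const 1)).eval s')).var (listOf side) = m + 1 := by
      simp [State.setNat, NatExpr.eval, hm']
    refine ⟨by rw [hv]; omega, fun t' ht' => (hst t' ht').congr (ht'.trans_le hn) hI,
      insert z L, ?_, ?_, ?_⟩
    · rw [hv]
      exact hL.append hI hI'
    · rw [Set.union_singleton]
      exact Set.insert_subset_insert hRL
    · exact Set.insert_subset hX hLs

/-- Append all crossing points for the functional determined by `var 13` and `var 14`. -/
def expandPair (side : Bool) : Program :=
  .seq (.setNat 17 (.var (listOf side)))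
    (forLoop 7 (.var 17) (forLoop 8 (.var 17)
      (.ite (.and (.realLt 0 (diffExpr side 7)) (.realLt (diffExpr side 8) 0))
        (appendCrossing side) .nop)))

/-- The list consists of mixed strategies and covers `H`. -/
def CoversList (side : Bool) (F : Fin e → Fin d → ℝ) (H : Set ((Fin d → ℝ) →ₗ[ℝ] ℝ))
    (s : State) : Prop :=
  ∃ L, Listed F s (listOf side) (s.var (listOf side)) L ∧ L ⊆ stdSimplex ℝ (Fin d) ∧ Covers H L

theorem setNat_var_of_ne {s : State} {v w : ℕ} (h : w ≠ v) (x : ℕ) :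
    (s.setNat v x).var w = s.var w := Function.update_of_ne h _ _

theorem listOf_ne {side : Bool} {v : ℕ} (h : 5 < v) : listOf side ≠ v := by
  cases side
  · exact (show 4 < v by omega).ne
  · exact h.ne

theorem Grown.setNat {side : Bool} {F : Fin e → Fin d → ℝ} {X : ℕ → Fin d → ℝ} {n : ℕ}
    {R : Set (Fin d → ℝ)} {s : State} (h : Grown side F X n R s) {v : ℕ} (hv : 5 < v) (x : ℕ) :
    Grown side F X n R (s.setNat v x) := by
  obtain ⟨h1, h2, L, h3, h4⟩ := h
  have := setNat_var_of_ne (s := s) (listOf_ne (side := side) hv) x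
  exact ⟨by rwa [this], h2, L, by rw [this]; exact h3, h4⟩

theorem CoversList.setNat {side : Bool} {F : Fin e → Fin d → ℝ}
    {H : Set ((Fin d → ℝ) →ₗ[ℝ] ℝ)} {s : State} (h : CoversList side F H s) {v : ℕ} (hv : 5 < v)
    (x : ℕ) : CoversList side F H (s.setNat v x) := by
  obtain ⟨L, h1, h2⟩ := h
  have := setNat_var_of_ne (s := s) (listOf_ne (side := side) hv) x
  exact ⟨L, by rw [this]; exact h1, h2⟩

/-- Variable `17` freezes the old length, so the loops range over old points only and terminate
although the list grows; the pairs of old points are all that `Covers.insert` needs. -/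
theorem ensures_expandPair {side : Bool} {F : Fin e → Fin d → ℝ} {s : State}
    {H : Set ((Fin d → ℝ) →ₗ[ℝ] ℝ)} (h : CoversList side F H s) (hd : s.var (own side) = d)
    (he : s.var (opp side) = e) {j l : Fin e} (hj : s.var 13 = j) (hl : s.var 14 = l) :
    Ensures (expandPair side) s ⊤ (CoversList side F (H ∪ {rowDiff F j l})) := by
  obtain ⟨L, ⟨X, hX, hLX⟩, hLs, hcov⟩ := h
  set n := s.var (listOf side) with hn
  have hXs : ∀ t < n, X t ∈ stdSimplex ℝ (Fin d) := fun t ht => hLs (hLX ▸ ⟨t, ht, rfl⟩)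
  set S : ℕ → ℕ → Set (Fin d → ℝ) := fun t u =>
    {z | 0 < rowDiff F j l (X t) ∧ rowDiff F j l (X u) < 0 ∧
      z = crossing (rowDiff F j l) (X t) (X u)} with hS
  refine (Ensures.seq (T := ⊤) (T' := ⊤) (P := fun s' => Grown side F X n L s' ∧ s'.var 17 = n)
    ((ensures_setNat ⟨Grown.setNat (v := 17) ⟨le_rfl, hX, L, ⟨X, hX, hLX⟩, subset_rfl, hLs⟩
      (by norm_num) _, by simp [State.setNat, NatExpr.eval, hn]⟩).mono le_top fun _ h => h) ?_).mono
    le_top fun _ h => h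
  rintro s₁ ⟨hG₁, h17₁⟩ hs₁
  have hd₁ : s₁.var (own side) = d := by rw [hs₁.1 (own side) (by cases side <;> rfl), hd]
  have he₁ : s₁.var (opp side) = e := by rw [hs₁.1 (opp side) (by cases side <;> rfl), he]
  have hj₁ : s₁.var 13 = j := by rw [hs₁.1 13 (by cases side <;> rfl), hj]
  have hl₁ : s₁.var 14 = l := by rw [hs₁.1 14 (by cases side <;> rfl), hl]
  refine (ensures_forLoop_union (N := n) (T := ⊤) (Grown side F X n) (fun t => ⋃ u < n, S t u) ?_ ?_
    (fun _ _ x h => h.setNat (by norm_num) x) hG₁ ?_).mono le_top ?_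
  · intro s' hs'
    rw [NatExpr.eval, hs'.1 17 (by cases side <;> rfl), h17₁]
  · cases side <;> rfl
  · intro t ht s₂ R hs₂ h7₂ hG₂
    refine (ensures_forLoop_union (N := n) (T := ⊤) (Grown side F X n) (S t) ?_ ?_
      (fun _ _ x h => h.setNat (by norm_num) x) hG₂ ?_).mono le_top fun _ h => h
    · intro s' hs'
      rw [NatExpr.eval, hs'.1 17 (by cases side <;> rfl), hs₂.1 17 (by cases side <;> rfl), h17₁]
    · cases side <;> rfl
    intro u hu s₃ R hs₃ h8₃ hG₃
    have hd₃ : s₃.var (own side) = d := by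
      rw [hs₃.1 (own side) (by cases side <;> rfl), hs₂.1 (own side) (by cases side <;> rfl), hd₁]
    have he₃ : s₃.var (opp side) = e := by
      rw [hs₃.1 (opp side) (by cases side <;> rfl), hs₂.1 (opp side) (by cases side <;> rfl), he₁]
    have hj₃ : s₃.var 13 = j := by
      rw [hs₃.1 13 (by cases side <;> rfl), hs₂.1 13 (by cases side <;> rfl), hj₁]
    have hl₃ : s₃.var 14 = l := by
      rw [hs₃.1 14 (by cases side <;> rfl), hs₂.1 14 (by cases side <;> rfl), hl₁]
    have h7₃ : s₃.var 7 = t := by rw [hs₃.1 7 (by cases side <;> rfl), h7₂]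
    have htest : (Test.and (.realLt 0 (diffExpr side 7)) (.realLt (diffExpr side 8) 0)).Holds s₃ ↔
        0 < rowDiff F j l (X t) ∧ rowDiff F j l (X u) < 0 := by
      simp only [Test.holds_and, Test.holds_realLt, RealExpr.eval_zero,
        eval_diffExpr (hG₃.2.1 t ht) hd₃ he₃ h7₃ hj₃ hl₃,
        eval_diffExpr (hG₃.2.1 u hu) hd₃ he₃ h8₃ hj₃ hl₃]
    refine (ensures_ite (T := ⊤) (fun hb => ?_) fun hb => ?_).mono le_top fun _ h => h
    · rw [htest] at hb
      have hSe : S t u = {crossing (rowDiff F j l) (X t) (X u)} := by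
        ext z
        simp [hS, hb]
      rw [hSe]
      exact ensures_appendCrossing hG₃ hd₃ he₃ hj₃ hl₃ ht hu h7₃ h8₃
        (crossing_mem (convex_stdSimplex ℝ _) (hXs t ht) (hXs u hu) hb.1.le hb.2)
    · rw [htest] at hb
      have hSe : S t u = ∅ := by
        ext z
        simp only [hS, Set.mem_ofPred_eq, Set.mem_empty_iff_false, iff_false]
        exact fun h => hb ⟨h.1, h.2.1⟩
      rw [hSe, Set.union_empty]
      exact (ensures_nop hG₃).mono le_top fun _ h => h
  · rintro s₂ ⟨_, _, L', hL', hsub, hLs'⟩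
    refine ⟨L', hL', hLs', ?_⟩
    rw [Set.union_singleton]
    refine hcov.insert (Set.subset_union_left.trans hsub) ?_
    rw [hLX]
    rintro _ ⟨t, ht, rfl⟩ _ ⟨u, hu, rfl⟩ h1 h2
    refine hsub (Or.inr ?_)
    simp only [Set.mem_iUnion]
    exact ⟨t, ht, u, hu, h1, h2, rfl⟩

/-- Append all crossing points, for all differences of payoffs of the opponent. -/
def expandList (side : Bool) : Program :=
  forLoop 13 (.var (opp side)) (forLoop 14 (.var (opp side)) (expandPair side))

/-- The length may grow quadratically with each functional, and no time bound is claimed: only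
termination matters in this branch. -/
theorem ensures_expandList {side : Bool} {F : Fin e → Fin d → ℝ} {s : State}
    {L : Set (Fin d → ℝ)} (hL : Listed F s (listOf side) (s.var (listOf side)) L)
    (hLs : L ⊆ stdSimplex ℝ (Fin d)) (hunit : ∀ a, Pi.single a 1 ∈ L)
    (hd : s.var (own side) = d) (he : s.var (opp side) = e) :
    Ensures (expandList side) s ⊤ fun s' =>
      ∃ L, Listed F s' (listOf side) (s'.var (listOf side)) L ∧ Candidates F L := by
  set S : ℕ → ℕ → Set ((Fin d → ℝ) →ₗ[ℝ] ℝ) := fun j l =>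
    {h | ∃ (hj : j < e) (hl : l < e), h = rowDiff F ⟨j, hj⟩ ⟨l, hl⟩} with hS
  refine (ensures_forLoop_union (N := e) (T := ⊤) (CoversList side F) (fun j => ⋃ l < e, S j l) ?_
    ?_ (fun _ _ x h => h.setNat (by norm_num) x) ⟨L, hL, hLs, covers_units hunit⟩ ?_).mono le_top ?_
  · intro s' hs'
    rw [NatExpr.eval, hs'.1 (opp side) (by cases side <;> rfl), he]
  · cases side <;> rfl
  · intro j hj s₁ H hs₁ hj₁ hC
    refine (ensures_forLoop_union (N := e) (T := ⊤) (CoversList side F) (S j) ?_ ?_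
      (fun _ _ x h => h.setNat (by norm_num) x) hC ?_).mono le_top fun _ h => h
    · intro s' hs'
      rw [NatExpr.eval, hs'.1 (opp side) (by cases side <;> rfl),
        hs₁.1 (opp side) (by cases side <;> rfl), he]
    · cases side <;> rfl
    · intro l hl s₂ H hs₂ hl₂ hC
      have hSe : S j l = {rowDiff F ⟨j, hj⟩ ⟨l, hl⟩} := by
        ext h
        simp [hS, hj, hl]
      rw [hSe]
      refine ensures_expandPair hC ?_ ?_ ?_ hl₂
      · rw [hs₂.1 (own side) (by cases side <;> rfl), hs₁.1 (own side) (by cases side <;> rfl), hd]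
      · rw [hs₂.1 (opp side) (by cases side <;> rfl), hs₁.1 (opp side) (by cases side <;> rfl), he]
      · rw [hs₂.1 13 (by cases side <;> rfl), hj₁]
  · rintro s' ⟨L', h1, h2, h3⟩
    refine ⟨L', h1, h2, fun z hz => convexHull_mono ?_ (h3 z hz)⟩
    rintro P ⟨hP, hP'⟩
    refine ⟨hP, fun h hh => hP' h ?_⟩
    refine hh.imp id ?_
    rintro ⟨⟨j, l⟩, rfl⟩
    simp only [Set.mem_iUnion]
    exact ⟨j, j.2, l, l.2, j.2, l.2, rfl⟩

end Expansion

/-! ### Testing pairs of candidates -/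

section Tests

variable {p q : ℕ} {A B : Fin p → Fin q → ℝ}

/-- The bimatrix game `(A, B)` is stored in memory. -/
structure HasGame (A B : Fin p → Fin q → ℝ) (s : State) : Prop where
  rows : s.var 0 = p
  cols : s.var 1 = q
  left : ∀ (i : Fin p) (j : Fin q), s.realArr 0 (i * q + j) = A i j
  right : ∀ (i : Fin p) (j : Fin q), s.realArr 1 (i * q + j) = B i j

theorem HasGame.congr {s s' : State} (h : HasGame A B s) (h0 : s'.var 0 = s.var 0)
    (h1 : s'.var 1 = s.var 1) (hr0 : s'.realArr 0 = s.realArr 0)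
    (hr1 : s'.realArr 1 = s.realArr 1) : HasGame A B s' :=
  ⟨h0.trans h.rows, h1.trans h.cols, fun i j => by rw [hr0, h.left],
    fun i j => by rw [hr1, h.right]⟩

/-- The matrix entry at row `var v` and column `var w`. -/
def entry (arr v w : ℕ) : RealExpr :=
  .get arr (.add (.mul (.var v) (.var 1)) (.var w))

theorem HasGame.eval_left {s : State} (h : HasGame A B s) {v w : ℕ} {i : Fin p} {j : Fin q}
    (hi : s.var v = i) (hj : s.var w = j) : (entry 0 v w).eval s = A i j := by
  simp [entry, RealExpr.eval, NatExpr.eval, hi, hj, h.cols, h.left]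

theorem HasGame.eval_right {s : State} (h : HasGame A B s) {v w : ℕ} {i : Fin p} {j : Fin q}
    (hi : s.var v = i) (hj : s.var w = j) : (entry 1 v w).eval s = B i j := by
  simp [entry, RealExpr.eval, NatExpr.eval, hi, hj, h.cols, h.right]

/-- The test for `Coincidence`, at rows `var 11`, `var 12` and columns `var 13`, `var 14`. -/
def coincidenceTest : Test :=
  .or (.and (.varNe 11 12) (.realEq (entry 0 11 13) (entry 0 12 13)))
    (.or (.and (.varNe 13 14) (.realEq (entry 1 11 13) (entry 1 11 14)))
      (.and (.varNe 11 12) (.and (.varNe 13 14)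
        (.realEq ((entry 0 12 13 - entry 0 11 13) * (entry 1 11 14 - entry 1 11 13))
          ((entry 1 12 13 - entry 1 11 13) * (entry 0 11 14 - entry 0 11 13))))))

theorem holds_coincidenceTest {s : State} (h : HasGame A B s) {i k : Fin p} {j l : Fin q}
    (hi : s.var 11 = i) (hk : s.var 12 = k) (hj : s.var 13 = j) (hl : s.var 14 = l) :
    coincidenceTest.Holds s ↔ Coincidence A B i k j l := by
  simp only [coincidenceTest, Test.holds_or, Test.holds_and, Test.holds_varNe, Test.holds_realEq,
    RealExpr.eval_mul, RealExpr.eval_sub, h.eval_left hi hj, h.eval_left hk hj, h.eval_left hi hl,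
    h.eval_right hi hj, h.eval_right hk hj, h.eval_right hi hl, hi, hk, hj, hl, Coincidence,
    ne_eq, Fin.ext_iff]

theorem AgreeOff.eval_entry {f : ℕ} {s s' : State} (h : AgreeOff [f] s s') {arr v w : ℕ}
    (h1 : f ≠ 1) (hv : f ≠ v) (hw : f ≠ w) : (entry arr v w).eval s' = (entry arr v w).eval s := by
  simp only [entry, RealExpr.eval, NatExpr.eval, h.2, h.1 1 (by simpa using h1.symm),
    h.1 v (by simpa using hv.symm), h.1 w (by simpa using hw.symm)]

theorem ignores_coincidenceTest : coincidenceTest.Ignores 3 := by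
  intro s s' h
  have hv : ∀ w, 3 ≠ w → s'.var w = s.var w := fun w hw => h.1 w (by simpa using hw.symm)
  simp only [coincidenceTest, Test.holds_or, Test.holds_and, Test.holds_varNe, Test.holds_realEq,
    RealExpr.eval_mul, RealExpr.eval_sub]
  simp only [h.eval_entry (arr := 0) (v := 11) (w := 13) (by norm_num) (by norm_num) (by norm_num),
    h.eval_entry (arr := 0) (v := 12) (w := 13) (by norm_num) (by norm_num) (by norm_num),
    h.eval_entry (arr := 0) (v := 11) (w := 14) (by norm_num) (by norm_num) (by norm_num),
    h.eval_entry (arr := 1) (v := 11) (w := 13) (by norm_num) (by norm_num) (by norm_num),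
    h.eval_entry (arr := 1) (v := 12) (w := 13) (by norm_num) (by norm_num) (by norm_num),
    h.eval_entry (arr := 1) (v := 11) (w := 14) (by norm_num) (by norm_num) (by norm_num),
    hv 11 (by norm_num), hv 12 (by norm_num), hv 13 (by norm_num), hv 14 (by norm_num)]

/-- Two entries of the row `var i` of a matrix, reduced by `v`. -/
def rowPairExpr (arr i : ℕ) (v : RealExpr) : RealExpr × RealExpr :=
  (entry arr i 13 - v, entry arr i 14 - v)

/-- The payoff of the row `var v` against the strategy number `var 8` of the column agent. -/
def rowValue (v : ℕ) : RealExpr := cell true 8 (.add (.var 1) (.var v))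

/-- The payoff of the column `var v` against the strategy number `var 7` of the row agent. -/
def colValue (v : ℕ) : RealExpr := cell false 7 (.add (.var 0) (.var v))

/-- The test for `Refutes`. -/
def refuteTest : Test :=
  .and (.realLt 0 (cell false 7 (.var 9))) (.and (.realLt 0 (cell true 8 (.var 10)))
    (.or (.realLt (rowValue 9) (rowValue 11)) (.or (.realLt (colValue 10) (colValue 13))
      (quadTest (rowPairExpr 0 11 (rowValue 9)) (rowPairExpr 1 11 (colValue 10))
        (rowPairExpr 0 12 (rowValue 9)) (rowPairExpr 1 12 (colValue 10))))))

theorem holds_refuteTest {s : State} (h : HasGame A B s) {t u : ℕ} {x : Fin p → ℝ}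
    {y : Fin q → ℝ} (hx : Stored (swp B) s 4 t x) (hy : Stored A s 5 u y) (ht : s.var 7 = t)
    (hu : s.var 8 = u) {i₀ i k : Fin p} {j₀ j l : Fin q} (hi₀ : s.var 9 = i₀) (hj₀ : s.var 10 = j₀)
    (hi : s.var 11 = i) (hk : s.var 12 = k) (hj : s.var 13 = j) (hl : s.var 14 = l) :
    refuteTest.Holds s ↔ Refutes A B x y i₀ j₀ i k j l := by
  have hrow : ∀ (v : ℕ) (a : Fin p), s.var v = a → (rowValue v).eval s = rowVal A y a :=
    fun v a hv => by
      rw [rowValue, eval_cell (side := true) hy h.cols h.rows hu (k := q + a)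
        (by simp [NatExpr.eval, h.cols, hv]) (by omega), extFun_right]
  have hcol : ∀ (v : ℕ) (a : Fin q), s.var v = a → (colValue v).eval s = rowVal (swp B) x a :=
    fun v a hv => by
      rw [colValue, eval_cell (side := false) hx h.rows h.cols ht (k := p + a)
        (by simp [NatExpr.eval, h.rows, hv]) (by omega), extFun_right]
  simp only [refuteTest, Test.holds_or, Test.holds_and, Test.holds_realLt, holds_quadTest,
    RealExpr.eval_zero, evalPair, rowPairExpr, RealExpr.eval_sub, h.eval_left hi hj,
    h.eval_left hk hj, h.eval_left hi hl, h.eval_left hk hl, h.eval_right hi hj,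
    h.eval_right hk hj, h.eval_right hi hl, h.eval_right hk hl, hrow _ _ hi₀, hrow _ _ hi,
    hcol _ _ hj₀, hcol _ _ hj,
    eval_cell (side := false) hx h.rows h.cols ht (c := .var 9) (k := i₀) hi₀ (by omega),
    eval_cell (side := true) hy h.cols h.rows hu (c := .var 10) (k := j₀) hj₀ (by omega),
    extFun_left, Refutes, rowPair]

theorem ignores_refuteTest : refuteTest.Ignores 6 := by
  intro s s' h
  have hv : ∀ w, 6 ≠ w → s'.var w = s.var w := fun w hw => h.1 w (by simpa using hw.symm)
  simp only [refuteTest, Test.holds_or, Test.holds_and, Test.holds_realLt, holds_quadTest,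
    evalPair, rowPairExpr, RealExpr.eval_sub, rowValue, colValue, cell, entry,
    entryIdx, listOf, own, opp, cond_true, cond_false, RealExpr.eval, NatExpr.eval]
  simp only [h.2, hv 0 (by norm_num), hv 1 (by norm_num), hv 7 (by norm_num), hv 8 (by norm_num),
    hv 9 (by norm_num), hv 10 (by norm_num), hv 11 (by norm_num), hv 12 (by norm_num),
    hv 13 (by norm_num), hv 14 (by norm_num)]

end Tests

/-! ### Search for an equilibrium among the candidates -/

section Search

variable {p q : ℕ} {A B : Fin p → Fin q → ℝ}

/-- Look for a coincidence, and record it in variable `3`. -/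
def coincidenceSearch : Program :=
  search coincidenceTest 3 [(11, 0), (12, 0), (13, 1), (14, 1)]

theorem HasGame.setNat {s : State} (h : HasGame A B s) {v : ℕ} (hv : 1 < v) (k : ℕ) :
    HasGame A B (s.setNat v k) :=
  h.congr (setNat_var_of_ne (by omega) k) (setNat_var_of_ne (by omega) k) rfl rfl

theorem found_coincidenceTest {s : State} (h : HasGame A B s) :
    Found coincidenceTest [(11, 0), (12, 0), (13, 1), (14, 1)] s ↔
      ∃ i k j l, Coincidence A B i k j l := by
  have key : ∀ (i k : Fin p) (j l : Fin q), coincidenceTest.Holds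
      ((((s.setNat 11 i).setNat 12 k).setNat 13 j).setNat 14 l) ↔ Coincidence A B i k j l :=
    fun i k j l => holds_coincidenceTest ((((h.setNat (by norm_num) _).setNat (by norm_num) _).setNat
      (by norm_num) _).setNat (by norm_num) _) (by simp [State.setNat]) (by simp [State.setNat])
      (by simp [State.setNat]) (by simp [State.setNat])
  have h0 : s.var 0 = p := h.rows
  have h1 : s.var 1 = q := h.cols
  simp only [Found, setNat_var_of_ne (show (0 : ℕ) ≠ 11 by norm_num),
    setNat_var_of_ne (show (1 : ℕ) ≠ 11 by norm_num), setNat_var_of_ne (show (1 : ℕ) ≠ 12 by norm_num),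
    setNat_var_of_ne (show (1 : ℕ) ≠ 13 by norm_num), h0, h1]
  constructor
  · rintro ⟨i, hi, k, hk, j, hj, l, hl, h⟩
    exact ⟨⟨i, hi⟩, ⟨k, hk⟩, ⟨j, hj⟩, ⟨l, hl⟩, (key _ _ _ _).1 h⟩
  · rintro ⟨i, k, j, l, h⟩
    exact ⟨i, i.2, k, k.2, j, j.2, l, l.2, (key _ _ _ _).2 h⟩

theorem ensures_coincidenceSearch {s : State} (h : HasGame A B s) (h3 : s.var 3 = 0) {M : ℕ}
    (hM : 1 ≤ M) (hp : p ≤ M) (hq : q ≤ M) :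
    Ensures coincidenceSearch s
      (((coincidenceTest.cost + 4) * 19 ^ 4 * M ^ 4 : ℕ) : ℕ∞)
      fun s' => s'.var 3 ≠ 0 ↔ ∃ i k j l, Coincidence A B i k j l := by
  have hb : ∀ r ∈ [(11, 0), (12, 0), (13, 1), (14, 1)], s.var r.2 ≤ M := by
    simp [h.rows, h.cols, hp, hq]
  refine (ensures_search ignores_coincidenceTest hM _ s (by decide) (by decide) hb).mono ?_
    fun s' hs' => ?_
  · rw [mul_assoc, ← mul_pow]
    exact le_rfl
  · rw [hs', found_coincidenceTest h]
    simp [h3]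

/-- The loop variables, with their bounds, for the search for a refutation. -/
def refuteLoops : List (ℕ × ℕ) := [(9, 0), (10, 1), (11, 0), (12, 0), (13, 1), (14, 1)]

theorem found_refuteTest {s : State} (h : HasGame A B s) {t u : ℕ} {x : Fin p → ℝ}
    {y : Fin q → ℝ} (hx : Stored (swp B) s 4 t x) (hy : Stored A s 5 u y) (ht : s.var 7 = t)
    (hu : s.var 8 = u) :
    Found refuteTest refuteLoops s ↔ ∃ i₀ j₀ i k j l, Refutes A B x y i₀ j₀ i k j l := by
  have key : ∀ (i₀ : Fin p) (j₀ : Fin q) (i k : Fin p) (j l : Fin q), refuteTest.Holds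
      ((((((s.setNat 9 i₀).setNat 10 j₀).setNat 11 i).setNat 12 k).setNat 13 j).setNat 14 l) ↔
        Refutes A B x y i₀ j₀ i k j l :=
    fun i₀ j₀ i k j l => holds_refuteTest ((((((h.setNat (by norm_num) _).setNat
      (by norm_num) _).setNat (by norm_num) _).setNat (by norm_num) _).setNat (by norm_num) _).setNat
      (by norm_num) _) hx hy (by simp [State.setNat, ht]) (by simp [State.setNat, hu])
      (by simp [State.setNat]) (by simp [State.setNat]) (by simp [State.setNat])
      (by simp [State.setNat]) (by simp [State.setNat]) (by simp [State.setNat])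
  have h0 : s.var 0 = p := h.rows
  have h1 : s.var 1 = q := h.cols
  simp only [refuteLoops, Found, setNat_var_of_ne (show (0 : ℕ) ≠ 9 by norm_num),
    setNat_var_of_ne (show (1 : ℕ) ≠ 9 by norm_num), setNat_var_of_ne (show (0 : ℕ) ≠ 10 by norm_num),
    setNat_var_of_ne (show (1 : ℕ) ≠ 10 by norm_num), setNat_var_of_ne (show (0 : ℕ) ≠ 11 by norm_num),
    setNat_var_of_ne (show (1 : ℕ) ≠ 11 by norm_num), setNat_var_of_ne (show (1 : ℕ) ≠ 12 by norm_num),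
    setNat_var_of_ne (show (1 : ℕ) ≠ 13 by norm_num), h0, h1]
  constructor
  · rintro ⟨i₀, hi₀, j₀, hj₀, i, hi, k, hk, j, hj, l, hl, h⟩
    exact ⟨⟨i₀, hi₀⟩, ⟨j₀, hj₀⟩, ⟨i, hi⟩, ⟨k, hk⟩, ⟨j, hj⟩, ⟨l, hl⟩, (key _ _ _ _ _ _).1 h⟩
  · rintro ⟨i₀, j₀, i, k, j, l, h⟩
    exact ⟨i₀, i₀.2, j₀, j₀.2, i, i.2, k, k.2, j, j.2, l, l.2, (key _ _ _ _ _ _).2 h⟩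

/-- Test the pair of candidates with numbers `var 7` and `var 8`, and record it if it is an
equilibrium. -/
def testPair : Program :=
  .seq (.setNat 6 (.const 0)) (.seq (search refuteTest 6 refuteLoops)
    (.ite (.natLe (.var 6) (.const 0))
      (.seq (.setNat 15 (.var 7)) (.seq (.setNat 16 (.var 8)) (.setNat 2 (.const 1)))) .nop))

/-- Test all pairs of candidates. -/
def testPairs : Program := forLoop 7 (.var 4) (forLoop 8 (.var 5) testPair)

/-- Variable `2` records whether one of the pairs of candidates in `R` is an equilibrium, and
variables `15` and `16` hold the numbers of such a pair. -/
def Tested (A B : Fin p → Fin q → ℝ) (X : ℕ → Fin p → ℝ) (Y : ℕ → Fin q → ℝ) (n n' : ℕ)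
    (R : Set (ℕ × ℕ)) (s : State) : Prop :=
  (s.var 2 ≠ 0 → s.var 15 < n ∧ s.var 16 < n' ∧ BiSNE A B (X (s.var 15)) (Y (s.var 16))) ∧
    (s.var 2 = 0 → ∀ r ∈ R, ¬ BiSNE A B (X r.1) (Y r.2))

theorem Tested.congr {X : ℕ → Fin p → ℝ} {Y : ℕ → Fin q → ℝ} {n n' : ℕ} {R : Set (ℕ × ℕ)}
    {s s' : State} (h : Tested A B X Y n n' R s) (h2 : s'.var 2 = s.var 2)
    (h15 : s'.var 15 = s.var 15) (h16 : s'.var 16 = s.var 16) : Tested A B X Y n n' R s' := by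
  rwa [Tested, h2, h15, h16]

/-- Six nested loops look for a refutation, which gives the exponent; an equilibrium is a pair for
which none is found. -/
theorem ensures_testPair {X : ℕ → Fin p → ℝ} {Y : ℕ → Fin q → ℝ} {n n' : ℕ} {R : Set (ℕ × ℕ)}
    {s : State} (hT : Tested A B X Y n n' R s) (h : HasGame A B s) {t u : ℕ} (htn : t < n)
    (hun : u < n') (hXt : X t ∈ stdSimplex ℝ (Fin p)) (hYu : Y u ∈ stdSimplex ℝ (Fin q))
    (hx : Stored (swp B) s 4 t (X t)) (hy : Stored A s 5 u (Y u)) (ht : s.var 7 = t)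
    (hu : s.var 8 = u) {M : ℕ} (hM : 1 ≤ M) (hp : p ≤ M) (hq : q ≤ M) :
    Ensures testPair s (((2 + ((refuteTest.cost + 4) * 19 ^ 6 + 10)) * M ^ 6 : ℕ) : ℕ∞)
      (Tested A B X Y n n' (R ∪ {(t, u)})) := by
  refine Ensures.seq_poly (P := fun s' => s'.var 6 = 0 ∧ s'.realArr = s.realArr)
    (Ensures.poly_of_const 6 hM (ensures_setNat ⟨by simp [State.setNat, NatExpr.eval], rfl⟩))
    fun s₁ hs₁ hf₁ => ?_
  obtain ⟨h6₁, hr₁⟩ := hs₁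
  have hg₁ : HasGame A B s₁ := h.congr (hf₁.1 0 rfl) (hf₁.1 1 rfl) (by rw [hr₁]) (by rw [hr₁])
  have ht₁ : s₁.var 7 = t := (hf₁.1 7 rfl).trans ht
  have hu₁ : s₁.var 8 = u := (hf₁.1 8 rfl).trans hu
  have hT₁ : Tested A B X Y n n' R s₁ := hT.congr (hf₁.1 2 rfl) (hf₁.1 15 rfl) (hf₁.1 16 rfl)
  have hx₁ : Stored (swp B) s₁ 4 t (X t) := fun c hc => by rw [hr₁]; exact hx c hc
  have hy₁ : Stored A s₁ 5 u (Y u) := fun c hc => by rw [hr₁]; exact hy c hc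
  have hb : ∀ r ∈ refuteLoops, s₁.var r.2 ≤ M := by
    simp [refuteLoops, hg₁.rows, hg₁.cols, hp, hq]
  refine Ensures.seq_poly (P := fun s' => s'.var 6 ≠ 0 ↔ ¬ BiSNE A B (X t) (Y u))
    ((ensures_search ignores_refuteTest hM _ s₁ (by decide) (by decide) hb).mono ?_
      fun s' hs' => ?_) fun s₂ hs₂ hf₂ => ?_
  · rw [mul_assoc, ← mul_pow]
    exact le_rfl
  · rw [hs', found_refuteTest hg₁ hx₁ hy₁ ht₁ hu₁, biSNE_iff_not_refutes hXt hYu, not_not]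
    simp [h6₁]
  have hw : ∀ w, w ∉ 6 :: refuteLoops.map Prod.fst → s₂.var w = s₁.var w := fun w hw =>
    hf₂.1 w (writesVar_search.2 hw)
  have h7₂ : s₂.var 7 = t := (hw 7 (by decide)).trans ht₁
  have h8₂ : s₂.var 8 = u := (hw 8 (by decide)).trans hu₁
  have hT₂ : Tested A B X Y n n' R s₂ :=
    hT₁.congr (hw 2 (by decide)) (hw 15 (by decide)) (hw 16 (by decide))
  refine Ensures.poly_of_const 6 hM ((ensures_ite (T := 6) (fun hb => ?_) fun hb => ?_).mono
    (by simp only [Test.cost, NatExpr.cost]; norm_num) fun _ h => h)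
  · have h6 : s₂.var 6 = 0 := Nat.le_zero.1 hb
    have hS : BiSNE A B (X t) (Y u) := by
      by_contra hS
      exact hs₂.2 hS h6
    refine (Ensures.seq (P := fun s' => s' = s₂.setNat 15 t) (ensures_setNat (by
      simp [NatExpr.eval, h7₂])) fun s' hs' _ => Ensures.seq
        (P := fun s' => s' = (s₂.setNat 15 t).setNat 16 u)
        (ensures_setNat (by simp [hs', NatExpr.eval, h8₂, State.setNat]))
        fun s' hs' _ => ensures_setNat ?_).mono (by simp only [NatExpr.cost]; norm_num) fun _ h => h
    subst hs'
    refine ⟨fun _ => ?_, fun h2 => ?_⟩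
    · simpa [State.setNat] using ⟨htn, hun, hS⟩
    · simp [State.setNat, NatExpr.eval] at h2
  · have h6 : s₂.var 6 ≠ 0 := fun h6 => hb (Nat.le_zero.2 h6)
    refine (ensures_nop ⟨hT₂.1, fun h2 r hr => ?_⟩).mono (by norm_num) fun _ h => h
    rcases hr with hr | rfl
    · exact hT₂.2 h2 r hr
    · exact hs₂.1 h6

theorem ensures_testPairs {X : ℕ → Fin p → ℝ} {Y : ℕ → Fin q → ℝ} {s : State}
    (h : HasGame A B s) (h2 : s.var 2 = 0)
    (hXs : ∀ t < s.var 4, X t ∈ stdSimplex ℝ (Fin p))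
    (hYs : ∀ u < s.var 5, Y u ∈ stdSimplex ℝ (Fin q))
    (hX : ∀ t < s.var 4, Stored (swp B) s 4 t (X t)) (hY : ∀ u < s.var 5, Stored A s 5 u (Y u))
    {M : ℕ} (hM : 1 ≤ M) (hp : p ≤ M) (hq : q ≤ M) (h4 : s.var 4 ≤ M) (h5 : s.var 5 ≤ M) :
    Ensures testPairs s (((2 + ((refuteTest.cost + 4) * 19 ^ 6 + 10) + 18 + 18) * M ^ 8 : ℕ) : ℕ∞)
      (Tested A B X Y (s.var 4) (s.var 5) {r | r.1 < s.var 4 ∧ r.2 < s.var 5}) := by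
  set n := s.var 4 with hn
  set n' := s.var 5 with hn'
  have hset : ∀ R s' x v, v = 7 ∨ v = 8 → Tested A B X Y n n' R s' →
      Tested A B X Y n n' R (s'.setNat v x) := by
    rintro R s' x v hv h
    refine h.congr (setNat_var_of_ne ?_ _) (setNat_var_of_ne ?_ _) (setNat_var_of_ne ?_ _) <;> omega
  refine (ensures_forLoop_union (N := n) (R := ∅) (Tested A B X Y n n') (fun t => ⋃ u < n', {(t, u)})
    ?_ ?_ (fun R s' x => hset R s' x 7 (by simp)) ?_ ?_).mono
    (forLoop_bound (k := 7) (C := 2 + ((refuteTest.cost + 4) * 19 ^ 6 + 10) + 18) hM h4) ?_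
  · exact fun s' hs' => hs'.1 4 rfl
  · rfl
  · exact ⟨fun h => absurd h2 h, fun _ r hr => absurd hr (Set.notMem_empty r)⟩
  · intro t ht s₁ R hs₁ h7₁ hT₁
    refine (ensures_forLoop_union (N := n') (Tested A B X Y n n') (fun u => {(t, u)})
      ?_ ?_ (fun R s' x => hset R s' x 8 (by simp)) hT₁ ?_).mono
      (forLoop_bound (k := 6) (C := 2 + ((refuteTest.cost + 4) * 19 ^ 6 + 10)) hM h5) fun _ h => h
    · exact fun s' hs' => (hs'.1 5 rfl).trans (hs₁.1 5 rfl)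
    · rfl
    · intro u hu s₂ R hs₂ h8₂ hT₂
      have hr : ∀ a, s₂.realArr a = s.realArr a := fun a => (hs₂.2 a rfl).trans (hs₁.2 a rfl)
      refine ensures_testPair hT₂ (h.congr ((hs₂.1 0 rfl).trans (hs₁.1 0 rfl))
        ((hs₂.1 1 rfl).trans (hs₁.1 1 rfl)) (hr 0) (hr 1)) ht hu (hXs t ht) (hYs u hu)
        (fun c hc => by rw [hr]; exact hX t ht c hc) (fun c hc => by rw [hr]; exact hY u hu c hc)
        ((hs₂.1 7 rfl).trans h7₁) h8₂ hM hp hq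
  · intro s' hs'
    refine ⟨hs'.1, fun h0 r hr => hs'.2 h0 r (Or.inr ?_)⟩
    simp only [Set.mem_iUnion]
    exact ⟨r.1, hr.1, r.2, hr.2, rfl⟩

/-- Copy the strategy found for an agent to the output array. -/
def copyOut (side : Bool) : Program :=
  forLoop 18 (.var (own side))
    (.putReal (2 + own side) (.var 18) (cell side (15 + own side) (.var 18)))

/-- The copy is made even if no equilibrium was recorded, so the time bound is unconditional and the
content is described only for a stored strategy. -/
theorem ensures_copyOut {side : Bool} {d e : ℕ} {F : Fin e → Fin d → ℝ} {s : State}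
    (hd : s.var (own side) = d) (he : s.var (opp side) = e) {M : ℕ} (hM : 1 ≤ M) (hdM : d ≤ M) :
    Ensures (copyOut side) s ((28 * M ^ 1 : ℕ) : ℕ∞) fun s' =>
      ∀ x, Stored F s (listOf side) (s.var (15 + own side)) x →
        ∀ a : Fin d, s'.realArr (2 + own side) a = x a := by
  refine (ensures_forLoop (N := d) (fun k s' =>
      ∀ x, Stored F s (listOf side) (s.var (15 + own side)) x →
        ∀ a : Fin d, (a : ℕ) < k → s'.realArr (2 + own side) a = x a) ?_ ?_ ?_ ?_ ?_).mono
    (forLoop_bound (k := 0) (C := 10) hM hdM) fun s' h x hx a => h x hx a a.2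
  · intro s' hs'
    rw [NatExpr.eval, hs'.1 (own side) (by cases side <;> rfl), hd]
  · rfl
  · exact fun _ _ _ h => h
  · exact fun x _ a ha => absurd ha (Nat.not_lt_zero _)
  · intro k hk s' hs' h18 hI
    refine (ensures_putReal fun x hx a ha => ?_).mono (Q := _) ?_ fun _ h => h
    · rw [putReal_realArr]
      have hx' : Stored F s' (listOf side) (s.var (15 + own side)) x := fun c hc => by
        rw [hs'.2 (listOf side) (by cases side <;> rfl)]
        exact hx c hc
      have h1 : (NatExpr.var 18).eval s' = k := h18
      rw [h1, eval_cell hx' (by rw [hs'.1 (own side) (by cases side <;> rfl), hd])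
        (by rw [hs'.1 (opp side) (by cases side <;> rfl), he])
        (hs'.1 (15 + own side) (by cases side <;> rfl)) h1 (by omega)]
      by_cases hak : (a : ℕ) = k
      · rw [if_pos hak, ← hak, extFun_left]
      · rw [if_neg hak]
        exact hI x hx a (by omega)
    · rw [pow_zero, mul_one]
      cases side <;> exact Nat.cast_le.2 (by decide)

end Search

/-! ### The algorithm -/

section Solver

variable {p q : ℕ} {A B : Fin p → Fin q → ℝ}

/-- Look for coincidences, and initialize the candidate lists with the pure strategies. -/
def prepare : Program :=
  .seq coincidenceSearch (.seq (initList false) (initList true))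

/-- If there are coincidences, expand the candidate lists. -/
def expandLists : Program :=
  .ite (.natLe (.const 1) (.var 3)) (.seq (expandList false) (expandList true)) .nop

/-- Test all pairs of candidates, and output an equilibrium if one is found. -/
def selectPair : Program :=
  .seq testPairs (.seq (copyOut false) (copyOut true))

/-- The algorithm that finds strong equilibria of 2-agent games. -/
def solver : Program :=
  .seq prepare (.seq expandLists selectPair)

/-- The list of an agent consists of the pure strategies. -/
def PureList {d e : ℕ} (side : Bool) (F : Fin e → Fin d → ℝ) (s : State) : Prop :=
  s.var (listOf side) = d ∧ ∀ a : Fin d, Stored F s (listOf side) a (Pi.single a 1)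

theorem PureList.congr {d e : ℕ} {side : Bool} {F : Fin e → Fin d → ℝ} {s s' : State}
    (h : PureList side F s) (hv : s'.var (listOf side) = s.var (listOf side))
    (hr : s'.realArr (listOf side) = s.realArr (listOf side)) : PureList side F s' :=
  ⟨hv.trans h.1, fun a c hc => by rw [hr]; exact h.2 a c hc⟩

theorem PureList.listed {d e : ℕ} {side : Bool} {F : Fin e → Fin d → ℝ} {s : State}
    (h : PureList side F s) :
    Listed F s (listOf side) (s.var (listOf side)) (Set.range fun a : Fin d => Pi.single a 1) := by
  refine ⟨fun t => if ht : t < d then Pi.single ⟨t, ht⟩ 1 else 0, fun t ht => ?_, ?_⟩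
  · have ht : t < d := h.1 ▸ ht
    simp only [dif_pos ht]
    exact h.2 ⟨t, ht⟩
  · ext z
    rw [h.1]
    constructor
    · rintro ⟨a, rfl⟩
      exact ⟨a, a.2, by simp⟩
    · rintro ⟨t, ht, rfl⟩
      have ht : t < d := ht
      exact ⟨⟨t, ht⟩, by simp [ht]⟩

/-- The candidate lists consist of mixed strategies and contain an equilibrium if there is one. -/
def Complete (A B : Fin p → Fin q → ℝ) (s : State) : Prop :=
  ∃ LX LY, Listed (swp B) s 4 (s.var 4) LX ∧ Listed A s 5 (s.var 5) LY ∧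
    LX ⊆ stdSimplex ℝ (Fin p) ∧ LY ⊆ stdSimplex ℝ (Fin q) ∧
    ((∃ x y, BiSNE A B x y) → ∃ x ∈ LX, ∃ y ∈ LY, BiSNE A B x y)

/-- The answer in memory is correct. -/
def Solved (A B : Fin p → Fin q → ℝ) (s : State) : Prop :=
  (s.var 2 = 0 → ¬ ∃ x y, BiSNE A B x y) ∧
    (s.var 2 ≠ 0 → BiSNE A B (fun a => s.realArr 2 a) fun b => s.realArr 3 b)

theorem ensures_prepare {s : State} (h : HasGame A B s) (h3 : s.var 3 = 0)
    (hz4 : ∀ i, s.realArr 4 i = 0) (hz5 : ∀ i, s.realArr 5 i = 0) {M : ℕ} (hM : 1 ≤ M)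
    (hp : p ≤ M) (hq : q ≤ M) :
    Ensures prepare s
      ((((coincidenceTest.cost + 4) * 19 ^ 4 + (66 + 66)) * M ^ 4 : ℕ) : ℕ∞) fun s' =>
      (s'.var 3 ≠ 0 ↔ ∃ i k j l, Coincidence A B i k j l) ∧ PureList false (swp B) s' ∧
        PureList true A s' := by
  refine (ensures_coincidenceSearch h h3 hM hp hq).seq_poly fun s₁ hs₁ hf₁ => ?_
  have hg₁ : HasGame A B s₁ := h.congr (hf₁.1 0 rfl) (hf₁.1 1 rfl) (hf₁.2 0 rfl) (hf₁.2 1 rfl)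
  refine Ensures.seq_poly (Ensures.poly_mono (k := 2) hM (by norm_num)
    (ensures_initList false (F := swp B) hM hp hq hg₁.rows hg₁.cols
      (fun i => (congrFun (hf₁.2 4 rfl) i).trans (hz4 i)) ?_)) fun s₂ hs₂ hf₂ => ?_
  · intro s' hv1 _ hr1 a j ha hj
    simp only [oppPayoff, cond_false, RealExpr.eval, NatExpr.eval, ha, hj, hr1, hv1, hg₁.cols,
      hg₁.right, swp]
  have hg₂ : HasGame A B s₂ := hg₁.congr (hf₂.1 0 rfl) (hf₂.1 1 rfl) (hf₂.2 0 rfl) (hf₂.2 1 rfl)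
  refine Ensures.poly_mono (k := 2) hM (by norm_num)
    ((ensures_initList true (F := A) hM hq hp hg₂.cols hg₂.rows
      (fun i => (congrFun ((hf₂.2 5 rfl).trans (hf₁.2 5 rfl)) i).trans (hz5 i)) ?_).frame.mono
      le_rfl ?_)
  · intro s' hv1 hr0 _ a j ha hj
    simp only [oppPayoff, cond_true, RealExpr.eval, NatExpr.eval, ha, hj, hr0, hv1, hg₂.cols,
      hg₂.left]
  · rintro s₃ ⟨hs₃, hf₃⟩
    refine ⟨?_, PureList.congr (s := s₂) hs₂ (hf₃.1 4 rfl) (hf₃.2 4 rfl), hs₃⟩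
    rw [hf₃.1 3 rfl, hf₂.1 3 rfl]
    exact hs₁

theorem ensures_expandLists_of_coincidence {s : State} (h : HasGame A B s) (h3 : s.var 3 ≠ 0)
    (hX : PureList false (swp B) s) (hY : PureList true A s) :
    Ensures expandLists s ⊤ (Complete A B) := by
  have hs : ∀ d, (Set.range fun a : Fin d => (Pi.single a 1 : Fin d → ℝ)) ⊆ stdSimplex ℝ (Fin d) := by
    rintro d _ ⟨a, rfl⟩
    exact single_mem_stdSimplex ℝ a
  refine (ensures_ite (T := ⊤) (fun _ => ?_) fun hb => ?_).mono le_top fun _ h => h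
  · refine ((ensures_expandList (side := false) hX.listed (hs p) (fun a => ⟨a, rfl⟩) h.rows
      h.cols).seq (T' := ⊤) ?_).mono le_top fun _ h => h
    rintro s₁ ⟨LX, hLX, hCX⟩ hf₁
    have hY₁ : PureList true A s₁ := hY.congr (hf₁.1 5 rfl) (hf₁.2 5 rfl)
    refine (ensures_expandList (side := true) hY₁.listed (hs q) (fun a => ⟨a, rfl⟩)
      ((hf₁.1 1 rfl).trans h.cols) ((hf₁.1 0 rfl).trans h.rows)).frame.mono le_rfl ?_
    rintro s₂ ⟨⟨LY, hLY, hCY⟩, hf₂⟩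
    refine ⟨LX, LY, ?_, hLY, hCX.mem, hCY.mem, exists_biSNE_candidates hCX hCY⟩
    rw [hf₂.1 4 rfl]
    exact hLX.congr (hf₂.2 4 rfl)
  · exact absurd (Nat.one_le_iff_ne_zero.2 h3) hb

/-- Without coincidences the pure strategies are already complete, so the lists keep the lengths `p`
and `q`; the polynomial bound for testing all pairs rests on this. -/
theorem ensures_expandLists_of_no_coincidence {s : State} (h3 : s.var 3 = 0)
    (hc : ∀ i k j l, ¬ Coincidence A B i k j l)
    (hX : PureList false (swp B) s) (hY : PureList true A s) :
    Ensures expandLists s (5 : ℕ) fun s' => Complete A B s' ∧ s'.var 4 = p ∧ s'.var 5 = q := by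
  refine (ensures_ite (T := 1) (fun hb => ?_) fun _ => ensures_nop ⟨?_, hX.1, hY.1⟩).mono
    (by simp only [Test.cost, NatExpr.cost]; norm_num) fun _ h => h
  · exact absurd h3 (Nat.one_le_iff_ne_zero.1 hb)
  · refine ⟨_, _, hX.listed, hY.listed, ?_, ?_, ?_⟩
    · rintro _ ⟨a, rfl⟩
      exact single_mem_stdSimplex ℝ a
    · rintro _ ⟨a, rfl⟩
      exact single_mem_stdSimplex ℝ a
    · rintro ⟨x, y, h⟩
      obtain ⟨i, j, rfl, rfl⟩ := h.pure_of_no_coincidence hc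
      exact ⟨_, ⟨i, rfl⟩, _, ⟨j, rfl⟩, h⟩

theorem ensures_selectPair {s : State} (h : HasGame A B s) (h2 : s.var 2 = 0)
    (hC : Complete A B s) {M : ℕ} (hM : 1 ≤ M) (hp : p ≤ M) (hq : q ≤ M) (h4 : s.var 4 ≤ M)
    (h5 : s.var 5 ≤ M) :
    Ensures selectPair s
      (((2 + ((refuteTest.cost + 4) * 19 ^ 6 + 10) + 18 + 18 + (28 + 28)) * M ^ 8 : ℕ) : ℕ∞)
      (Solved A B) := by
  obtain ⟨_, _, ⟨X, hX, rfl⟩, ⟨Y, hY, rfl⟩, hXs, hYs, hex⟩ := hC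
  refine (ensures_testPairs h h2 (fun t ht => hXs ⟨t, ht, rfl⟩) (fun u hu => hYs ⟨u, hu, rfl⟩) hX hY
    hM hp hq h4 h5).seq_poly fun s₁ hs₁ hf₁ => ?_
  have hg₁ : HasGame A B s₁ := h.congr (hf₁.1 0 rfl) (hf₁.1 1 rfl) (hf₁.2 0 rfl) (hf₁.2 1 rfl)
  refine Ensures.seq_poly (Ensures.poly_mono hM (by norm_num)
    (ensures_copyOut (side := false) (F := swp B) hg₁.rows hg₁.cols hM hp)) fun s₂ hs₂ hf₂ => ?_
  refine Ensures.poly_mono hM (by norm_num)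
    ((ensures_copyOut (side := true) (F := A) ((hf₂.1 1 rfl).trans hg₁.cols)
      ((hf₂.1 0 rfl).trans hg₁.rows) hM hq).frame.mono le_rfl ?_)
  rintro s₃ ⟨hs₃, hf₃⟩
  have h2₃ : s₃.var 2 = s₁.var 2 := (hf₃.1 2 rfl).trans (hf₂.1 2 rfl)
  refine ⟨fun h0 hS => ?_, fun h0 => ?_⟩
  · rw [h2₃] at h0
    obtain ⟨_, ⟨t, ht, rfl⟩, _, ⟨u, hu, rfl⟩, hS⟩ := hex hS
    exact hs₁.2 h0 (t, u) ⟨ht, hu⟩ hS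
  · rw [h2₃] at h0
    obtain ⟨h15, h16, hS⟩ := hs₁.1 h0
    have hx := hs₂ (X (s₁.var 15)) fun c hc =>
      (congrFun (hf₁.2 4 rfl) _).trans (hX _ h15 c hc)
    have hv : s₂.var 16 = s₁.var 16 := hf₂.1 16 rfl
    have hy := hs₃ (Y (s₁.var 16)) fun c hc => by
      change s₂.realArr 5 (s₂.var 16 * _ + c) = _
      rw [hv]
      exact (congrFun ((hf₂.2 5 rfl).trans (hf₁.2 5 rfl)) _).trans (hY _ h16 c hc)
    have hr2 : s₃.realArr 2 = s₂.realArr 2 := hf₃.2 2 rfl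
    have ex : (fun a : Fin p => s₃.realArr 2 a) = X (s₁.var 15) := by
      funext a
      rw [hr2]
      exact hx a
    have ey : (fun b : Fin q => s₃.realArr 3 b) = Y (s₁.var 16) := funext hy
    rwa [ex, ey]

/-- Initial states for the algorithm. -/
structure IsInitial (A B : Fin p → Fin q → ℝ) (s : State) : Prop where
  game : HasGame A B s
  var_eq : ∀ v, 2 ≤ v → s.var v = 0
  real_eq : ∀ arr i, 2 ≤ arr → s.realArr arr i = 0

theorem ensures_solver {s : State} (h : IsInitial A B s) :
    Ensures solver s ⊤ (Solved A B) := by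
  have hM : 1 ≤ max 1 (max p q) := le_max_left _ _
  have hp : p ≤ max 1 (max p q) := (le_max_left _ _).trans (le_max_right _ _)
  have hq : q ≤ max 1 (max p q) := (le_max_right _ _).trans (le_max_right _ _)
  refine ((ensures_prepare h.game (h.var_eq 3 (by norm_num)) (fun i => h.real_eq 4 i (by norm_num))
    (fun i => h.real_eq 5 i (by norm_num)) hM hp hq).seq (T' := ⊤) ?_).mono le_top fun _ h => h
  rintro s₁ ⟨h3, hX, hY⟩ hf₁
  have hg₁ : HasGame A B s₁ :=
    h.game.congr (hf₁.1 0 rfl) (hf₁.1 1 rfl) (hf₁.2 0 rfl) (hf₁.2 1 rfl)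
  have hexp : Ensures expandLists s₁ ⊤ (Complete A B) := by
    by_cases h0 : s₁.var 3 = 0
    · refine (ensures_expandLists_of_no_coincidence h0 (fun i k j l hc => ?_) hX hY).mono le_top
        fun _ h => h.1
      exact h3.2 ⟨i, k, j, l, hc⟩ h0
    · exact ensures_expandLists_of_coincidence hg₁ h0 hX hY
  refine (hexp.seq (T' := ⊤) fun s₂ hC hf₂ => ?_).mono le_top fun _ h => h
  -- The bound may depend on the final list lengths, because it is discarded for `⊤`.
  refine (ensures_selectPair (M := max (max 1 (max p q)) (max (s₂.var 4) (s₂.var 5)))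
    (hg₁.congr (hf₂.1 0 rfl) (hf₂.1 1 rfl) (hf₂.2 0 rfl) (hf₂.2 1 rfl))
    ((hf₂.1 2 rfl).trans ((hf₁.1 2 rfl).trans (h.var_eq 2 le_rfl))) hC (hM.trans (le_max_left _ _))
    (hp.trans (le_max_left _ _)) (hq.trans (le_max_left _ _))
    ((le_max_left _ _).trans (le_max_right _ _))
    ((le_max_right _ _).trans (le_max_right _ _))).mono le_top fun _ h => h

/-- The constant in the running time. -/
def solverConst : ℕ :=
  (coincidenceTest.cost + 4) * 19 ^ 4 + (66 + 66) +
    (5 + (2 + ((refuteTest.cost + 4) * 19 ^ 6 + 10) + 18 + 18 + (28 + 28)))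

theorem ensures_solver_of_no_coincidence {s : State} (h : IsInitial A B s)
    (hc : ∀ i k j l, ¬ Coincidence A B i k j l) {M : ℕ} (hM : 1 ≤ M) (hp : p ≤ M) (hq : q ≤ M) :
    Ensures solver s ((solverConst * M ^ 8 : ℕ) : ℕ∞) (Solved A B) := by
  refine Ensures.seq_poly (Ensures.poly_mono hM (by norm_num) (ensures_prepare h.game
    (h.var_eq 3 (by norm_num)) (fun i => h.real_eq 4 i (by norm_num))
    (fun i => h.real_eq 5 i (by norm_num)) hM hp hq)) ?_
  rintro s₁ ⟨h3, hX, hY⟩ hf₁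
  have hg₁ : HasGame A B s₁ :=
    h.game.congr (hf₁.1 0 rfl) (hf₁.1 1 rfl) (hf₁.2 0 rfl) (hf₁.2 1 rfl)
  have h0 : s₁.var 3 = 0 := by
    by_contra h0
    obtain ⟨i, k, j, l, h⟩ := h3.1 h0
    exact hc i k j l h
  refine Ensures.seq_poly (Ensures.poly_of_const 8 hM
    (ensures_expandLists_of_no_coincidence h0 hc hX hY)) ?_
  rintro s₂ ⟨hC, h4, h5⟩ hf₂
  exact ensures_selectPair (hg₁.congr (hf₂.1 0 rfl) (hf₂.1 1 rfl) (hf₂.2 0 rfl) (hf₂.2 1 rfl))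
    ((hf₂.1 2 rfl).trans ((hf₁.1 2 rfl).trans (h.var_eq 2 le_rfl))) hC hM hp hq (h4.le.trans hp)
    (h5.le.trans hq)

end Solver

/-! ### Input games: correctness and smoothed running time -/

section Main

theorem isInitial_inputState {m : Fin 2 → ℕ} (U : Game m) :
    IsInitial (payoffMatrix U 0) (payoffMatrix U 1) (inputState U) := by
  -- Row-major addresses are injective, so exactly one summand of the input sum survives.
  have hcell : ∀ (i : Fin 2) (a : Fin (m 0)) (b : Fin (m 1)),
      (inputState U).realArr i.val (a * m 1 + b) = payoffMatrix U i a b := by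
    intro i a b
    simp only [inputState]
    rw [Finset.sum_eq_single i, sum_profile, Finset.sum_eq_single a, Finset.sum_eq_single b]
    · rw [if_pos ⟨rfl, rfl⟩]
      rfl
    · intro b' _ hb
      rw [if_neg]
      rintro ⟨_, h⟩
      exact cell_ne b.2 b'.2 (Or.inr fun h => hb (Fin.ext h.symm)) h
    · simp
    · intro a' _ ha
      refine Finset.sum_eq_zero fun b' _ => ?_
      rw [if_neg]
      rintro ⟨_, h⟩
      exact cell_ne b.2 b'.2 (Or.inl fun h => ha (Fin.ext h.symm)) h
    · simp
    · intro i' _ hi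
      refine Finset.sum_eq_zero fun a' _ => ?_
      rw [if_neg]
      rintro ⟨h, _⟩
      exact hi (Fin.ext h.symm)
    · simp
  refine ⟨⟨rfl, rfl, hcell 0, hcell 1⟩, fun v hv => ?_, fun arr i harr => ?_⟩
  · simp only [inputState]
    rw [if_neg (by omega), if_neg (by omega)]
  · simp only [inputState]
    refine Finset.sum_eq_zero fun j _ => Finset.sum_eq_zero fun a _ => ?_
    rw [if_neg]
    rintro ⟨h, _⟩
    omega

theorem findsSNE_solver : FindsSNE solver := by
  intro m _ U
  obtain ⟨t, s, hrun, _, h1, h2⟩ := ensures_solver (isInitial_inputState U)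
  refine ⟨t, s, hrun, ?_⟩
  unfold output
  split_ifs with h0
  · rintro ⟨x, hx⟩
    exact h1 h0 ⟨x 0, x 1, (isSNE_iff_biSNE U x).1 hx⟩
  · exact (isSNE_iff_biSNE U _).2 (h2 h0)

theorem time_solver_le {m : Fin 2 → ℕ} (hm : ∀ i, 1 ≤ m i) {V : Game m}
    (hc : ∀ i k j l, ¬ Coincidence (payoffMatrix V 0) (payoffMatrix V 1) i k j l) :
    solver.time (inputState V) ≤ ((solverConst * max (m 0) (m 1) ^ 8 : ℕ) : ℝ≥0∞) := by
  obtain ⟨t, s, hrun, ht, _⟩ := ensures_solver_of_no_coincidence (isInitial_inputState V) hc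
    ((hm 0).trans (le_max_left _ (m 1))) (le_max_left _ _) (le_max_right _ _)
  exact (iInf₂_le t ⟨s, hrun⟩).trans (Nat.cast_le.2 (Nat.cast_le.1 ht))

/-- The polynomial bound holds almost surely, so it passes to the integral against a probability
measure; the slow branch does not contribute. -/
theorem smoothedTime_solver_le (D : PerturbationModel) {σ : ℝ} (hσ : 0 < σ) {m : Fin 2 → ℕ}
    (hm : ∀ i, 1 ≤ m i) (U : Game m) :
    smoothedTime solver D σ U ≤ ((solverConst * max (m 0) (m 1) ^ 8 : ℕ) : ℝ≥0∞) := by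
  have := isProbabilityMeasure_noise D hσ m
  calc smoothedTime solver D σ U
      ≤ ∫⁻ _, ((solverConst * max (m 0) (m 1) ^ 8 : ℕ) : ℝ≥0∞) ∂(D.noise σ m) :=
        lintegral_mono_ae ((ae_noise_of_ae_volume D hσ U (ae_no_coincidence m)).mono
          fun Z hZ => time_solver_le hm hZ)
    _ = _ := by simp

theorem solverConst_pos : 0 < solverConst := by
  unfold solverConst
  omega

theorem smoothedPolynomialTime_solver (D : PerturbationModel) : SmoothedPolynomialTime solver D := by
  refine ⟨solverConst, 8, 1, by exact_mod_cast solverConst_pos, by norm_num, by norm_num,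
    fun σ h0 h1 m hm U => (smoothedTime_solver_le D h0 hm U).trans ?_⟩
  rw [← ENNReal.ofReal_natCast]
  refine ENNReal.ofReal_le_ofReal ?_
  -- The bound does not involve `σ`; any positive exponent would do, since the factor is at least
  -- one for `σ < 1`.
  have h2 : (1 : ℝ) ≤ σ ^ (-1 : ℝ) := by
    rw [Real.rpow_neg_one]
    exact (one_le_inv₀ h0).2 h1.le
  have h3 : (((max (m 0) (m 1) : ℕ) : ℝ) ^ (8 : ℝ)) = ((max (m 0) (m 1) : ℕ) : ℝ) ^ (8 : ℕ) := by
    rw [← Real.rpow_natCast]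
    norm_num
  rw [h3, Nat.cast_mul, Nat.cast_pow]
  exact le_mul_of_one_le_right (by positivity) h2

end Main

end StrongNash

theorem theorem5p1 :
    (∃ p : StrongNash.Program, StrongNash.FindsSNE p ∧
      ∀ D : StrongNash.PerturbationModel, StrongNash.SmoothedPolynomialTime p D) ∧
    (∀ (D : StrongNash.PerturbationModel) (σ : ℝ), 0 < σ →
      ∀ (n : ℕ) (m : Fin n → ℕ) (U : StrongNash.Game m),
        ∀ᵐ Z ∂(D.noise σ m), ∀ x : StrongNash.Strategies m,
          StrongNash.IsSNE (U + Z) x → StrongNash.IsPure x) :=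
  ⟨⟨StrongNash.solver, StrongNash.findsSNE_solver, StrongNash.smoothedPolynomialTime_solver⟩,
    fun D _ hσ _ _ U => StrongNash.ae_noise_of_ae_volume D hσ U StrongNash.ae_sne_isPure⟩
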